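/- **Theorem 3.1.3.** Let $k$ be a field of characteristic $0$, let $\mathcal C$ be a pseudo-tensor $k$-category in the sense of Beilinson–Drinfeld, and let $B^\bullet$ be a cosimplicial Lie algebra in $\mathcal C$, i.e. a functor $[m]\mapsto B^m$ from the simplex category $\Delta$ to the category of Lie algebras in $\mathcal C$ (a Lie algebra in $\mathcal C$ is a pseudo-tensor functor $\mathcal Lie\to\mathcal C$). Let $MB$ be the complex in $\mathcal C$ with $(MB)^m=B^m$ for $m\ge 0$, zero in negative degrees, with the alternating sum of the cofaces as differential. For complexes $y_i$ $(1\le i\le n)$ and $x$ in $\mathcal C$ let $P_n(\{y_i\},x)$ be the total complex of the $P_n(\{y_i^{l_i}\},x^{l})$; its elements of degree $d$ are the families with entries in $P_n(\{y_i^{l_i}\},x^{l})$ for $l=l_1+\dots+l_n+d$. With the Koszul sign rule these complexes make the complexes in $\mathcal C$ a pseudo-tensor category $\mathcal C_{\mathcal C(k)}$ enriched in complexes of $k$-vector spaces. For $m\ge0$ let $Z([m])$ be the complex of (unnormalized) chains of the standard simplex $\Delta^m$: its component of degree $-l$ has the basis $\mathrm{Hom}_\Delta([l],[m])$. Let $$\mathcal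 Z(n)=\mathrm{Tot}\,\mathrm{Hom}_{\Delta(k)}(Z,Z^{\otimes n})$$ be the Eilenberg–Zilber operad: an element of degree $d$ of $\mathcal Z(n)$ is a family of linear maps $Z([m])\to Z([m])^{\otimes n}$ of degree $d$, natural in $[m]\in\Delta$; the differential is $D\phi=\phi\circ d-(-1)^{d}\,d\circ\phi$ for $\phi$ of degree $d$, the symmetric group permutes the tensor factors with the Koszul sign, and the composition is $(\phi;\phi_1,\dots,\phi_n)\mapsto(\phi_1\otimes\dots\otimes\phi_n)\circ\phi$, where for $\phi_i$ of degree $r_i$ and simplices $p_i$ $$(\phi_1\otimes\dots\otimes\phi_n)(p_1\otimes\dots\otimes p_n)=\prod_{i<j}(-1)^{r_j(r_i-\dim p_i)}\;\phi_1(p_1)\otimes\dots\otimes\phi_n(p_n).$$ Let $\mathcal Y=\mathcal Lie\otimes\mathcal Z$, $\mathcal Y(n)=\mathcal Lie(n)\otimes_k\mathcal Z(n)$, be the Lie Eilenberg–Zilber operad. For $\psi\in\mathcal Lie(n)$ let $\psi_m\in P_n(\{B^m\},B^m)$ be its image under the Lie structure map of $B^m$. For $\phi\in\mathcal Z(n)$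 of degree $d$ write $$\phi(\mathrm{id}_{[m]})=\sum_{p_1,\dots,p_n}\alpha_{p_1,\dots,p_n}\;p_1\otimes\dots\otimes p_n,\qquad p_i:[l_i]\to[m],$$ so that only terms with $m=l_1+\dots+l_n+d$ occur. Define linear maps $F_n:\mathcal Lie(n)\otimes\mathcal Z(n)\to P_n(\{MB\},MB)$, $n\ge1$, by letting the entry of $F_n(\psi\otimes\phi)$ in $P_n(\{B^{l_1},\dots,B^{l_n}\},B^{m})$ be $$F_n(\psi\otimes\phi)_{l_1,\dots,l_n;m}=\sum_{p_i:[l_i]\to[m]}\alpha_{p_1,\dots,p_n}\;\psi_m\circ\bigl(B(p_1),\dots,B(p_n)\bigr),$$ the composition being that of $\mathcal C$; this entry is $0$ unless $m=l_1+\dots+l_n+d$. Then $\mathcal C_{\mathcal C(k)}$ is a pseudo-tensor category enriched in complexes, $\mathcal Y$ is an operad in complexes, and the maps $F_n$ form a pseudo-tensor functor $\mathcal Y=\mathcal Lie\otimes\mathcal Z\to\mathcal C_{\mathcal C(k)}$ sending the unique object to $MB$: they are morphisms of complexes and respect compositions, identities and permutations of the arguments. Hence $MB$ is a homotopy Lie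 algebra in $\mathcal C_{\mathcal C(k)}$. Explicitly: the canonical truncation $\tau_{\le0}\mathcal Y$ is a suboperad of $\mathcal Y$; it is a homotopy Lie operad, i.e. the augmentation $\epsilon:\tau_{\le 0}\mathcal Y\to\mathcal Lie$ ($\mathcal Lie$ being placed in degree $0$), which takes $\psi\otimes\phi$ with $\phi$ of degree $0$ to $\alpha\,\psi$, where $\phi(\mathrm{id}_{[0]})=\alpha\,\mathrm{id}_{[0]}\otimes\dots\otimes\mathrm{id}_{[0]}$, and which is zero in negative degrees, is a morphism of operads and a quasi-isomorphism in each arity; and the restrictions of the $F_n$ form a pseudo-tensor functor $\tau_{\le0}\mathcal Y\to\mathcal C_{\mathcal C(k)}$ sending the unique object to $MB$. -/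

import Mathlib

universe u v w v' w'

set_option linter.checkUnivs false

open CategoryTheory Simplicial TensorProduct

noncomputable section

namespace HomotopyLie

instance nonemptySigma {I : Type} {J : I → Type} [Nonempty I] [∀ i, Nonempty (J i)] :
    Nonempty (Σ i, J i) :=
  ⟨⟨Classical.arbitrary I, Classical.arbitrary _⟩⟩

/-- `(Σ _ : Unit, I) ≃ I`. -/
abbrev unitSigma (I : Type) : (Σ _ : Unit, I) ≃ I where
  toFun p := p.2
  invFun i := ⟨(), i⟩
  left_inv _ := rfl
  right_inv _ := rfl

/-- `(Σ _ : I, Unit) ≃ I`. -/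
abbrev sigmaUnit (I : Type) : (Σ _ : I, Unit) ≃ I where
  toFun p := p.1
  invFun i := ⟨i, ()⟩
  left_inv _ := rfl
  right_inv _ := rfl

/-! ### Pseudo-tensor `k`-categories -/

/-- A pseudo-tensor `k`-category.  To a finite non-empty set `I`, objects `y i` (`i : I`) and an
object `x` it assigns the `k`-vector space of operations `P I y x`.  The composition of
`f ∈ P I y x` with `g i ∈ P (J i) (z i) (y i)` is an operation with inputs indexed by the disjoint
union `Σ i, J i`; together with the transport `map` of operations along bijections of index sets,
this is the composition along an arbitrary surjection `π : J → I` (the disjoint union of the fibres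
of `π` is identified with `J`). -/
structure PTCat (k : Type u) [Field k] where
  /-- objects -/
  Ob : Type v
  /-- operations -/
  P : ∀ (I : Type) [Finite I] [Nonempty I], (I → Ob) → Ob → Type w
  [addCommGroup : ∀ (I : Type) [Finite I] [Nonempty I] (y : I → Ob) (x : Ob),
    AddCommGroup (P I y x)]
  [module : ∀ (I : Type) [Finite I] [Nonempty I] (y : I → Ob) (x : Ob), Module k (P I y x)]
  /-- transport along bijections of index sets -/
  map : ∀ {I I' : Type} [Finite I] [Nonempty I] [Finite I'] [Nonempty I'] (e : I ≃ I')
    {y : I' → Ob} {x : Ob}, P I (fun i => y (e i)) x →ₗ[k] P I' y x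
  /-- identity operations -/
  id : ∀ x : Ob, P Unit (fun _ => x) x
  /-- polylinear composition -/
  comp : ∀ {I : Type} [Finite I] [Nonempty I] {J : I → Type} [∀ i, Finite (J i)]
    [∀ i, Nonempty (J i)] {z : ∀ i, J i → Ob} {y : I → Ob} {x : Ob},
    P I y x →ₗ[k] MultilinearMap k (fun i => P (J i) (z i) (y i))
      (P (Σ i, J i) (fun p => z p.1 p.2) x)
  map_refl : ∀ {I : Type} [Finite I] [Nonempty I] {y : I → Ob} {x : Ob} (f : P I y x),
    map (Equiv.refl I) f = f
  map_trans : ∀ {I I' I'' : Type} [Finite I] [Nonempty I] [Finite I'] [Nonempty I']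
    [Finite I''] [Nonempty I''] (e : I ≃ I') (e' : I' ≃ I'') {y : I'' → Ob} {x : Ob}
    (f : P I (fun i => y (e' (e i))) x),
    map (y := y) (e.trans e') f = map e' (map (y := fun i => y (e' i)) e f)
  comp_map_right : ∀ {I : Type} [Finite I] [Nonempty I] {J J' : I → Type} [∀ i, Finite (J i)]
    [∀ i, Nonempty (J i)] [∀ i, Finite (J' i)] [∀ i, Nonempty (J' i)]
    (e : ∀ i, J i ≃ J' i) {z : ∀ i, J' i → Ob} {y : I → Ob} {x : Ob} (f : P I y x)
    (g : ∀ i, P (J i) (fun j => z i (e i j)) (y i)),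
    comp f (fun i => map (y := z i) (e i) (g i)) =
      map (y := fun p => z p.1 p.2) (Equiv.sigmaCongrRight e) (comp f g)
  comp_map_left : ∀ {I I' : Type} [Finite I] [Nonempty I] [Finite I'] [Nonempty I'] (e : I ≃ I')
    {J : I' → Type} [∀ i, Finite (J i)] [∀ i, Nonempty (J i)]
    {z : ∀ i, J i → Ob} {y : I' → Ob} {x : Ob} (f : P I (fun i => y (e i)) x)
    (g : ∀ i, P (J i) (z i) (y i)),
    comp (map (y := y) e f) g =
      map (y := fun p => z p.1 p.2) (Equiv.sigmaCongrLeft e)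
        (comp (z := fun i => z (e i)) f (fun i => g (e i)))
  assoc : ∀ {I : Type} [Finite I] [Nonempty I] {J : I → Type} [∀ i, Finite (J i)]
    [∀ i, Nonempty (J i)] {H : ∀ i, J i → Type} [∀ i j, Finite (H i j)] [∀ i j, Nonempty (H i j)]
    {t : ∀ i j, H i j → Ob} {z : ∀ i, J i → Ob} {y : I → Ob} {x : Ob}
    (f : P I y x) (g : ∀ i, P (J i) (z i) (y i)) (h : ∀ i j, P (H i j) (t i j) (z i j)),
    map (y := fun p => t p.1 p.2.1 p.2.2) (Equiv.sigmaAssoc H)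
        (comp (J := fun p : Σ i, J i => H p.1 p.2) (z := fun p => t p.1 p.2)
          (y := fun p => z p.1 p.2) (comp f g) (fun p => h p.1 p.2)) =
      comp (J := fun i => Σ j, H i j) (z := fun i p => t i p.1 p.2) f
        (fun i => comp (J := H i) (z := t i) (y := z i) (g i) (h i))
  id_comp : ∀ {I : Type} [Finite I] [Nonempty I] {y : I → Ob} {x : Ob} (f : P I y x),
    map (unitSigma I) (comp (J := fun _ => I) (z := fun _ => y) (id x) (fun _ => f)) = f
  comp_id : ∀ {I : Type} [Finite I] [Nonempty I] {y : I → Ob} {x : Ob} (f : P I y x),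
    map (sigmaUnit I) (comp (J := fun _ => Unit) (z := fun i _ => y i) f (fun i => id (y i))) = f

attribute [instance] PTCat.addCommGroup PTCat.module

variable {k : Type u} [Field k]

namespace PTCat

variable (C : PTCat.{u, v, w} k)

/-- `g ∘ f` for an operation `f` and a unary operation `g`. -/
def post {I : Type} [Finite I] [Nonempty I] {y : I → C.Ob} {x x' : C.Ob}
    (g : C.P Unit (fun _ => x) x') (f : C.P I y x) : C.P I y x' :=
  C.map (unitSigma I) (C.comp (J := fun _ => I) (z := fun _ => y) g (fun _ => f))

/-- `f ∘ (h i)_i` for an operation `f` and unary operations `h i`. -/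
def pre {I : Type} [Finite I] [Nonempty I] {z y : I → C.Ob} {x : C.Ob}
    (f : C.P I y x) (h : ∀ i, C.P Unit (fun _ => z i) (y i)) : C.P I z x :=
  C.map (sigmaUnit I) (C.comp (J := fun _ => Unit) (z := fun i _ => z i) f h)

end PTCat

section LieOperad

/-! ### The Lie operad -/

/-- The value of a bracket monomial at a family of elements of a Lie algebra. -/
def evalWord {I : Type} {L : Type*} [LieRing L] (v : I → L) (t : FreeMagma I) : L :=
  match t with
  | .of i => v i
  | .mul a b => ⁅evalWord v a, evalWord v b⁆

open Classical in
/-- The number of occurrences of each letter in a bracket monomial. -/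
def occ {I : Type} (t : FreeMagma I) : I → ℕ :=
  match t with
  | .of i => Pi.single i 1
  | .mul a b => occ a + occ b

variable (k) in
/-- The part of multidegree `e` of the free Lie algebra on `I`: the span of the bracket monomials
in which the letter `i` occurs exactly `e i` times. -/
def lieDeg {I : Type} (e : I → ℕ) : Submodule k (FreeLieAlgebra k I) :=
  Submodule.span k {x | ∃ w : FreeMagma I, occ w = e ∧ evalWord (FreeLieAlgebra.of k) w = x}

variable (k) in
/-- `Lie(I)`: the multilinear part of the free Lie algebra on `I`. -/
abbrev Lie (I : Type) : Submodule k (FreeLieAlgebra k I) := lieDeg k (fun _ : I => 1)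

lemma lift_evalWord {I : Type} {L : Type*} [LieRing L] [LieAlgebra k L] (v : I → L)
    (w : FreeMagma I) :
    FreeLieAlgebra.lift k v (evalWord (FreeLieAlgebra.of k) w) = evalWord v w := by
  induction w using FreeMagma.rec with
  | of i => simp [evalWord]
  | mul a b ha hb => simp only [evalWord, LieHom.map_lie, ha, hb]

lemma lie_mem_lieDeg {I : Type} {e e' : I → ℕ} {x y : FreeLieAlgebra k I}
    (hx : x ∈ lieDeg k e) (hy : y ∈ lieDeg k e') : ⁅x, y⁆ ∈ lieDeg k (e + e') := by
  induction hx using Submodule.span_induction with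
  | mem x hx =>
    obtain ⟨a, ha, rfl⟩ := hx
    induction hy using Submodule.span_induction with
    | mem y hy =>
      obtain ⟨b, hb, rfl⟩ := hy
      exact Submodule.subset_span ⟨.mul a b, by simp [occ, ha, hb], rfl⟩
    | zero => simp
    | add y y' _ _ h h' => rw [lie_add]; exact add_mem h h'
    | smul r y _ h => rw [lie_smul]; exact Submodule.smul_mem _ r h
  | zero => simp
  | add y y' _ _ h h' => rw [add_lie]; exact add_mem h h'
  | smul r y _ h => rw [smul_lie]; exact Submodule.smul_mem _ r h

/-- Renaming of letters. -/
def lieRename {I I' : Type} (e : I → I') : FreeLieAlgebra k I →ₗ⁅k⁆ FreeLieAlgebra k I' :=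
  FreeLieAlgebra.lift k (fun i => FreeLieAlgebra.of k (e i))

open Classical in
lemma lieRename_mem {I I' : Type} {e : I → I'} (he : Function.Injective e) {c : I → ℕ}
    {c' : I' → ℕ} (hc : ∀ i, c' (e i) = c i) (hc' : ∀ i', (∀ i, e i ≠ i') → c' i' = 0)
    {x : FreeLieAlgebra k I} (hx : x ∈ lieDeg k c) : lieRename (k := k) e x ∈ lieDeg k c' := by
  have key : ∀ w : FreeMagma I, ∃ w' : FreeMagma I',
      (∀ i, occ w' (e i) = occ w i) ∧ (∀ i', (∀ i, e i ≠ i') → occ w' i' = 0) ∧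
      evalWord (FreeLieAlgebra.of k) w' = lieRename (k := k) e (evalWord (FreeLieAlgebra.of k) w) := by
    intro w
    induction w using FreeMagma.rec with
    | of i =>
      refine ⟨.of (e i), fun j => ?_, fun i' h => ?_, ?_⟩
      · simp [occ, Pi.single_apply, he.eq_iff]
      · simp [occ, (h i).symm]
      · simp [evalWord, lieRename]
    | mul a b ha hb =>
      obtain ⟨a', h1, h2, h3⟩ := ha
      obtain ⟨b', h4, h5, h6⟩ := hb
      refine ⟨.mul a' b', fun j => ?_, fun i' h => ?_, ?_⟩
      · simp [occ, h1, h4]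
      · simp [occ, h2 i' h, h5 i' h]
      · simp only [evalWord, LieHom.map_lie, h3, h6]
  induction hx using Submodule.span_induction with
  | mem x hx =>
    obtain ⟨a, ha, rfl⟩ := hx
    obtain ⟨a', h1, h2, h3⟩ := key a
    refine Submodule.subset_span ⟨a', ?_, h3⟩
    funext i'
    by_cases h : ∃ i, e i = i'
    · obtain ⟨i, rfl⟩ := h
      rw [h1, hc, ha]
    · push Not at h
      rw [h2 i' h, hc' i' h]
  | zero => simp
  | add y y' _ _ h h' => rw [map_add]; exact add_mem h h'
  | smul r y _ h => rw [map_smul]; exact Submodule.smul_mem _ r h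

/-- Substitution: the letter `i` is replaced by the Lie polynomial `g i`, with letters `⟨i, j⟩`. -/
def lieSubst {I : Type} {J : I → Type} (g : ∀ i, FreeLieAlgebra k (J i)) :
    FreeLieAlgebra k I →ₗ⁅k⁆ FreeLieAlgebra k (Σ i, J i) :=
  FreeLieAlgebra.lift k (fun i => lieRename (fun j => (⟨i, j⟩ : Σ i, J i)) (g i))

open Classical in
lemma lieSubst_mem {I : Type} {J : I → Type} {g : ∀ i, FreeLieAlgebra k (J i)}
    (hg : ∀ i, g i ∈ Lie k (J i)) {x : FreeLieAlgebra k I} (hx : x ∈ Lie k I) :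
    lieSubst g x ∈ Lie k (Σ i, J i) := by
  have key : ∀ w : FreeMagma I,
      evalWord (fun i => lieRename (k := k) (fun j => (⟨i, j⟩ : Σ i, J i)) (g i)) w ∈
        lieDeg k (fun p : Σ i, J i => occ w p.1) := by
    intro w
    induction w using FreeMagma.rec with
    | of i =>
      refine lieRename_mem sigma_mk_injective (fun j => ?_) (fun p hp => ?_) (hg i)
      · simp [occ]
      · obtain ⟨i', j⟩ := p
        by_cases h : i' = i
        · subst h
          exact absurd rfl (hp j)
        · simp [occ, h]
    | mul a b ha hb => exact lie_mem_lieDeg ha hb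
  induction hx using Submodule.span_induction with
  | mem x hx =>
    obtain ⟨a, ha, rfl⟩ := hx
    have := key a
    rw [ha] at this
    rwa [lieSubst, lift_evalWord]
  | zero => simp
  | add y y' _ _ h h' => rw [map_add]; exact add_mem h h'
  | smul r y _ h => rw [map_smul]; exact Submodule.smul_mem _ r h

lemma evalWord_update {I : Type} [DecidableEq I] {L : Type*} [LieRing L] [LieAlgebra k L]
    (v : I → L) (i : I) (w : FreeMagma I) :
    (occ w i = 0 → ∀ a, evalWord (Function.update v i a) w = evalWord v w) ∧
    (occ w i = 1 →
      (∀ a b, evalWord (Function.update v i (a + b)) w =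
        evalWord (Function.update v i a) w + evalWord (Function.update v i b) w) ∧
      (∀ (r : k) a, evalWord (Function.update v i (r • a)) w =
        r • evalWord (Function.update v i a) w)) := by
  induction w using FreeMagma.rec with
  | of j =>
    by_cases h : j = i
    · subst h
      simp [occ, evalWord]
    · simp [occ, evalWord, h, Ne.symm h]
  | mul a b ha hb =>
    refine ⟨fun h c => ?_, fun h => ?_⟩
    · have h' : occ a i + occ b i = 0 := h
      simp only [evalWord, ha.1 (by omega), hb.1 (by omega)]
    · have h' : occ a i + occ b i = 1 := h
      rcases Nat.eq_zero_or_pos (occ a i) with h0 | h0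
      · have h1 : occ b i = 1 := by omega
        simp only [evalWord, ha.1 h0, (hb.2 h1).1, (hb.2 h1).2, lie_add, lie_smul,
          implies_true, and_self]
      · have h1 : occ a i = 1 := by omega
        have h2 : occ b i = 0 := by omega
        simp only [evalWord, hb.1 h2, (ha.2 h1).1, (ha.2 h1).2, add_lie, smul_lie,
          implies_true, and_self]

lemma lieSubst_update_add {I : Type} [DecidableEq I] {J : I → Type}
    (g : ∀ i, FreeLieAlgebra k (J i)) (i : I) (a b : FreeLieAlgebra k (J i))
    {x : FreeLieAlgebra k I} (hx : x ∈ Lie k I) :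
    lieSubst (Function.update g i (a + b)) x =
      lieSubst (Function.update g i a) x + lieSubst (Function.update g i b) x := by
  have hu : ∀ c, (fun i' => lieRename (k := k) (fun j => (⟨i', j⟩ : Σ i, J i))
      (Function.update g i c i')) = Function.update
        (fun i' => lieRename (k := k) (fun j => (⟨i', j⟩ : Σ i, J i)) (g i')) i
        (lieRename (k := k) (fun j => (⟨i, j⟩ : Σ i, J i)) c) := by
    intro c
    funext i'
    by_cases h : i' = i
    · subst h; simp
    · simp [h]
  simp only [lieSubst, hu, map_add]
  induction hx using Submodule.span_induction with
  | mem x hx =>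
    obtain ⟨w, hw, rfl⟩ := hx
    simp only [lift_evalWord]
    exact ((evalWord_update (k := k) _ i w).2 (by rw [hw])).1 _ _
  | zero => simp
  | add y y' _ _ h h' => simp only [map_add, h, h']; abel
  | smul r y _ h => simp only [map_smul, h, smul_add]

lemma lieSubst_update_smul {I : Type} [DecidableEq I] {J : I → Type}
    (g : ∀ i, FreeLieAlgebra k (J i)) (i : I) (r : k) (a : FreeLieAlgebra k (J i))
    {x : FreeLieAlgebra k I} (hx : x ∈ Lie k I) :
    lieSubst (Function.update g i (r • a)) x = r • lieSubst (Function.update g i a) x := by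
  have hu : ∀ c, (fun i' => lieRename (k := k) (fun j => (⟨i', j⟩ : Σ i, J i))
      (Function.update g i c i')) = Function.update
        (fun i' => lieRename (k := k) (fun j => (⟨i', j⟩ : Σ i, J i)) (g i')) i
        (lieRename (k := k) (fun j => (⟨i, j⟩ : Σ i, J i)) c) := by
    intro c
    funext i'
    by_cases h : i' = i
    · subst h; simp
    · simp [h]
  simp only [lieSubst, hu, map_smul]
  induction hx using Submodule.span_induction with
  | mem x hx =>
    obtain ⟨w, hw, rfl⟩ := hx
    simp only [lift_evalWord]
    exact ((evalWord_update (k := k) _ i w).2 (by rw [hw])).2 _ _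
  | zero => simp
  | add y y' _ _ h h' => simp only [map_add, h, h', smul_add]
  | smul s y _ h => simp only [map_smul, h]; rw [smul_comm]

/-- Transport of Lie operations along a bijection. -/
def lieMap {I I' : Type} (e : I ≃ I') : Lie k I →ₗ[k] Lie k I' :=
  (lieRename (k := k) e : FreeLieAlgebra k I →ₗ[k] FreeLieAlgebra k I').restrict
    (fun _ hx => lieRename_mem e.injective (fun _ => rfl)
      (fun i' h => absurd (e.apply_symm_apply i') (h _)) hx)

/-- The identity operation. -/
def lieOne : Lie k Unit :=
  ⟨FreeLieAlgebra.of k (), Submodule.subset_span ⟨.of (), by funext i; simp [occ], rfl⟩⟩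

/-- Composition of Lie operations by substitution. -/
def lieComp {I : Type} {J : I → Type} :
    Lie k I →ₗ[k] MultilinearMap k (fun i => Lie k (J i)) (Lie k (Σ i, J i)) where
  toFun f :=
    { toFun := fun g => ⟨lieSubst (fun i => (g i : FreeLieAlgebra k (J i))) f,
        lieSubst_mem (fun i => (g i).2) f.2⟩
      map_update_add' := by
        intro _ g i a b
        have hu : ∀ c : Lie k (J i), (fun i' => (Function.update g i c i' : FreeLieAlgebra k (J i')))
            = Function.update (fun i' => (g i' : FreeLieAlgebra k (J i'))) i c := by
          intro c
          funext i'
          by_cases h : i' = i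
          · subst h; simp
          · simp [h]
        apply Subtype.ext
        simp only [hu, Submodule.coe_add]
        exact lieSubst_update_add _ i _ _ f.2
      map_update_smul' := by
        intro _ g i r a
        have hu : ∀ c : Lie k (J i), (fun i' => (Function.update g i c i' : FreeLieAlgebra k (J i')))
            = Function.update (fun i' => (g i' : FreeLieAlgebra k (J i'))) i c := by
          intro c
          funext i'
          by_cases h : i' = i
          · subst h; simp
          · simp [h]
        apply Subtype.ext
        simp only [hu, Submodule.coe_smul]
        exact lieSubst_update_smul _ i r _ f.2 }
  map_add' f f' := by ext g; simp
  map_smul' r f := by ext g; simp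

lemma lieHom_ext {I : Type} {L : Type*} [LieRing L] [LieAlgebra k L]
    {F G : FreeLieAlgebra k I →ₗ⁅k⁆ L}
    (h : ∀ i, F (FreeLieAlgebra.of k i) = G (FreeLieAlgebra.of k i)) (x : FreeLieAlgebra k I) :
    F x = G x := by
  rw [FreeLieAlgebra.hom_ext h]

lemma lieRename_rename {I I' I'' : Type} (e : I → I') (e' : I' → I'') (x : FreeLieAlgebra k I) :
    lieRename e' (lieRename e x) = lieRename (e' ∘ e) x :=
  lieHom_ext (F := (lieRename e').comp (lieRename e)) (G := lieRename (e' ∘ e))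
    (fun i => by simp [lieRename]) x

lemma lieSubst_rename {I I' : Type} {J : I' → Type} (e : I → I')
    (g : ∀ i, FreeLieAlgebra k (J i)) (x : FreeLieAlgebra k I) :
    lieSubst g (lieRename e x) =
      lieRename (fun p : Σ i, J (e i) => (⟨e p.1, p.2⟩ : Σ i, J i))
        (lieSubst (fun i => g (e i)) x) :=
  lieHom_ext (F := (lieSubst g).comp (lieRename e))
    (G := (lieRename (fun p : Σ i, J (e i) => (⟨e p.1, p.2⟩ : Σ i, J i))).comp
      (lieSubst (fun i => g (e i))))
    (fun i => by simp [lieRename, lieSubst]; rw [← lieRename, ← lieRename, ← lieRename, lieRename_rename]; rfl) x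

lemma lieRename_subst {I : Type} {J : I → Type} {K : Type}
    (e : (Σ i, J i) → K) (g : ∀ i, FreeLieAlgebra k (J i)) (x : FreeLieAlgebra k I) :
    lieRename e (lieSubst g x) =
      FreeLieAlgebra.lift k (fun i => lieRename (fun j => e ⟨i, j⟩) (g i)) x :=
  lieHom_ext (F := (lieRename e).comp (lieSubst g))
    (G := FreeLieAlgebra.lift k (fun i => lieRename (fun j => e ⟨i, j⟩) (g i)))
    (fun i => by
      simp only [LieHom.comp_apply, lieSubst, FreeLieAlgebra.lift_of_apply, lieRename_rename]
      rfl) x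

variable (k) in
/-- The Lie operad, as a pseudo-tensor category with one object. -/
abbrev LieOp : PTCat.{u, 0, u} k where
  Ob := Unit
  P I _ _ _ _ := Lie k I
  map {_ _ _ _ _ _} e _ _ := lieMap e
  id _ := lieOne
  comp {_ _ _ _ _ _ _ _ _} := lieComp
  map_refl {I _ _ _ _} f := Subtype.ext (lieHom_ext (F := lieRename (Equiv.refl I)) (G := LieHom.id) (fun i => by simp [lieRename]) f.1)
  map_trans e e' _ _ f := Subtype.ext (lieRename_rename e e' f.1).symm
  comp_map_right := by
    intro I _ _ J J' _ _ _ _ e z y x f g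
    apply Subtype.ext
    refine Eq.trans ?_ (lieRename_subst _ _ _).symm
    change lieSubst (fun i => lieRename (e i) (g i).1) f.1 = _
    simp only [lieSubst, lieRename_rename]
    rfl
  comp_map_left := by
    intro I I' _ _ _ _ e J _ _ z y x f g
    exact Subtype.ext (lieSubst_rename e _ f.1)
  assoc := by
    intro I _ _ J _ _ H _ _ t z y x f g h
    apply Subtype.ext
    change lieRename (Equiv.sigmaAssoc H) (lieSubst _ (lieSubst (fun i => (g i).1) f.1)) =
      lieSubst (fun i => lieSubst (fun j => (h i j).1) (g i).1) f.1
    rw [lieRename_subst]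
    refine lieHom_ext (F := (FreeLieAlgebra.lift k _).comp (lieSubst (fun i => (g i).1)))
      (G := lieSubst (fun i => lieSubst (fun j => (h i j).1) (g i).1)) (fun i => ?_) f.1
    simp only [LieHom.comp_apply, lieSubst, FreeLieAlgebra.lift_of_apply]
    rw [← lieSubst, lieRename_subst]
    refine lieHom_ext (F := (FreeLieAlgebra.lift k _).comp (lieRename _))
      (G := FreeLieAlgebra.lift k _) (fun j => ?_) (g i).1
    simp only [LieHom.comp_apply, lieRename, FreeLieAlgebra.lift_of_apply]
    rfl
  id_comp := by
    intro I _ _ y x f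
    apply Subtype.ext
    change lieRename (unitSigma I) (lieSubst (fun _ => f.1) (FreeLieAlgebra.of k ())) = f.1
    rw [lieRename_subst, FreeLieAlgebra.lift_of_apply]
    exact lieHom_ext (F := lieRename _) (G := LieHom.id) (fun i => by simp [lieRename, unitSigma]) f.1
  comp_id := by
    intro I _ _ y x f
    apply Subtype.ext
    change lieRename (sigmaUnit I) (lieSubst (fun _ => FreeLieAlgebra.of k ()) f.1) = f.1
    rw [lieRename_subst]
    exact lieHom_ext (F := FreeLieAlgebra.lift k _) (G := LieHom.id)
      (fun i => by simp [lieRename, sigmaUnit]) f.1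

end LieOperad


/-! ### Functors, Lie algebras, the underlying `k`-linear category -/

/-- A pseudo-tensor (`k`-linear) functor between pseudo-tensor `k`-categories. -/
structure PTFunctor (A : PTCat.{u, v, w} k) (B : PTCat.{u, v', w'} k) where
  /-- the map on objects -/
  obj : A.Ob → B.Ob
  /-- the maps on operations -/
  op : ∀ {I : Type} [Finite I] [Nonempty I] {y : I → A.Ob} {x : A.Ob},
    A.P I y x →ₗ[k] B.P I (fun i => obj (y i)) (obj x)
  op_map : ∀ {I I' : Type} [Finite I] [Nonempty I] [Finite I'] [Nonempty I'] (e : I ≃ I')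
    {y : I' → A.Ob} {x : A.Ob} (f : A.P I (fun i => y (e i)) x),
    op (A.map (y := y) e f) = B.map (y := fun i => obj (y i)) e (op f)
  op_id : ∀ x, op (A.id x) = B.id (obj x)
  op_comp : ∀ {I : Type} [Finite I] [Nonempty I] {J : I → Type} [∀ i, Finite (J i)]
    [∀ i, Nonempty (J i)] {z : ∀ i, J i → A.Ob} {y : I → A.Ob} {x : A.Ob}
    (f : A.P I y x) (g : ∀ i, A.P (J i) (z i) (y i)),
    op (A.comp f g) = B.comp (z := fun i j => obj (z i j)) (op f) (fun i => op (g i))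

/-- A Lie algebra in `C`: a pseudo-tensor functor from the Lie operad to `C`. -/
abbrev LieAlg (C : PTCat.{u, v, w} k) := PTFunctor (LieOp k) C

/-- The underlying object of a Lie algebra in `C`. -/
abbrev LieAlg.carrier {C : PTCat.{u, v, w} k} (B : LieAlg C) : C.Ob := B.obj ()

/-- The operation `ψ_B ∈ P I ({B}, B)` defined by `ψ ∈ Lie(I)`. -/
def LieAlg.act {C : PTCat.{u, v, w} k} (B : LieAlg C) (I : Type) [Finite I] [Nonempty I] :
    Lie k I →ₗ[k] C.P I (fun _ => B.carrier) B.carrier :=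
  B.op (I := I) (y := fun _ => ()) (x := ())

/-- A cosimplicial Lie algebra in `C`: a functor `[n] ↦ B^n` from the simplex category to the
category of Lie algebras in `C`; a morphism of Lie algebras is a unary operation commuting with all
operations from the Lie operad. -/
structure CosimplicialLie (C : PTCat.{u, v, w} k) where
  /-- the Lie algebras `B^n` -/
  lie : SimplexCategory → LieAlg C
  /-- the cosimplicial structure maps `B(θ)` -/
  mor : ∀ {m n : SimplexCategory}, (m ⟶ n) → C.P Unit (fun _ => (lie m).carrier) (lie n).carrier
  mor_id : ∀ n, mor (𝟙 n) = C.id (lie n).carrier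
  mor_comp : ∀ {l m n : SimplexCategory} (θ : l ⟶ m) (θ' : m ⟶ n),
    mor (θ ≫ θ') = C.post (mor θ') (mor θ)
  mor_lie : ∀ {m n : SimplexCategory} (θ : m ⟶ n) (I : Type) [Finite I] [Nonempty I]
    (ψ : Lie k I),
    C.post (mor θ) ((lie m).act I ψ) = C.pre ((lie n).act I ψ) (fun _ => mor θ)

namespace PTCat

variable (C : PTCat.{u, v, w} k)

lemma map_congr {I I' : Type} [Finite I] [Nonempty I] [Finite I'] [Nonempty I'] {e e' : I ≃ I'}
    (h : ∀ i, e i = e' i) {y : I' → C.Ob} {x : C.Ob} {f : C.P I (fun i => y (e i)) x}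
    {f' : C.P I (fun i => y (e' i)) x} (hf : f ≍ f') : C.map (y := y) e f = C.map e' f' := by
  obtain rfl : e = e' := Equiv.ext h
  obtain rfl := eq_of_heq hf
  rfl

lemma post_post {I : Type} [Finite I] [Nonempty I] {y : I → C.Ob} {x x' x'' : C.Ob}
    (h : C.P Unit (fun _ => x') x'') (g : C.P Unit (fun _ => x) x') (f : C.P I y x) :
    C.post h (C.post g f) = C.post (C.post h g) f := by
  have h1 := C.comp_map_right (J := fun _ : Unit => Σ _ : Unit, I) (J' := fun _ => I)
    (fun _ => unitSigma I) (z := fun _ => y) h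
    (fun _ => C.comp (J := fun _ => I) (z := fun _ => y) g (fun _ => f))
  have h2 := C.comp_map_left (unitSigma Unit) (J := fun _ => I) (z := fun _ => y) (y := fun _ => x)
    (C.comp (J := fun _ => Unit) (z := fun _ _ => x) h (fun _ => g)) (fun _ => f)
  have h3 := C.assoc (J := fun _ : Unit => Unit) (H := fun _ _ => I) (t := fun _ _ => y)
    (z := fun _ _ => x) h (fun _ => g) (fun _ _ => f)
  refine (congrArg (C.map (y := y) (unitSigma I)) h1).trans
    (Eq.trans ?_ (congrArg (C.map (y := y) (unitSigma I)) h2).symm)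
  refine (C.map_trans (y := y) _ (unitSigma I) _).symm.trans
    (Eq.trans ?_ (C.map_trans (y := y) _ (unitSigma I) _))
  refine (congrArg (C.map (y := y) ((Equiv.sigmaCongrRight fun _ : Unit => unitSigma I).trans
    (unitSigma I))) h3.symm).trans ?_
  refine (C.map_trans (y := y) (Equiv.sigmaAssoc fun _ _ : Unit => I) _ _).symm.trans ?_
  exact C.map_congr (fun _ => rfl) HEq.rfl

lemma post_id {I : Type} [Finite I] [Nonempty I] {y : I → C.Ob} {x : C.Ob} (f : C.P I y x) :
    C.post (C.id x) f = f := C.id_comp f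

lemma id_post {x x' : C.Ob} (f : C.P Unit (fun _ => x) x') : C.post f (C.id x) = f := by
  conv_rhs => rw [← C.comp_id f]
  exact C.map_congr (fun _ => rfl) HEq.rfl

/-- `post` as a bilinear map. -/
def postₗ {I : Type} [Finite I] [Nonempty I] (y : I → C.Ob) (x x' : C.Ob) :
    C.P Unit (fun _ => x) x' →ₗ[k] C.P I y x →ₗ[k] C.P I y x' :=
  LinearMap.mk₂ k (fun g f => C.post g f)
    (fun g g' f => by simp only [post, map_add, add_apply])
    (fun r g f => by simp only [post, map_smul, smul_apply])
    (fun g f f' => by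
      have := (C.comp (J := fun _ : Unit => I) (z := fun _ => y) g).map_update_add
        (fun _ => f) () f f'
      simp only [Function.update_eq_const_of_subsingleton] at this
      exact (congrArg (C.map (y := y) (unitSigma I)) this).trans (map_add _ _ _))
    (fun r g f => by
      have := (C.comp (J := fun _ : Unit => I) (z := fun _ => y) g).map_update_smul
        (fun _ => f) () r f
      simp only [Function.update_eq_const_of_subsingleton] at this
      exact (congrArg (C.map (y := y) (unitSigma I)) this).trans (map_smul _ _ _))

/-- The `k`-linear category underlying a pseudo-tensor category: its morphisms are the unary
operations. -/
def Und : Type v := C.Ob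

instance : Category.{w} C.Und where
  Hom x x' := C.P Unit (fun _ => (show C.Ob from x)) (show C.Ob from x')
  id x := C.id x
  comp f g := C.post g f
  id_comp f := C.id_post f
  comp_id f := C.post_id f
  assoc f g h := C.post_post h g f

instance : Preadditive C.Und where
  homGroup x x' := inferInstanceAs
    (AddCommGroup (C.P Unit (fun _ => (show C.Ob from x)) (show C.Ob from x')))
  add_comp _ _ _ f f' g := (C.postₗ _ _ _ g).map_add f f'
  comp_add _ _ _ f g g' := (C.postₗ _ _ _).map_add₂ g g' f

end PTCat

/-- The cosimplicial object underlying a cosimplicial Lie algebra. -/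
def CosimplicialLie.toCosimplicial {C : PTCat.{u, v, w} k} (B : CosimplicialLie C) :
    CosimplicialObject C.Und where
  obj n := (B.lie n).carrier
  map θ := B.mor θ
  map_id n := B.mor_id n
  map_comp θ θ' := B.mor_comp θ θ'


/-- The restriction of a family of polylinear maps to subspaces. -/
def restrictComp {ι : Type*} {A M : Type*} {E : ι → Type*} [AddCommGroup A] [Module k A]
    [AddCommGroup M] [Module k M] [∀ i, AddCommGroup (E i)] [∀ i, Module k (E i)]
    (φ : A →ₗ[k] MultilinearMap k E M) (S : Submodule k A) (T : ∀ i, Submodule k (E i))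
    (U : Submodule k M) (h : ∀ f ∈ S, ∀ g : ∀ i, E i, (∀ i, g i ∈ T i) → φ f g ∈ U) :
    S →ₗ[k] MultilinearMap k (fun i => T i) U where
  toFun f :=
    { toFun := fun g => ⟨φ f.1 (fun i => (g i).1), h f.1 f.2 _ (fun i => (g i).2)⟩
      map_update_add' := fun g i a b => Subtype.ext
        (((φ f.1).compLinearMap (fun i => (T i).subtype)).map_update_add g i a b)
      map_update_smul' := fun g i r a => Subtype.ext
        (((φ f.1).compLinearMap (fun i => (T i).subtype)).map_update_smul g i r a) }
  map_add' f f' := by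
    ext g
    exact congrArg (fun ψ => ψ (fun i => (g i).1)) (φ.map_add f.1 f'.1)
  map_smul' r f := by
    ext g
    exact congrArg (fun ψ => ψ (fun i => (g i).1)) (φ.map_smul r f.1)

/-! ### Differential graded pseudo-tensor categories -/

/-- The lexicographic order on `Σ i, J i`. -/
instance lexLinearOrder {I : Type} {J : I → Type} [LinearOrder I] [∀ i, LinearOrder (J i)] :
    LinearOrder (Σ i, J i) :=
  inferInstanceAs (LinearOrder (Σₗ i, J i))

/-- The sign `∏_{i < i'} (-1)^(A i * m i')` of the shuffle
`(m₁, …, mₙ, A₁, …, Aₙ) ↦ (m₁, A₁, …, mₙ, Aₙ)` of homogeneous elements of the given degrees. -/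
def shuffleSign {I : Type} [Fintype I] [LinearOrder I] (m A : I → ℤ) : ℤˣ :=
  ∏ i, ∏ i' with i < i', Int.negOnePow (A i * m i')

/-- The Koszul sign of the permutation `e` of homogeneous elements of degrees `a i`. -/
def permSign {I I' : Type} [Fintype I] [LinearOrder I] [LinearOrder I'] (e : I ≃ I')
    (a : I → ℤ) : ℤˣ :=
  ∏ i, ∏ i' with i < i' ∧ e i' < e i, Int.negOnePow (a i * a i')

/-- The data of a pseudo-tensor category enriched in complexes of `k`-vector spaces (differentials
have degree `+1`).  The axioms are in `DGPTData.Lawful`.  Index sets are finite, non-empty and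
linearly ordered; the order only serves to write down Koszul signs, and operations are transported
along all bijections. -/
structure DGPTData (k : Type u) [Field k] where
  /-- objects -/
  Ob : Type v
  /-- operations of given degree -/
  P : ∀ (I : Type) [Fintype I] [LinearOrder I] [Nonempty I], (I → Ob) → Ob → ℤ → Type w
  [addCommGroup : ∀ (I : Type) [Fintype I] [LinearOrder I] [Nonempty I] (y : I → Ob) (x : Ob)
    (n : ℤ), AddCommGroup (P I y x n)]
  [module : ∀ (I : Type) [Fintype I] [LinearOrder I] [Nonempty I] (y : I → Ob) (x : Ob)
    (n : ℤ), Module k (P I y x n)]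
  /-- the differential -/
  d : ∀ {I : Type} [Fintype I] [LinearOrder I] [Nonempty I] {y : I → Ob} {x : Ob} (n n' : ℤ)
    (_ : n + 1 = n'), P I y x n →ₗ[k] P I y x n'
  /-- transport along bijections of index sets -/
  map : ∀ {I I' : Type} [Fintype I] [LinearOrder I] [Nonempty I] [Fintype I'] [LinearOrder I']
    [Nonempty I'] (e : I ≃ I') {y : I' → Ob} {x : Ob} (n : ℤ),
    P I (fun i => y (e i)) x n →ₗ[k] P I' y x n
  /-- identity operations -/
  id : ∀ x : Ob, P Unit (fun _ => x) x 0
  /-- polylinear composition -/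
  comp : ∀ {I : Type} [Fintype I] [LinearOrder I] [Nonempty I] {J : I → Type} [∀ i, Fintype (J i)]
    [∀ i, LinearOrder (J i)] [∀ i, Nonempty (J i)] {z : ∀ i, J i → Ob} {y : I → Ob} {x : Ob}
    (n : ℤ) (m : I → ℤ) (N : ℤ) (_ : n + ∑ i, m i = N),
    P I y x n →ₗ[k] MultilinearMap k (fun i => P (J i) (z i) (y i) (m i))
      (P (Σ i, J i) (fun p => z p.1 p.2) x N)

attribute [instance] DGPTData.addCommGroup DGPTData.module

namespace DGPTData

/-- The identification of the operations of degrees `n` and `n'` when `n = n'`. -/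
def cast (A : DGPTData.{u, v, w} k) {I : Type} [Fintype I] [LinearOrder I] [Nonempty I]
    {y : I → A.Ob} {x : A.Ob} {n n' : ℤ} (h : n = n') : A.P I y x n →ₗ[k] A.P I y x n' :=
  h ▸ LinearMap.id

/-- The family `(g₁, …, d gᵢ, …, gₙ)`. -/
def dAt (A : DGPTData.{u, v, w} k) {I : Type} [LinearOrder I] {J : I → Type}
    [∀ i, Fintype (J i)] [∀ i, LinearOrder (J i)] [∀ i, Nonempty (J i)] {z : ∀ i, J i → A.Ob}
    {y : I → A.Ob} {m : I → ℤ} (i : I) (g : ∀ j, A.P (J j) (z j) (y j) (m j)) (j : I) :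
    A.P (J j) (z j) (y j) (Function.update m i (m i + 1) j) :=
  if h : j = i then A.d (m j) _ (by subst h; simp) (g j) else A.cast (by simp [h]) (g j)

/-- The axioms of a pseudo-tensor category enriched in complexes, with the Koszul sign rule. -/
structure Lawful (A : DGPTData.{u, v, w} k) : Prop where
  d_d : ∀ {I : Type} [Fintype I] [LinearOrder I] [Nonempty I] {y : I → A.Ob} {x : A.Ob}
    (n n' n'' : ℤ) (h : n + 1 = n') (h' : n' + 1 = n'') (f : A.P I y x n),
    A.d n' n'' h' (A.d n n' h f) = 0
  map_refl : ∀ {I : Type} [Fintype I] [LinearOrder I] [Nonempty I] {y : I → A.Ob} {x : A.Ob}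
    (n : ℤ) (f : A.P I y x n), A.map (Equiv.refl I) n f = f
  map_trans : ∀ {I I' I'' : Type} [Fintype I] [LinearOrder I] [Nonempty I] [Fintype I']
    [LinearOrder I'] [Nonempty I'] [Fintype I''] [LinearOrder I''] [Nonempty I'']
    (e : I ≃ I') (e' : I' ≃ I'') {y : I'' → A.Ob} {x : A.Ob} (n : ℤ)
    (f : A.P I (fun i => y (e' (e i))) x n),
    A.map (y := y) (e.trans e') n f = A.map e' n (A.map (y := fun i => y (e' i)) e n f)
  d_map : ∀ {I I' : Type} [Fintype I] [LinearOrder I] [Nonempty I] [Fintype I']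
    [LinearOrder I'] [Nonempty I'] (e : I ≃ I') {y : I' → A.Ob} {x : A.Ob} (n n' : ℤ)
    (h : n + 1 = n') (f : A.P I (fun i => y (e i)) x n),
    A.d n n' h (A.map (y := y) e n f) = A.map e n' (A.d n n' h f)
  d_id : ∀ x : A.Ob, A.d 0 1 (by norm_num) (A.id x) = 0
  d_comp : ∀ {I : Type} [Fintype I] [LinearOrder I] [Nonempty I] {J : I → Type}
    [∀ i, Fintype (J i)] [∀ i, LinearOrder (J i)] [∀ i, Nonempty (J i)] {z : ∀ i, J i → A.Ob}
    {y : I → A.Ob} {x : A.Ob} (n : ℤ) (m : I → ℤ) (N N' : ℤ) (h : n + ∑ i, m i = N)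
    (h' : N + 1 = N') (f : A.P I y x n) (g : ∀ i, A.P (J i) (z i) (y i) (m i)),
    A.d N N' h' (A.comp n m N h f g) =
      A.comp (n + 1) m N' (by omega) (A.d n (n + 1) rfl f) g +
      ∑ i, Int.negOnePow (n + ∑ j with j < i, m j) •
        A.comp n (Function.update m i (m i + 1)) N'
          (by
            have h1 := Finset.add_sum_erase Finset.univ m (Finset.mem_univ i)
            have h2 := Finset.sum_update_of_mem (Finset.mem_univ i) m (m i + 1)
            rw [Finset.sdiff_singleton_eq_erase] at h2
            omega) f (A.dAt i g)
  comp_map_right : ∀ {I : Type} [Fintype I] [LinearOrder I] [Nonempty I] {J J' : I → Type}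
    [∀ i, Fintype (J i)] [∀ i, LinearOrder (J i)] [∀ i, Nonempty (J i)] [∀ i, Fintype (J' i)]
    [∀ i, LinearOrder (J' i)] [∀ i, Nonempty (J' i)] (e : ∀ i, J i ≃ J' i) {z : ∀ i, J' i → A.Ob}
    {y : I → A.Ob} {x : A.Ob} (n : ℤ) (m : I → ℤ) (N : ℤ) (h : n + ∑ i, m i = N)
    (f : A.P I y x n) (g : ∀ i, A.P (J i) (fun j => z i (e i j)) (y i) (m i)),
    A.comp n m N h f (fun i => A.map (y := z i) (e i) (m i) (g i)) =
      A.map (y := fun p => z p.1 p.2) (Equiv.sigmaCongrRight e) N (A.comp n m N h f g)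
  comp_map_left : ∀ {I I' : Type} [Fintype I] [LinearOrder I] [Nonempty I] [Fintype I']
    [LinearOrder I'] [Nonempty I'] (e : I ≃ I') {J : I' → Type}
    [∀ i, Fintype (J i)] [∀ i, LinearOrder (J i)] [∀ i, Nonempty (J i)] {z : ∀ i, J i → A.Ob}
    {y : I' → A.Ob} {x : A.Ob} (n : ℤ) (m : I' → ℤ) (N : ℤ) (h : n + ∑ i, m i = N)
    (h' : n + ∑ i, m (e i) = N)
    (f : A.P I (fun i => y (e i)) x n) (g : ∀ i, A.P (J i) (z i) (y i) (m i)),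
    A.comp n m N h (A.map (y := y) e n f) g =
      permSign e (fun i => m (e i)) •
        A.map (y := fun p => z p.1 p.2) (Equiv.sigmaCongrLeft e) N
          (A.comp (z := fun i => z (e i)) n (fun i => m (e i)) N h' f (fun i => g (e i)))
  assoc : ∀ {I : Type} [Fintype I] [LinearOrder I] [Nonempty I] {J : I → Type}
    [∀ i, Fintype (J i)] [∀ i, LinearOrder (J i)] [∀ i, Nonempty (J i)] {H : ∀ i, J i → Type}
    [∀ i j, Fintype (H i j)] [∀ i j, LinearOrder (H i j)] [∀ i j, Nonempty (H i j)]
    {t : ∀ i j, H i j → A.Ob} {z : ∀ i, J i → A.Ob} {y : I → A.Ob} {x : A.Ob}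
    (n : ℤ) (m : I → ℤ) (r : ∀ i, J i → ℤ) (N N' : ℤ) (M : I → ℤ) (hN : n + ∑ i, m i = N)
    (hN' : N + ∑ p : Σ i, J i, r p.1 p.2 = N') (hM : ∀ i, m i + ∑ j, r i j = M i)
    (hMN : n + ∑ i, M i = N')
    (f : A.P I y x n) (g : ∀ i, A.P (J i) (z i) (y i) (m i))
    (h : ∀ i j, A.P (H i j) (t i j) (z i j) (r i j)),
    A.map (y := fun p => t p.1 p.2.1 p.2.2)
        (Equiv.sigmaAssoc H) N'
        (A.comp (J := fun p : Σ i, J i => H p.1 p.2)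
          (z := fun p => t p.1 p.2) (y := fun p => z p.1 p.2)
          N (fun p => r p.1 p.2) N' hN' (A.comp n m N hN f g)
          (fun p => h p.1 p.2)) =
      shuffleSign m (fun i => ∑ j, r i j) •
        A.comp (J := fun i => Σ j, H i j) (z := fun i p => t i p.1 p.2)
          n M N' hMN f
          (fun i => A.comp (J := H i) (z := t i) (y := z i) (m i) (r i) (M i) (hM i) (g i) (h i))
  id_comp : ∀ {I : Type} [Fintype I] [LinearOrder I] [Nonempty I] {y : I → A.Ob} {x : A.Ob}
    (n : ℤ) (f : A.P I y x n),
    A.map (unitSigma I) n (A.comp (J := fun _ => I) (z := fun _ => y) 0 (fun _ => n) n (by simp)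
      (A.id x) (fun _ => f)) = f
  comp_id : ∀ {I : Type} [Fintype I] [LinearOrder I] [Nonempty I] {y : I → A.Ob} {x : A.Ob}
    (n : ℤ) (f : A.P I y x n),
    A.map (sigmaUnit I) n (A.comp (J := fun _ => Unit) (z := fun i _ => y i) n (fun _ => 0) n
      (by simp) f (fun i => A.id (y i))) = f

/-- The maps `F`, over the map `obj` on objects, form a pseudo-tensor functor from `A` to `B`: they
are morphisms of complexes and respect compositions, identities and transport along bijections. -/
structure IsFunctor (A : DGPTData.{u, v, w} k) (B : DGPTData.{u, v', w'} k) (obj : A.Ob → B.Ob)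
    (F : ∀ (I : Type) [Fintype I] [LinearOrder I] [Nonempty I] (y : I → A.Ob) (x : A.Ob) (n : ℤ),
      A.P I y x n →ₗ[k] B.P I (fun i => obj (y i)) (obj x) n) : Prop where
  d : ∀ {I : Type} [Fintype I] [LinearOrder I] [Nonempty I] {y : I → A.Ob} {x : A.Ob} (n n' : ℤ)
    (h : n + 1 = n') (f : A.P I y x n), F I y x n' (A.d n n' h f) = B.d n n' h (F I y x n f)
  map : ∀ {I I' : Type} [Fintype I] [LinearOrder I] [Nonempty I] [Fintype I'] [LinearOrder I']
    [Nonempty I'] (e : I ≃ I') {y : I' → A.Ob} {x : A.Ob} (n : ℤ)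
    (f : A.P I (fun i => y (e i)) x n),
    F I' y x n (A.map (y := y) e n f) =
      B.map (y := fun i => obj (y i)) e n (F I (fun i => y (e i)) x n f)
  id : ∀ x, F Unit (fun _ => x) x 0 (A.id x) = B.id (obj x)
  comp : ∀ {I : Type} [Fintype I] [LinearOrder I] [Nonempty I] {J : I → Type} [∀ i, Fintype (J i)]
    [∀ i, LinearOrder (J i)] [∀ i, Nonempty (J i)] {z : ∀ i, J i → A.Ob} {y : I → A.Ob} {x : A.Ob}
    (n : ℤ) (m : I → ℤ) (N : ℤ) (h : n + ∑ i, m i = N) (f : A.P I y x n)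
    (g : ∀ i, A.P (J i) (z i) (y i) (m i)),
    F (Σ i, J i) _ x N (A.comp n m N h f g) =
      B.comp (z := fun i j => obj (z i j)) n m N h (F I y x n f)
        (fun i => F (J i) (z i) (y i) (m i) (g i))

/-- The maps `F` commuting with the differentials induce isomorphisms on the cohomology of all
complexes of operations. -/
structure IsQuasiIso (A : DGPTData.{u, v, w} k) (B : DGPTData.{u, v', w'} k) (obj : A.Ob → B.Ob)
    (F : ∀ (I : Type) [Fintype I] [LinearOrder I] [Nonempty I] (y : I → A.Ob) (x : A.Ob) (n : ℤ),
      A.P I y x n →ₗ[k] B.P I (fun i => obj (y i)) (obj x) n) : Prop where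
  injective : ∀ {I : Type} [Fintype I] [LinearOrder I] [Nonempty I] {y : I → A.Ob} {x : A.Ob}
    (n n' n'' : ℤ) (h : n + 1 = n') (h' : n' + 1 = n'') (a : A.P I y x n'),
    A.d n' n'' h' a = 0 → (∃ b, B.d n n' h b = F I y x n' a) → ∃ a', A.d n n' h a' = a
  surjective : ∀ {I : Type} [Fintype I] [LinearOrder I] [Nonempty I] {y : I → A.Ob} {x : A.Ob}
    (n n' n'' : ℤ) (h : n + 1 = n') (h' : n' + 1 = n'')
    (b : B.P I (fun i => obj (y i)) (obj x) n'), B.d n' n'' h' b = 0 →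
    ∃ a, A.d n' n'' h' a = 0 ∧ ∃ c, F I y x n' a = b + B.d n n' h c

/-- A family of subspaces of the operations of `A` closed under all the structure. -/
structure IsSub (A : DGPTData.{u, v, w} k)
    (S : ∀ (I : Type) [Fintype I] [LinearOrder I] [Nonempty I] (y : I → A.Ob) (x : A.Ob) (n : ℤ),
      Submodule k (A.P I y x n)) : Prop where
  d : ∀ {I : Type} [Fintype I] [LinearOrder I] [Nonempty I] {y : I → A.Ob} {x : A.Ob} (n n' : ℤ)
    (h : n + 1 = n') (f : A.P I y x n), f ∈ S I y x n → A.d n n' h f ∈ S I y x n'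
  map : ∀ {I I' : Type} [Fintype I] [LinearOrder I] [Nonempty I] [Fintype I'] [LinearOrder I']
    [Nonempty I'] (e : I ≃ I') {y : I' → A.Ob} {x : A.Ob} (n : ℤ)
    (f : A.P I (fun i => y (e i)) x n), f ∈ S I (fun i => y (e i)) x n →
    A.map (y := y) e n f ∈ S I' y x n
  id : ∀ x, A.id x ∈ S Unit (fun _ => x) x 0
  comp : ∀ {I : Type} [Fintype I] [LinearOrder I] [Nonempty I] {J : I → Type} [∀ i, Fintype (J i)]
    [∀ i, LinearOrder (J i)] [∀ i, Nonempty (J i)] {z : ∀ i, J i → A.Ob} {y : I → A.Ob} {x : A.Ob}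
    (n : ℤ) (m : I → ℤ) (N : ℤ) (h : n + ∑ i, m i = N) (f : A.P I y x n)
    (g : ∀ i, A.P (J i) (z i) (y i) (m i)), f ∈ S I y x n → (∀ i, g i ∈ S (J i) (z i) (y i) (m i)) →
    A.comp n m N h f g ∈ S (Σ i, J i) (fun p => z p.1 p.2) x N

/-- The structure on a family of subspaces closed under all the structure of `A`. -/
abbrev sub (A : DGPTData.{u, v, w} k)
    (S : ∀ (I : Type) [Fintype I] [LinearOrder I] [Nonempty I] (y : I → A.Ob) (x : A.Ob) (n : ℤ),
      Submodule k (A.P I y x n)) (hS : A.IsSub S) : DGPTData.{u, v, w} k where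
  Ob := A.Ob
  P I _ _ _ y x n := S I y x n
  d n n' h := (A.d n n' h).restrict (hS.d n n' h)
  map {_ _ _ _ _ _ _ _} e {y x} n :=
    (A.map e n).restrict (fun f hf => hS.map (y := y) (x := x) e n f hf)
  id x := ⟨A.id x, hS.id x⟩
  comp {_ _ _ _ _ _ _ _ _ _ _} n m N h :=
    restrictComp (A.comp n m N h) _ (fun i => S _ _ _ (m i)) _ (fun f hf g hg => hS.comp n m N h f g hf hg)

/-- The canonical truncation `τ_{≤ 0}`: all of degree `< 0`, the cocycles in degree `0`, and `0` in
degree `> 0`. -/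
def tau (A : DGPTData.{u, v, w} k) (I : Type) [Fintype I] [LinearOrder I] [Nonempty I]
    (y : I → A.Ob) (x : A.Ob) (n : ℤ) : Submodule k (A.P I y x n) where
  carrier := {f | (0 < n → f = 0) ∧ (n = 0 → A.d n (n + 1) rfl f = 0)}
  add_mem' {f g} hf hg := ⟨fun h => by rw [hf.1 h, hg.1 h, add_zero],
    fun h => by rw [map_add, hf.2 h, hg.2 h, add_zero]⟩
  zero_mem' := ⟨fun _ => rfl, fun _ => map_zero _⟩
  smul_mem' r f hf := ⟨fun h => by rw [hf.1 h, smul_zero],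
    fun h => by rw [map_smul, hf.2 h, smul_zero]⟩

end DGPTData

/-- The degree `n` component of a vector space placed in degree `0`. -/
def inDegreeZero (M : Type*) [AddCommGroup M] [Module k M] (n : ℤ) : Submodule k M where
  carrier := {f | n ≠ 0 → f = 0}
  add_mem' {f g} hf hg h := by rw [hf h, hg h, add_zero]
  zero_mem' _ := rfl
  smul_mem' r f hf h := by rw [hf h, smul_zero]

/-- A pseudo-tensor `k`-category whose spaces of operations are placed in degree `0`. -/
abbrev PTCat.toDG (A : PTCat.{u, v, w} k) : DGPTData.{u, v, w} k where
  Ob := A.Ob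
  P I _ _ _ y x n := inDegreeZero (k := k) (A.P I y x) n
  d _ _ _ := 0
  map {_ _ _ _ _ _ _ _} e {y x} n := (A.map (y := y) (x := x) e).restrict
    (p := inDegreeZero _ n) (q := inDegreeZero _ n) (fun f hf h => by rw [hf h, map_zero])
  id x := ⟨A.id x, fun h => absurd rfl h⟩
  comp {I _ _ _ J _ _ _ z y x} n m N h :=
    restrictComp (A.comp (I := I) (J := J) (z := z) (y := y) (x := x)) (inDegreeZero _ n)
      (fun i => inDegreeZero _ (m i)) (inDegreeZero _ N) (fun f hf g hg hN => by
        by_cases hn : n = 0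
        · have : ∃ i, m i ≠ 0 := by
            by_contra hm
            push Not at hm
            exact hN (by simp [← h, hn, hm])
          obtain ⟨i, hi⟩ := this
          exact MultilinearMap.map_coord_zero _ i (hg i hi)
        · rw [hf hn]; simp)


/-! ### Complexes in a pseudo-tensor `k`-category -/

/-- A complex in `C`.  Its terms are the objects `X a`, placed in the pairwise distinct degrees
`deg a`; in the degrees outside the range of `deg` the complex is zero (`C` itself need not have a
zero object).  The component `d a b` of the differential can be non-zero only if
`deg b = deg a + 1`. -/
structure Cx (C : PTCat.{u, v, w} k) where
  /-- the set of (indices of) degrees -/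
  ι : Type
  /-- the degrees -/
  deg : ι → ℤ
  deg_injective : Function.Injective deg
  /-- the terms -/
  X : ι → C.Ob
  /-- the differential -/
  d : ∀ a b : ι, C.P Unit (fun _ => X a) (X b)
  d_eq_zero : ∀ a b, deg b ≠ deg a + 1 → d a b = 0
  d_d : ∀ a b c, C.post (d b c) (d a b) = 0

namespace Cx

variable {C : PTCat.{u, v, w} k}

/-- The operations of degree `n` from the complexes `y i` to the complex `x`: families of operations
`f a b ∈ P I (y i ^ (a i)) (x ^ b)` such that `f a b = 0` unless `deg b - ∑ i, deg (a i) = n`. -/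
def Op (I : Type) [Fintype I] [Nonempty I] (y : I → Cx C) (x : Cx C) (n : ℤ) :
    Submodule k (∀ (a : ∀ i, (y i).ι) (b : x.ι), C.P I (fun i => (y i).X (a i)) (x.X b)) where
  carrier := {f | ∀ a b, x.deg b ≠ ∑ i, (y i).deg (a i) + n → f a b = 0}
  add_mem' {f g} hf hg a b h := by
    rw [Pi.add_apply, Pi.add_apply, hf a b h, hg a b h, add_zero]
  zero_mem' _ _ _ := rfl
  smul_mem' r f hf a b h := by rw [Pi.smul_apply, Pi.smul_apply, hf a b h, smul_zero]

lemma sign_smul_finsum_add {ι M : Type*} [AddCommGroup M] (s : ℤˣ) {u u' u'' : ι → M}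
    (h : ∀ c, u c = u' c + u'' c) (hu' : (Function.support u').Finite)
    (hu'' : (Function.support u'').Finite) :
    s • ∑ᶠ c, u c = s • ∑ᶠ c, u' c + s • ∑ᶠ c, u'' c := by
  rw [← smul_add, ← finsum_add_distrib hu' hu'', finsum_congr h]

lemma sign_smul_finsum_smul {ι M : Type*} [AddCommGroup M] [Module k M] (s : ℤˣ) (r : k)
    {u u' : ι → M} (h : ∀ c, u c = r • u' c) :
    s • ∑ᶠ c, u c = r • s • ∑ᶠ c, u' c := by
  rw [smul_comm, smul_finsum, finsum_congr h]

/-- The entry `f a b` of a family `f`. -/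
def evalAt {I : Type} [Finite I] [Nonempty I] {y : I → Cx C} {x : Cx C} (a : ∀ i, (y i).ι)
    (b : x.ι) : (∀ (a : ∀ i, (y i).ι) (b : x.ι), C.P I (fun i => (y i).X (a i)) (x.X b)) →ₗ[k]
      C.P I (fun i => (y i).X (a i)) (x.X b) where
  toFun f := f a b
  map_add' _ _ := rfl
  map_smul' _ _ := rfl

section comp

variable {I : Type} [Fintype I] [Nonempty I] {J : I → Type} [∀ i, Fintype (J i)]
  [∀ i, Nonempty (J i)] {z : ∀ i, J i → Cx C} {y : I → Cx C} {x : Cx C}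

/-- The summand of the composition of `f` and the `g i` through the terms `(y i) ^ (c i)`. -/
def compTerm (a : ∀ p : Σ i, J i, (z p.1 p.2).ι) (b : x.ι) (c : ∀ i, (y i).ι) :
    (∀ (a : ∀ i, (y i).ι) (b : x.ι), C.P I (fun i => (y i).X (a i)) (x.X b)) →ₗ[k]
    MultilinearMap k (fun i => ∀ (a : ∀ j, (z i j).ι) (b : (y i).ι),
        C.P (J i) (fun j => (z i j).X (a j)) ((y i).X b))
      (C.P (Σ i, J i) (fun p => (z p.1 p.2).X (a p)) (x.X b)) where
  toFun f :=
    { toFun := fun g => C.comp (J := J) (z := fun i j => (z i j).X (a ⟨i, j⟩)) (f c b)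
        (fun i => g i (fun j => a ⟨i, j⟩) (c i))
      map_update_add' := fun g i g₁ g₂ =>
        ((C.comp (J := J) (z := fun i j => (z i j).X (a ⟨i, j⟩)) (f c b)).compLinearMap
          (fun i => evalAt (fun j => a ⟨i, j⟩) (c i))).map_update_add g i g₁ g₂
      map_update_smul' := fun g i r g₁ =>
        ((C.comp (J := J) (z := fun i j => (z i j).X (a ⟨i, j⟩)) (f c b)).compLinearMap
          (fun i => evalAt (fun j => a ⟨i, j⟩) (c i))).map_update_smul g i r g₁ }
  map_add' f f' := by
    ext g
    simp
    rfl
  map_smul' r f := by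
    ext g
    simp
    rfl

lemma compTerm_apply (a : ∀ p : Σ i, J i, (z p.1 p.2).ι) (b : x.ι)
    (c : ∀ i, (y i).ι)
    (f : ∀ (a : ∀ i, (y i).ι) (b : x.ι), C.P I (fun i => (y i).X (a i)) (x.X b))
    (g : ∀ i, ∀ (a : ∀ j, (z i j).ι) (b : (y i).ι),
      C.P (J i) (fun j => (z i j).X (a j)) ((y i).X b)) :
    compTerm a b c f g =
      C.comp (J := J) (z := fun i j => (z i j).X (a ⟨i, j⟩)) (f c b)
        (fun i => g i (fun j => a ⟨i, j⟩) (c i)) := rfl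

lemma compTerm_eq_zero (a : ∀ p : Σ i, J i, (z p.1 p.2).ι) (b : x.ι)
    (c : ∀ i, (y i).ι) {n : ℤ} {m : I → ℤ} (f : Op I y x n)
    (g : ∀ i, Op (J i) (z i) (y i) (m i)) {i : I}
    (hi : (y i).deg (c i) ≠ ∑ j, (z i j).deg (a ⟨i, j⟩) + m i) :
    compTerm a b c f.1 (fun i => (g i).1) = 0 := by
  rw [compTerm_apply, (C.comp (f.1 c b)).map_coord_zero i ((g i).2 _ _ hi)]

lemma finite_support (a : ∀ p : Σ i, J i, (z p.1 p.2).ι) (b : x.ι)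
    {n : ℤ} {m : I → ℤ} (f : Op I y x n) (g : ∀ i, Op (J i) (z i) (y i) (m i)) :
    (Function.support fun c => compTerm a b c f.1 (fun i => (g i).1)).Finite := by
  refine Set.Subsingleton.finite fun c hc c' hc' => ?_
  funext i
  by_contra h
  by_cases h1 : (y i).deg (c i) = ∑ j, (z i j).deg (a ⟨i, j⟩) + m i
  · refine hc' (compTerm_eq_zero a b c' f g (i := i) fun h2 => h ?_)
    exact (y i).deg_injective (h1.trans h2.symm)
  · exact hc (compTerm_eq_zero a b c f g h1)

variable [LinearOrder I] [∀ i, LinearOrder (J i)]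

/-- The composition of homogeneous operations between complexes:
`(f ∘ g)_{a, b} = ± ∑_c f_{c, b} ∘ (g_{i, (a_ij)_j, c_i})_i` (at most one summand is non-zero), where
the sign is the Koszul sign of moving the `g i` past the arguments. -/
def compFun (n : ℤ) (m : I → ℤ) (N : ℤ) (h : n + ∑ i, m i = N) (f : Op I y x n)
    (g : ∀ i, Op (J i) (z i) (y i) (m i)) :
    Op (Σ i, J i) (fun p => z p.1 p.2) x N :=
  ⟨fun a b => shuffleSign m (fun i => ∑ j, (z i j).deg (a ⟨i, j⟩)) •
      ∑ᶠ c : ∀ i, (y i).ι, compTerm a b c f.1 (fun i => (g i).1), by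
    intro a b hab
    refine (congrArg _ (finsum_eq_zero_of_forall_eq_zero fun c => ?_)).trans (smul_zero _)
    by_cases hc : ∀ i, (y i).deg (c i) = ∑ j, (z i j).deg (a ⟨i, j⟩) + m i
    · rw [compTerm_apply, f.2, map_zero]
      · rfl
      · intro hb
        apply hab
        have hs := Fintype.sum_sigma (fun p : Σ i, J i => (z p.1 p.2).deg (a p))
        dsimp only at hs ⊢
        rw [hb, hs, Finset.sum_congr rfl (fun i _ => hc i), Finset.sum_add_distrib]
        omega
    · push Not at hc
      obtain ⟨i, hi⟩ := hc
      exact compTerm_eq_zero a b c f g hi⟩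

/-- The composition as a polylinear map. -/
def comp (n : ℤ) (m : I → ℤ) (N : ℤ) (h : n + ∑ i, m i = N) :
    Op I y x n →ₗ[k] MultilinearMap k (fun i => Op (J i) (z i) (y i) (m i))
      (Op (Σ i, J i) (fun p => z p.1 p.2) x N) where
  toFun f :=
    { toFun := fun g => compFun n m N h f g
      map_update_add' := by
        intro _ g i g₁ g₂
        apply Subtype.ext
        funext a b
        have := fun c => ((compTerm a b c f.1).compLinearMap
          (fun i => (Op (J i) (z i) (y i) (m i)).subtype)).map_update_add g i g₁ g₂
        exact sign_smul_finsum_add _ this (finite_support a b f _) (finite_support a b f _)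
      map_update_smul' := by
        intro _ g i r g₁
        apply Subtype.ext
        funext a b
        have := fun c => ((compTerm a b c f.1).compLinearMap
          (fun i => (Op (J i) (z i) (y i) (m i)).subtype)).map_update_smul g i r g₁
        exact sign_smul_finsum_smul _ _ this }
  map_add' f f' := by
    ext g a b
    exact sign_smul_finsum_add _ (fun c => by rw [Submodule.coe_add, map_add]; rfl)
      (finite_support a b f _) (finite_support a b f' _)
  map_smul' r f := by
    ext g a b
    exact sign_smul_finsum_smul _ _ (fun c => by rw [Submodule.coe_smul, map_smul]; rfl)

end comp

/-- Transport along a bijection, with the Koszul sign of the permutation of the arguments. -/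
def mapOp {I I' : Type} [Fintype I] [LinearOrder I] [Nonempty I] [Fintype I'] [LinearOrder I']
    [Nonempty I'] (e : I ≃ I') {y : I' → Cx C} {x : Cx C} (n : ℤ) :
    Op I (fun i => y (e i)) x n →ₗ[k] Op I' y x n where
  toFun f := ⟨fun a b => permSign e (fun i => (y (e i)).deg (a (e i))) •
      C.map (y := fun i => (y i).X (a i)) e (f.1 (fun i => a (e i)) b), by
    intro a b hab
    have hf := f.2 (fun i => a (e i)) b (by
      rwa [Equiv.sum_comp e (fun i => (y i).deg (a i))])
    refine (congrArg _ (congrArg _ hf)).trans ?_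
    rw [map_zero, smul_zero]⟩
  map_add' f f' := by
    apply Subtype.ext
    funext a b
    exact (congrArg (permSign e (fun i => (y (e i)).deg (a (e i))) • ·)
      ((C.map (y := fun i => (y i).X (a i)) e).map_add (f.1 (fun i => a (e i)) b) _)).trans
      (smul_add _ _ _)
  map_smul' r f := by
    apply Subtype.ext
    funext a b
    exact (congrArg (permSign e (fun i => (y (e i)).deg (a (e i))) • ·)
      ((C.map (y := fun i => (y i).X (a i)) e).map_smul r (f.1 (fun i => a (e i)) b))).trans
      (smul_comm _ _ _)

open Classical in
/-- The identity operation of a complex. -/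
def one (x : Cx C) : Op Unit (fun _ => x) x 0 :=
  ⟨fun a b => if h : a () = b then h ▸ C.id (x.X (a ())) else 0, by
    intro a b hab
    refine dif_neg ?_
    rintro rfl
    simp at hab⟩

/-- The differential of a complex, as an operation of degree `1`. -/
def dOp (x : Cx C) : Op Unit (fun _ => x) x 1 :=
  ⟨fun a b => x.d (a ()) b, fun a b hab => x.d_eq_zero _ _ (by simpa using hab)⟩

/-- The family `(1, …, d, …, 1)` with the differential of `y i` at the place `i`. -/
def dFamily {I : Type} [LinearOrder I] (y : I → Cx C) (i j : I) :
    Op Unit (fun _ => y j) (y j) (if j = i then 1 else 0) :=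
  ⟨if j = i then (y j).dOp.1 else (y j).one.1, by
    split_ifs
    · exact (y j).dOp.2
    · exact (y j).one.2⟩

/-- The differential of the complex of operations, of degree `n`:
`d f = d ∘ f - (-1)^n ∑ i, f ∘ (1, …, d, …, 1)`. -/
def dP {I : Type} [Fintype I] [LinearOrder I] [Nonempty I] {y : I → Cx C} {x : Cx C} (n n' : ℤ)
    (h : n + 1 = n') : Op I y x n →ₗ[k] Op I y x n' where
  toFun f :=
    mapOp (unitSigma I) n'
        (comp (J := fun _ => I) (z := fun _ => y) 1 (fun _ => n) n' (by simp; omega) x.dOp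
          (fun _ => f)) -
      Int.negOnePow n • ∑ i, mapOp (sigmaUnit I) n'
        (comp (J := fun _ => Unit) (z := fun j _ => y j) n (fun j => if j = i then 1 else 0) n'
          (by simpa using h) f (dFamily y i))
  map_add' f f' := by
    have := (comp (J := fun _ : Unit => I) (z := fun _ => y) 1 (fun _ => n) n'
      (by simp; omega) x.dOp).map_update_add (fun _ => f) () f f'
    simp only [Function.update_eq_const_of_subsingleton] at this
    refine (congrArg₂ _ (congrArg (mapOp (unitSigma I) n') this) rfl).trans ?_
    simp only [map_add, add_apply, Finset.sum_add_distrib, smul_add]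
    exact add_sub_add_comm _ _ _ _
  map_smul' r f := by
    have := (comp (J := fun _ : Unit => I) (z := fun _ => y) 1 (fun _ => n) n'
      (by simp; omega) x.dOp).map_update_smul (fun _ => f) () r f
    simp only [Function.update_eq_const_of_subsingleton] at this
    refine (congrArg₂ _ (congrArg (mapOp (unitSigma I) n') this) rfl).trans ?_
    simp only [map_smul, smul_apply, ← Finset.smul_sum, smul_comm _ r, RingHom.id_apply, smul_sub]
    rfl

end Cx

/-- The pseudo-tensor category of complexes in `C`, enriched in complexes of vector spaces. -/
abbrev complexes (C : PTCat.{u, v, w} k) : DGPTData.{u, max 1 v w, w} k where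
  Ob := Cx C
  P I _ _ _ y x n := Cx.Op I y x n
  d n n' h := Cx.dP n n' h
  map {_ _ _ _ _ _ _ _} e {_ _} n := Cx.mapOp e n
  id x := x.one
  comp {_ _ _ _ _ _ _ _ _ _ _} n m N h := Cx.comp n m N h

/-- The complex `MB` of a cosimplicial Lie algebra `B`: the object `B^n` in degree `n`, with the
alternating sum of the cofaces as the differential. -/
def MB {C : PTCat.{u, v, w} k} (B : CosimplicialLie C) : Cx C where
  ι := ℕ
  deg n := n
  deg_injective := Nat.cast_injective
  X n := (B.lie ⦋n⦌).carrier
  d a b := ((AlgebraicTopology.alternatingCofaceMapComplex C.Und).obj B.toCosimplicial).d a b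
  d_eq_zero a b h := HomologicalComplex.shape _ _ _ (fun h' => h (by exact_mod_cast h'.symm))
  d_d a b c := HomologicalComplex.d_comp_d
    ((AlgebraicTopology.alternatingCofaceMapComplex C.Und).obj B.toCosimplicial) a b c


/-! ### The tensor product of an operad with a differential graded operad -/

section tensor

variable {ι : Type} [Fintype ι] {A B : ι → Type*} [∀ i, AddCommGroup (A i)] [∀ i, Module k (A i)]
  [∀ i, AddCommGroup (B i)] [∀ i, Module k (B i)]

open Classical in
variable (k A B) in
/-- The canonical map `⨂ᵢ (A i ⊗ B i) → (⨂ᵢ A i) ⊗ (⨂ᵢ B i)`, written with the help of bases of the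
`A i`; see `tensorSplit_tmul`. -/
def tensorSplit :
    (⨂[k] i, (A i ⊗[k] B i)) →ₗ[k] (⨂[k] i, A i) ⊗[k] (⨂[k] i, B i) :=
  (Finsupp.lsum k (fun p : ∀ i, Module.Basis.ofVectorSpaceIndex k (A i) =>
      TensorProduct.mk k (⨂[k] i, A i) (⨂[k] i, B i)
        (⨂ₜ[k] i, Module.Basis.ofVectorSpace k (A i) (p i)))).comp
    ((PiTensorProduct.ofFinsuppEquiv (R := k)).toLinearMap.comp
      (PiTensorProduct.map fun i =>
        (TensorProduct.equivFinsuppOfBasisLeft (Module.Basis.ofVectorSpace k (A i))).toLinearMap))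

lemma tensorSplit_tmul (a : ∀ i, A i) (b : ∀ i, B i) :
    tensorSplit k A B (⨂ₜ[k] i, (a i ⊗ₜ[k] b i)) = (⨂ₜ[k] i, a i) ⊗ₜ[k] (⨂ₜ[k] i, b i) := by
  classical
  have key : ((tensorSplit k A B).compMultilinearMap
      ((PiTensorProduct.tprod k).compLinearMap fun i =>
        (TensorProduct.mk k (A i) (B i)).flip (b i))) =
      (((TensorProduct.mk k (⨂[k] i, A i) (⨂[k] i, B i)).flip (⨂ₜ[k] i, b i)).compMultilinearMap
        (PiTensorProduct.tprod k)) := by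
    refine Module.Basis.ext_multilinear (fun i => Module.Basis.ofVectorSpace k (A i)) fun v => ?_
    simp only [LinearMap.compMultilinearMap_apply, MultilinearMap.compLinearMap_apply,
      LinearMap.flip_apply, TensorProduct.mk_apply, tensorSplit, LinearMap.comp_apply,
      LinearEquiv.coe_coe, PiTensorProduct.map_tprod,
      TensorProduct.equivFinsuppOfBasisLeft_apply_tmul, Module.Basis.repr_self]
    have : ∀ i, Finsupp.mapRange (fun r : k => r • b i) (zero_smul k (b i))
        (Finsupp.single (v i) 1) = Finsupp.single (v i) (b i) := by
      intro i
      simp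
    simp only [this, PiTensorProduct.ofFinsuppEquiv_tprod_single]
    simp
  exact congrArg (fun φ => φ a) key

variable {A' B' M N : Type*} [AddCommGroup A'] [Module k A'] [AddCommGroup B'] [Module k B']
  [AddCommGroup M] [Module k M] [AddCommGroup N] [Module k N]

/-- The tensor product of two families of polylinear maps; see `tensorComp_tmul`. -/
def tensorComp (φ : A' →ₗ[k] MultilinearMap k A M) (ψ : B' →ₗ[k] MultilinearMap k B N) :
    (A' ⊗[k] B') →ₗ[k] MultilinearMap k (fun i => A i ⊗[k] B i) (M ⊗[k] N) :=
  TensorProduct.lift <| LinearMap.mk₂ k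
    (fun a b => ((TensorProduct.map (PiTensorProduct.lift (φ a)) (PiTensorProduct.lift (ψ b))).comp
      (tensorSplit k A B)).compMultilinearMap (PiTensorProduct.tprod k))
    (fun a a' b => by ext x; simp [TensorProduct.map_add_left])
    (fun r a b => by ext x; simp [TensorProduct.map_smul_left])
    (fun a b b' => by ext x; simp [TensorProduct.map_add_right])
    (fun r a b => by ext x; simp [TensorProduct.map_smul_right])

lemma tensorComp_tmul (φ : A' →ₗ[k] MultilinearMap k A M) (ψ : B' →ₗ[k] MultilinearMap k B N)
    (a : A') (b : B') (x : ∀ i, A i) (y : ∀ i, B i) :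
    tensorComp φ ψ (a ⊗ₜ b) (fun i => x i ⊗ₜ y i) = φ a x ⊗ₜ ψ b y := by
  simp [tensorComp, tensorSplit_tmul]

end tensor

/-- The tensor product `(A ⊗ Z)(I) = A(I) ⊗ Z(I)`, with the componentwise structure, where `A` is
placed in degree `0`. -/
abbrev tensorOperad (A : PTCat.{u, v, w} k) (Z : DGPTData.{u, v', w'} k) :
    DGPTData.{u, max v v', max w w'} k where
  Ob := A.Ob × Z.Ob
  P I _ _ _ y x n := A.P I (fun i => (y i).1) x.1 ⊗[k] Z.P I (fun i => (y i).2) x.2 n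
  d n n' h := (Z.d n n' h).lTensor _
  map {_ _ _ _ _ _ _ _} e {y _} n :=
    TensorProduct.map (A.map (y := fun i => (y i).1) e) (Z.map (y := fun i => (y i).2) e n)
  id x := A.id x.1 ⊗ₜ Z.id x.2
  comp {_ _ _ _ _ _ _ _ _ _ _} n m N h := tensorComp A.comp (Z.comp n m N h)


/-! ### The Eilenberg–Zilber operad -/

/-- The simplices of the standard simplex `Δ^m`: pairs of `l` and `p : [l] ⟶ [m]`. -/
abbrev Simp (m : ℕ) : Type := Σ l : ℕ, (⦋l⦌ ⟶ ⦋m⦌)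

/-- The map of simplices `Δ^m → Δ^m'` induced by `θ`. -/
def Simp.push {m m' : ℕ} (θ : ⦋m⦌ ⟶ ⦋m'⦌) (σ : Simp m) : Simp m' := ⟨σ.1, σ.2 ≫ θ⟩

variable (k) in
/-- `Z([m])`, the chains of `Δ^m`: the graded vector space with basis the simplices of `Δ^m`, an
`l`-simplex having degree `-l`. -/
abbrev ZChains (m : ℕ) : Type u := Simp m →₀ k

variable (k) in
/-- `Z([m])^{⊗ I}`: the graded vector space with basis the tensors `⨂ i, p i` of simplices of `Δ^m`;
the degree of such a tensor is minus the sum of the dimensions of the `p i`. -/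
abbrev ZTens (I : Type) (m : ℕ) : Type u := (I → Simp m) →₀ k

/-- The functoriality of `Z([m])` in `[m]`. -/
def zPush {m m' : ℕ} (θ : ⦋m⦌ ⟶ ⦋m'⦌) : ZChains k m →ₗ[k] ZChains k m' :=
  Finsupp.lmapDomain k k (Simp.push θ)

/-- The functoriality of `Z([m])^{⊗ I}` in `[m]`. -/
def zPushTens (I : Type) {m m' : ℕ} (θ : ⦋m⦌ ⟶ ⦋m'⦌) : ZTens k I m →ₗ[k] ZTens k I m' :=
  Finsupp.lmapDomain k k (fun p i => Simp.push θ (p i))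

/-- The boundary `∑ s, (-1)^s (p ∘ δ_s)` of a simplex. -/
def Simp.bdry {m : ℕ} (σ : Simp m) : ZChains k m :=
  match σ with
  | ⟨0, _⟩ => 0
  | ⟨l + 1, p⟩ => ∑ s : Fin (l + 2),
      Finsupp.single (⟨l, SimplexCategory.δ s ≫ p⟩ : Simp m) ((-1 : k) ^ (s : ℕ))

/-- The differential of `Z([m])`. -/
def zD (m : ℕ) : ZChains k m →ₗ[k] ZChains k m := Finsupp.linearCombination k Simp.bdry

/-- The differential of `Z([m])^{⊗ I}`, on a tensor `p₁ ⊗ … ⊗ pₙ` given by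
`∑ j, (-1)^(dim p₁ + … + dim p_{j-1}) p₁ ⊗ … ⊗ ∂ p_j ⊗ … ⊗ pₙ`. -/
def zDTens (I : Type) [Fintype I] [LinearOrder I] (m : ℕ) : ZTens k I m →ₗ[k] ZTens k I m :=
  Finsupp.linearCombination k fun p => ∑ j, Int.negOnePow (∑ i with i < j, ((p i).1 : ℤ)) •
    Finsupp.lmapDomain k k (fun σ => Function.update p j σ) (Simp.bdry (p j))

/-- `Hom_{Δ(k)}(Z, Z^{⊗ I})` in degree `n`: the families of linear maps `Z([m]) → Z([m])^{⊗ I}` of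
degree `n` that are natural in `[m]`. -/
def ZHom (k : Type u) [Field k] (I : Type) [Fintype I] (n : ℤ) :
    @Submodule k (∀ m : ℕ, ZChains k m →ₗ[k] ZTens k I m) _ AddCommGroup.toAddCommMonoid
      inferInstance where
  carrier := {φ | (∀ (m m' : ℕ) (θ : ⦋m⦌ ⟶ ⦋m'⦌), (φ m').comp (zPush θ) = (zPushTens I θ).comp (φ m)) ∧
    ∀ (m : ℕ) (σ : Simp m) (p : I → Simp m),
      -(∑ i, ((p i).1 : ℤ)) ≠ -(σ.1 : ℤ) + n → φ m (Finsupp.single σ 1) p = 0}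
  add_mem' {φ φ'} h h' := by
    refine ⟨fun m m' θ => ?_, fun m σ p hp => ?_⟩
    · simp only [Pi.add_apply, LinearMap.add_comp, LinearMap.comp_add, h.1, h'.1]
    · simp only [Pi.add_apply, LinearMap.add_apply, Finsupp.add_apply, h.2 m σ p hp,
        h'.2 m σ p hp, add_zero]
  zero_mem' := by
    refine ⟨fun m m' θ => ?_, fun m σ p hp => rfl⟩
    simp
  smul_mem' r φ h := by
    refine ⟨fun m m' θ => ?_, fun m σ p hp => ?_⟩
    · simp only [Pi.smul_apply, LinearMap.smul_comp, LinearMap.comp_smul, h.1]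
    · simp only [Pi.smul_apply, LinearMap.smul_apply, Finsupp.smul_apply, h.2 m σ p hp, smul_zero]

lemma zPush_single {m m' : ℕ} (θ : ⦋m⦌ ⟶ ⦋m'⦌) (σ : Simp m) (r : k) :
    zPush θ (Finsupp.single σ r) = Finsupp.single (Simp.push θ σ) r := by
  simp [zPush]

lemma zPushTens_single (I : Type) {m m' : ℕ} (θ : ⦋m⦌ ⟶ ⦋m'⦌) (p : I → Simp m) (r : k) :
    zPushTens I θ (Finsupp.single p r) = Finsupp.single (fun i => Simp.push θ (p i)) r := by
  simp [zPushTens]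

lemma bdry_push {m m' : ℕ} (θ : ⦋m⦌ ⟶ ⦋m'⦌) (σ : Simp m) :
    (Simp.bdry (Simp.push θ σ) : ZChains k m') = zPush θ (Simp.bdry σ) := by
  obtain ⟨l, p⟩ := σ
  cases l with
  | zero => simp [Simp.push, Simp.bdry]
  | succ l =>
    simp only [Simp.push, Simp.bdry, map_sum, zPush_single]
    refine Finset.sum_congr rfl fun s _ => ?_
    rw [Category.assoc]

lemma bdry_apply_eq_zero {m : ℕ} (σ τ : Simp m) (h : τ.1 + 1 ≠ σ.1) :
    (Simp.bdry σ : ZChains k m) τ = 0 := by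
  obtain ⟨l, p⟩ := σ
  cases l with
  | zero => simp [Simp.bdry]
  | succ l =>
    simp only [Simp.bdry, Finsupp.coe_finsetSum, Finset.sum_apply]
    refine Finset.sum_eq_zero fun s _ => Finsupp.single_eq_of_ne ?_
    rintro rfl
    exact h rfl

lemma zD_comp_zPush {m m' : ℕ} (θ : ⦋m⦌ ⟶ ⦋m'⦌) :
    (zD m').comp (zPush θ) = (zPush (k := k) θ).comp (zD m) := by
  ext σ : 1
  ext
  simp [zD, zPush_single, bdry_push]

lemma zDTens_comp_zPushTens (I : Type) [Fintype I] [LinearOrder I] {m m' : ℕ} (θ : ⦋m⦌ ⟶ ⦋m'⦌) :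
    (zDTens I m').comp (zPushTens I θ) = (zPushTens (k := k) I θ).comp (zDTens I m) := by
  refine Finsupp.lhom_ext' fun p => LinearMap.ext_ring ?_
  simp only [LinearMap.comp_apply, Finsupp.lsingle_apply, zPushTens_single, zDTens,
    Finsupp.linearCombination_single, one_smul, map_sum, bdry_push]
  refine Finset.sum_congr rfl fun j _ => ?_
  rw [Units.smul_def, Units.smul_def, map_zsmul]
  congr 1
  simp only [zPush, zPushTens, Finsupp.lmapDomain_apply, ← Finsupp.mapDomain_comp]
  congr 1
  funext σ i
  by_cases h : i = j
  · subst h; simp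
  · simp [h]

/-- The coefficient of `q` in `ψ x` vanishes if it does so for all `ψ p` with `p` in the support of `x`. -/
lemma apply_eq_zero_of_support {X Y : Type} (ψ : (X →₀ k) →ₗ[k] (Y →₀ k)) (x : X →₀ k) (q : Y)
    (h : ∀ p, x p ≠ 0 → ψ (Finsupp.single p 1) q = 0) : ψ x q = 0 := by
  have hx : ψ x = x.sum fun p r => r • ψ (Finsupp.single p 1) := by
    conv_lhs => rw [← Finsupp.sum_single x]
    rw [map_finsuppSum]
    refine Finsupp.sum_congr fun p _ => ?_
    rw [← map_smul, Finsupp.smul_single, smul_eq_mul, mul_one]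
  rw [hx, Finsupp.sum, Finsupp.coe_finsetSum, Finset.sum_apply]
  refine Finset.sum_eq_zero fun p hp => ?_
  rw [Finsupp.smul_apply, h p (Finsupp.mem_support_iff.1 hp), smul_zero]

lemma zDTens_apply_eq_zero (I : Type) [Fintype I] [LinearOrder I] {m : ℕ} (p q : I → Simp m)
    (h : ∑ i, ((q i).1 : ℤ) + 1 ≠ ∑ i, ((p i).1 : ℤ)) :
    zDTens (k := k) I m (Finsupp.single p 1) q = 0 := by
  simp only [zDTens, Finsupp.linearCombination_single, one_smul, Finsupp.coe_finsetSum,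
    Finset.sum_apply]
  refine Finset.sum_eq_zero fun j _ => ?_
  rw [Units.smul_def, Finsupp.smul_apply]
  rw [apply_eq_zero_of_support, smul_zero]
  intro τ hτ
  rw [Finsupp.lmapDomain_apply, Finsupp.mapDomain_single]
  refine Finsupp.single_eq_of_ne ?_
  rintro rfl
  have h1 : τ.1 + 1 = (p j).1 := by
    by_contra h1
    exact hτ (bdry_apply_eq_zero _ _ h1)
  apply h
  rw [← Finset.add_sum_erase _ _ (Finset.mem_univ j),
    ← Finset.add_sum_erase Finset.univ (fun i => ((p i).1 : ℤ)) (Finset.mem_univ j), ← h1]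
  have : ∑ i ∈ Finset.univ.erase j, ((Function.update p j τ i).1 : ℤ) =
      ∑ i ∈ Finset.univ.erase j, ((p i).1 : ℤ) :=
    Finset.sum_congr rfl fun i hi => by rw [Function.update_of_ne (Finset.ne_of_mem_erase hi)]
  rw [this]
  simp
  ring

/-- The differential of the total complex `Tot Hom_{Δ(k)}(Z, Z^{⊗ I})`:
`D φ = φ ∘ d - (-1)^n d ∘ φ` for `φ` of degree `n`. -/
def zDiff {I : Type} [Fintype I] [LinearOrder I] (n n' : ℤ) (h : n + 1 = n') :
    ZHom k I n →ₗ[k] ZHom k I n' where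
  toFun φ := ⟨fun m => (φ.1 m).comp (zD m) - Int.negOnePow n • (zDTens I m).comp (φ.1 m), by
    refine ⟨fun m m' θ => ?_, fun m σ p hp => ?_⟩
    · refine LinearMap.ext fun x => ?_
      have h1 := LinearMap.congr_fun (zD_comp_zPush (k := k) θ) x
      have h2 := LinearMap.congr_fun (φ.2.1 m m' θ)
      have h3 := LinearMap.congr_fun (zDTens_comp_zPushTens (k := k) I θ) (φ.1 m x)
      simp only [LinearMap.comp_apply] at h1 h2 h3
      simp only [LinearMap.comp_apply, LinearMap.sub_apply, Units.smul_def, LinearMap.smul_apply,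
        map_sub, map_zsmul, h1, h2, h3]
    · rw [LinearMap.sub_apply, Finsupp.sub_apply, LinearMap.comp_apply,
        apply_eq_zero_of_support, Units.smul_def, LinearMap.smul_apply, Finsupp.smul_apply,
        LinearMap.comp_apply, apply_eq_zero_of_support, smul_zero, sub_zero]
      · intro q hq
        refine zDTens_apply_eq_zero I q p fun h' => hq (φ.2.2 m σ q ?_)
        omega
      · intro τ hτ
        refine φ.2.2 m τ p fun h' => hτ ?_
        rw [zD, Finsupp.linearCombination_single, one_smul]
        refine bdry_apply_eq_zero _ _ ?_
        omega⟩
  map_add' φ φ' := by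
    apply Subtype.ext
    funext m
    simp only [Submodule.coe_add, Pi.add_apply, LinearMap.add_comp, LinearMap.comp_add, smul_add]
    abel
  map_smul' r φ := by
    apply Subtype.ext
    funext m
    simp only [Submodule.coe_smul, Pi.smul_apply, LinearMap.smul_comp, LinearMap.comp_smul,
      RingHom.id_apply]
    refine LinearMap.ext fun x => ?_
    simp only [LinearMap.sub_apply, LinearMap.smul_apply, Units.smul_def, smul_sub]
    rw [smul_comm r]

/-- The permutation of the tensor factors of `Z([m])^{⊗ I}`, with the Koszul sign. -/
def zPerm {I I' : Type} [Fintype I] [LinearOrder I] [LinearOrder I'] (e : I ≃ I') (m : ℕ) :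
    ZTens k I m →ₗ[k] ZTens k I' m :=
  Finsupp.linearCombination k fun p => permSign e (fun i => ((p i).1 : ℤ)) •
    Finsupp.single (fun i' => p (e.symm i')) (1 : k)

lemma zPerm_comp_zPushTens {I I' : Type} [Fintype I] [LinearOrder I] [LinearOrder I'] (e : I ≃ I')
    {m m' : ℕ} (θ : ⦋m⦌ ⟶ ⦋m'⦌) :
    (zPerm e m').comp (zPushTens I θ) = (zPushTens (k := k) I' θ).comp (zPerm e m) := by
  refine Finsupp.lhom_ext' fun p => LinearMap.ext_ring ?_
  simp only [LinearMap.comp_apply, Finsupp.lsingle_apply, zPushTens_single, zPerm,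
    Finsupp.linearCombination_single, one_smul, Units.smul_def, map_zsmul]
  rfl

/-- Transport of `φ ∈ Hom_{Δ(k)}(Z, Z^{⊗ I})` along a bijection. -/
def zMap {I I' : Type} [Fintype I] [LinearOrder I] [Fintype I'] [LinearOrder I'] (e : I ≃ I')
    (n : ℤ) : ZHom k I n →ₗ[k] ZHom k I' n where
  toFun φ := ⟨fun m => (zPerm e m).comp (φ.1 m), by
    refine ⟨fun m m' θ => ?_, fun m σ p hp => ?_⟩
    · rw [LinearMap.comp_assoc, φ.2.1, ← LinearMap.comp_assoc, zPerm_comp_zPushTens,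
        LinearMap.comp_assoc]
    · rw [LinearMap.comp_apply, apply_eq_zero_of_support]
      intro q hq
      simp only [zPerm, Finsupp.linearCombination_single, one_smul, Units.smul_def,
        Finsupp.smul_apply]
      rw [Finsupp.single_eq_of_ne, smul_zero]
      rintro rfl
      refine hq (φ.2.2 m σ q ?_)
      rwa [Equiv.sum_comp e.symm (fun i => ((q i).1 : ℤ))] at hp⟩
  map_add' φ φ' := by
    apply Subtype.ext
    funext m
    simp only [Submodule.coe_add, Pi.add_apply, LinearMap.comp_add]
  map_smul' r φ := by
    apply Subtype.ext
    funext m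
    simp only [Submodule.coe_smul, Pi.smul_apply, LinearMap.comp_smul, RingHom.id_apply]

/-- The identity of `Z`. -/
def zOne : ZHom k Unit 0 :=
  ⟨fun m => Finsupp.lmapDomain k k (fun σ _ => σ), by
    refine ⟨fun m m' θ => ?_, fun m σ p hp => ?_⟩
    · refine Finsupp.lhom_ext' fun σ => LinearMap.ext_ring ?_
      simp [zPush_single, zPushTens_single]
    · rw [Finsupp.lmapDomain_apply, Finsupp.mapDomain_single]
      refine Finsupp.single_eq_of_ne ?_
      rintro rfl
      simp at hp⟩

section comp

variable {I : Type} [Fintype I] {J : I → Type}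

open Classical in
variable (k) in
/-- The identification `⨂ i, Z([m])^{⊗ J i} → Z([m])^{⊗ (Σ i, J i)}` of tensor products, as a
polylinear map. -/
def zTensor (J : I → Type) (m : ℕ) :
    MultilinearMap k (fun i => ZTens k (J i) m) (ZTens k (Σ i, J i) m) :=
  ((Finsupp.domLCongr (Equiv.piCurry (fun (i : I) (_ : J i) => Simp m)).symm).toLinearMap.comp
    (PiTensorProduct.ofFinsuppEquiv' (R := k) (κ := fun i => J i → Simp m)).toLinearMap
    ).compMultilinearMap (PiTensorProduct.tprod k)

lemma zTensor_apply (m : ℕ) (x : ∀ i, ZTens k (J i) m) (p : (Σ i, J i) → Simp m) :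
    zTensor k J m x p = ∏ i, x i (fun j => p ⟨i, j⟩) := by
  simp [zTensor, Finsupp.domLCongr_apply, Finsupp.domCongr_apply]
  rfl

lemma zTensor_push {m m' : ℕ} (θ : ⦋m⦌ ⟶ ⦋m'⦌) (x : ∀ i, ZTens k (J i) m) :
    zTensor k J m' (fun i => zPushTens (J i) θ (x i)) =
      zPushTens (Σ i, J i) θ (zTensor k J m x) := by
  classical
  have : (zTensor k J m').compLinearMap (fun i => zPushTens (k := k) (J i) θ) =
      (zPushTens (k := k) (Σ i, J i) θ).compMultilinearMap (zTensor k J m) := by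
    refine Module.Basis.ext_multilinear
      (fun i => Finsupp.basisSingleOne (R := k) (ι := J i → Simp m)) fun v => ?_
    have h1 : ∀ (m : ℕ) (v : ∀ i, J i → Simp m),
        zTensor k J m (fun i => Finsupp.single (v i) 1) =
          Finsupp.single (fun p => v p.1 p.2) 1 := by
      intro m v
      ext p
      rw [zTensor_apply, Finsupp.single_apply]
      simp only [Finsupp.single_apply]
      split_ifs with h
      · subst h
        simp
      · by_contra hne
        have h2 := fun i => Finset.prod_ne_zero_iff.1 hne i (Finset.mem_univ i)
        refine h (funext fun p => ?_)
        have := h2 p.1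
        rw [ne_eq, ite_eq_right_iff, not_forall] at this
        exact congrFun this.1 p.2
    simp only [MultilinearMap.compLinearMap_apply, LinearMap.compMultilinearMap_apply,
      Finsupp.coe_basisSingleOne, zPushTens_single, h1]
  exact congrArg (fun f => f x) this

variable [∀ i, Fintype (J i)] [LinearOrder I]

/-- The map `φ₁ ⊗ … ⊗ φₙ : Z([m])^{⊗ I} → Z([m])^{⊗ (Σ i, J i)}` for `φ i` of degree `r i`.  On
`p₁ ⊗ … ⊗ pₙ` its value is `± φ₁(p₁) ⊗ … ⊗ φₙ(pₙ)` with the sign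
`∏_{i < i'} (-1)^(r i' * |φ i (p i)|)`, where `|φ i (p i)| = r i - dim (p i)`. -/
def zTensorMap (r : I → ℤ) (m : ℕ) (φ : ∀ i, ZHom k (J i) (r i)) :
    ZTens k I m →ₗ[k] ZTens k (Σ i, J i) m :=
  Finsupp.linearCombination k fun p => shuffleSign r (fun i => r i - ((p i).1 : ℤ)) •
    zTensor k J m (fun i => (φ i).1 m (Finsupp.single (p i) 1))

lemma zTensorMap_single (r : I → ℤ) (m : ℕ) (φ : ∀ i, ZHom k (J i) (r i)) (p : I → Simp m) :
    zTensorMap r m φ (Finsupp.single p 1) = shuffleSign r (fun i => r i - ((p i).1 : ℤ)) •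
      zTensor k J m (fun i => (φ i).1 m (Finsupp.single (p i) 1)) := by
  simp [zTensorMap]

lemma zTensorMap_comp_push (r : I → ℤ) (φ : ∀ i, ZHom k (J i) (r i)) {m m' : ℕ}
    (θ : ⦋m⦌ ⟶ ⦋m'⦌) :
    (zTensorMap r m' φ).comp (zPushTens I θ) =
      (zPushTens (Σ i, J i) θ).comp (zTensorMap r m φ) := by
  refine Finsupp.lhom_ext' fun p => LinearMap.ext_ring ?_
  simp only [LinearMap.comp_apply, Finsupp.lsingle_apply, zPushTens_single, zTensorMap_single,
    Units.smul_def, map_zsmul, ← zTensor_push]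
  have : ∀ i, (φ i).1 m' (Finsupp.single (Simp.push θ (p i)) 1) =
      zPushTens (J i) θ ((φ i).1 m (Finsupp.single (p i) 1)) := by
    intro i
    have := LinearMap.congr_fun ((φ i).2.1 m m' θ) (Finsupp.single (p i) 1)
    rwa [LinearMap.comp_apply, zPush_single] at this
  simp only [this]
  rfl

lemma zTensorMap_apply_eq_zero (r : I → ℤ) (m : ℕ) (φ : ∀ i, ZHom k (J i) (r i)) (p : I → Simp m)
    (q : (Σ i, J i) → Simp m)
    (h : -(∑ i, ((q i).1 : ℤ)) ≠ -(∑ i, ((p i).1 : ℤ)) + ∑ i, r i) :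
    zTensorMap r m φ (Finsupp.single p 1) q = 0 := by
  rw [zTensorMap_single, Units.smul_def, Finsupp.smul_apply, zTensor_apply]
  have : ∃ i, -(∑ j, ((q ⟨i, j⟩).1 : ℤ)) ≠ -((p i).1 : ℤ) + r i := by
    by_contra hc
    push Not at hc
    apply h
    rw [Fintype.sum_sigma, ← Finset.sum_neg_distrib, Finset.sum_congr rfl (fun i _ => hc i),
      Finset.sum_add_distrib, Finset.sum_neg_distrib]
  obtain ⟨i, hi⟩ := this
  rw [Finset.prod_eq_zero (Finset.mem_univ i) ((φ i).2.2 m (p i) _ hi), smul_zero]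

/-- The operadic composition `(φ; φ₁, …, φₙ) ↦ (φ₁ ⊗ … ⊗ φₙ) ∘ φ`. -/
def zCompFun (n : ℤ) (r : I → ℤ) (N : ℤ) (h : n + ∑ i, r i = N) (φ : ZHom k I n)
    (φ' : ∀ i, ZHom k (J i) (r i)) : ZHom k (Σ i, J i) N :=
  ⟨fun m => (zTensorMap r m φ').comp (φ.1 m), by
    refine ⟨fun m m' θ => ?_, fun m σ p hp => ?_⟩
    · rw [LinearMap.comp_assoc, φ.2.1, ← LinearMap.comp_assoc, zTensorMap_comp_push,
        LinearMap.comp_assoc]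
    · rw [LinearMap.comp_apply, apply_eq_zero_of_support]
      intro q hq
      refine zTensorMap_apply_eq_zero r m φ' q p fun h' => hq (φ.2.2 m σ q ?_)
      omega⟩

variable (k J) in
/-- `zTensorMap` as a polylinear map. -/
def zTensorMapₗ (r : I → ℤ) (m : ℕ) :
    MultilinearMap k (fun i => ZHom k (J i) (r i)) (ZTens k I m →ₗ[k] ZTens k (Σ i, J i) m) where
  toFun φ := zTensorMap r m φ
  map_update_add' φ i a b := by
    refine Finsupp.lhom_ext' fun p => LinearMap.ext_ring ?_
    simp only [LinearMap.comp_apply, LinearMap.add_apply, Finsupp.lsingle_apply, zTensorMap_single]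
    rw [← smul_add]
    exact congrArg _ (((zTensor k J m).compLinearMap
      (fun i => (LinearMap.applyₗ (Finsupp.single (p i) (1 : k))).comp
        ((LinearMap.proj m).comp (ZHom k (J i) (r i)).subtype))).map_update_add φ i a b)
  map_update_smul' φ i s a := by
    refine Finsupp.lhom_ext' fun p => LinearMap.ext_ring ?_
    simp only [LinearMap.comp_apply, LinearMap.smul_apply, Finsupp.lsingle_apply,
      zTensorMap_single]
    rw [smul_comm s]
    exact congrArg _ (((zTensor k J m).compLinearMap
      (fun i => (LinearMap.applyₗ (Finsupp.single (p i) (1 : k))).comp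
        ((LinearMap.proj m).comp (ZHom k (J i) (r i)).subtype))).map_update_smul φ i s a)

/-- The operadic composition as a polylinear map. -/
def zComp (n : ℤ) (r : I → ℤ) (N : ℤ) (h : n + ∑ i, r i = N) :
    ZHom k I n →ₗ[k] MultilinearMap k (fun i => ZHom k (J i) (r i)) (ZHom k (Σ i, J i) N) where
  toFun φ :=
    { toFun := fun φ' => zCompFun n r N h φ φ'
      map_update_add' := by
        intro _ φ' i a b
        apply Subtype.ext
        funext m
        exact (congrArg (fun F => F.comp (φ.1 m))
          ((zTensorMapₗ k J r m).map_update_add φ' i a b)).trans (LinearMap.add_comp _ _ _)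
      map_update_smul' := by
        intro _ φ' i s a
        apply Subtype.ext
        funext m
        exact (congrArg (fun F => F.comp (φ.1 m))
          ((zTensorMapₗ k J r m).map_update_smul φ' i s a)).trans (LinearMap.smul_comp _ _ _) }
  map_add' φ φ₁ := by
    ext1 φ'
    apply Subtype.ext
    funext m
    exact LinearMap.comp_add _ _ _
  map_smul' s φ := by
    ext1 φ'
    apply Subtype.ext
    funext m
    exact LinearMap.comp_smul _ _ _

end comp

variable (k) in
/-- The Eilenberg–Zilber operad `Z(I) = Tot Hom_{Δ(k)}(Z, Z^{⊗ I})`. -/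
abbrev EZ : DGPTData.{u, 0, u} k where
  Ob := Unit
  P I _ _ _ _ _ n := ↥(ZHom k I n)
  d n n' h := zDiff n n' h
  map {_ _ _ _ _ _ _ _} e {_ _} n := zMap e n
  id _ := zOne
  comp {I _ _ _ J _ _ _ _ _ _} n m N h := zComp (k := k) (I := I) (J := J) n m N h


/-! ### The action of `Lie ⊗ Z` on `MB` -/

variable (k) in
/-- The Lie Eilenberg–Zilber operad `Lie ⊗ Z`. -/
abbrev LieEZ : DGPTData.{u, 0, u} k := tensorOperad (LieOp k) (EZ k)

instance (a b : SimplexCategory) : Fintype (a ⟶ b) := Fintype.ofFinite _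

section action

variable {C : PTCat.{u, v, w} k} (B : CosimplicialLie C)

section

variable {I : Type} [Fintype I]

/-- The coefficient at `⨂ i, p i` of the value of `φ` at the identity of `[b]`, where
`p i : [a i] ⟶ [b]`. -/
def coef {n : ℤ} (φ : ZHom k I n) (a : I → ℕ) (b : ℕ) (p : ∀ i, (⦋a i⦌ ⟶ ⦋b⦌)) : k :=
  φ.1 b (Finsupp.single ⟨b, 𝟙 ⦋b⦌⟩ 1) (fun i => ⟨a i, p i⟩)

variable [LinearOrder I] [Nonempty I]

/-- The operation `ψ_b (φ̄) ∈ P I (B^(a i)) (B^b)`: the sum over the families of maps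
`p i : [a i] ⟶ [b]` of the compositions of `ψ_b ∈ P I ({B^b}, B^b)` with the `B(p i)`, multiplied by
the coefficients of `φ`. -/
def entry (ψ : Lie k I) {n : ℤ} (φ : ZHom k I n) (a : I → ℕ) (b : ℕ) :
    C.P I (fun i => (B.lie ⦋a i⦌).carrier) (B.lie ⦋b⦌).carrier :=
  ∑ p : ∀ i, (⦋a i⦌ ⟶ ⦋b⦌),
    coef φ a b p • C.pre ((B.lie ⦋b⦌).act I ψ) (fun i => B.mor (p i))

/-- The operation of degree `n` on `MB` defined by `ψ ∈ Lie(I)` and `φ ∈ Z(I)` of degree `n`; its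
component from the `B^(a i)` to `B^b` is `entry`, which vanishes unless `b = ∑ i, a i + n`. -/
def opOf (ψ : Lie k I) {n : ℤ} (φ : ZHom k I n) : Cx.Op I (fun _ => MB B) (MB B) n :=
  ⟨fun a b => entry B ψ φ a b, fun a b h => Finset.sum_eq_zero fun p _ => by
    have : coef φ a b p = 0 := φ.2.2 b ⟨b, 𝟙 _⟩ (fun i => ⟨a i, p i⟩) (by
      intro h'
      apply h
      have h2 : -(∑ i, (MB B).deg (a i)) = -(MB B).deg b + n := h'
      linarith)
    exact (congrArg (· • _) this).trans (zero_smul k _)⟩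

end

/-- The maps `F_I : Lie(I) ⊗ Z(I) → P_I ({MB}, MB)`. -/
def F (I : Type) [Fintype I] [LinearOrder I] [Nonempty I] (y : I → (LieEZ k).Ob) (x : (LieEZ k).Ob)
    (n : ℤ) : (LieEZ k).P I y x n →ₗ[k] (complexes C).P I (fun _ => MB B) (MB B) n :=
  TensorProduct.lift (LinearMap.mk₂ k (fun (ψ : Lie k I) (φ : ZHom k I n) => opOf B ψ φ)
    (by
      intro ψ ψ' φ
      apply Subtype.ext
      funext a b
      change entry B (ψ + ψ') φ a b = entry B ψ φ a b + entry B ψ' φ a b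
      simp only [entry, PTCat.pre, map_add, add_apply, smul_add, Finset.sum_add_distrib])
    (by
      intro r ψ φ
      apply Subtype.ext
      funext a b
      change entry B (r • ψ) φ a b = r • entry B ψ φ a b
      simp only [entry, PTCat.pre, map_smul, smul_apply, Finset.smul_sum, smul_comm r])
    (by
      intro ψ φ φ'
      apply Subtype.ext
      funext a b
      change entry B ψ (φ + φ') a b = entry B ψ φ a b + entry B ψ φ' a b
      have this (p : ∀ i, (⦋a i⦌ ⟶ ⦋b⦌)) : coef (φ + φ') a b p = coef φ a b p + coef φ' a b p := rfl
      simp only [entry, this, add_smul, Finset.sum_add_distrib])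
    (by
      intro r ψ φ
      apply Subtype.ext
      funext a b
      change entry B ψ (r • φ) a b = r • entry B ψ φ a b
      have this (p : ∀ i, (⦋a i⦌ ⟶ ⦋b⦌)) : coef (r • φ) a b p = r * coef φ a b p := rfl
      simp only [entry, this, mul_smul, Finset.smul_sum]))

lemma F_tmul_apply (I : Type) [Fintype I] [LinearOrder I] [Nonempty I] (y : I → (LieEZ k).Ob)
    (x : (LieEZ k).Ob) (n : ℤ) (ψ : Lie k I) (φ : ZHom k I n) (a : I → ℕ) (b : ℕ) :
    (F B I y x n (ψ ⊗ₜ[k] φ)).1 a b = ∑ p : ∀ i, (⦋a i⦌ ⟶ ⦋b⦌),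
      φ.1 b (Finsupp.single ⟨b, 𝟙 ⦋b⦌⟩ 1) (fun i => ⟨a i, p i⟩) •
        C.pre ((B.lie ⦋b⦌).act I ψ) (fun i => B.mor (p i)) :=
  rfl

end action

/-! ### The augmentation -/

/-- The linear form on `Z(I)` which takes `φ` to the coefficient of `φ(id_[0])` at
`id_[0] ⊗ … ⊗ id_[0]`. -/
def augZ (I : Type) [Fintype I] (n : ℤ) : ZHom k I n →ₗ[k] k where
  toFun φ := coef φ (fun _ => 0) 0 (fun _ => 𝟙 _)
  map_add' _ _ := rfl
  map_smul' _ _ := rfl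

variable (k) in
/-- The truncated operad `τ_{≤ 0} (Lie ⊗ Z)`. -/
abbrev LieEZTrunc (h : (LieEZ k).IsSub (LieEZ k).tau) : DGPTData.{u, 0, u} k :=
  (LieEZ k).sub (LieEZ k).tau h

/-- The augmentation `ε : τ_{≤ 0} (Lie ⊗ Z) → Lie`: in degree `0` it takes `ψ ⊗ φ` to the multiple
of `ψ` by the value of `augZ` at `φ`, in the other degrees it is zero. -/
def augmentation (h : (LieEZ k).IsSub (LieEZ k).tau) (I : Type) [Fintype I] [LinearOrder I]
    [Nonempty I] (y : I → (LieEZTrunc k h).Ob) (x : (LieEZTrunc k h).Ob) (n : ℤ) :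
    (LieEZTrunc k h).P I y x n →ₗ[k] (LieOp k).toDG.P I (fun _ => ()) () n :=
  LinearMap.codRestrict (inDegreeZero (k := k) (Lie k I) n)
    (if n = 0 then
      (TensorProduct.lift (LinearMap.mk₂ k (fun (ψ : Lie k I) (φ : ZHom k I n) => augZ I n φ • ψ)
        (by intros; simp only [smul_add]) (by intros; rw [smul_comm])
        (by intros; rw [map_add, add_smul]) (by intros; rw [map_smul, smul_assoc]))).comp
        ((LieEZ k).tau I y x n).subtype
    else 0) (fun f hn => by rw [if_neg hn]; rfl)

/-- The operad `L` (a pseudo-tensor category with a unique object, enriched in complexes) together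
with `ε : L → Lie` is a homotopy Lie operad: `ε` is a morphism of operads and a quasi-isomorphism in
each arity. -/
structure IsHomotopyLieOperad (L : DGPTData.{u, v, w} k)
    (ε : ∀ (I : Type) [Fintype I] [LinearOrder I] [Nonempty I] (y : I → L.Ob) (x : L.Ob) (n : ℤ),
      L.P I y x n →ₗ[k] (LieOp k).toDG.P I (fun _ => ()) () n) : Prop where
  unique : Nonempty (Unique L.Ob)
  lawful : L.Lawful
  isFunctor : DGPTData.IsFunctor L (LieOp k).toDG (fun _ => ()) ε
  isQuasiIso : DGPTData.IsQuasiIso L (LieOp k).toDG (fun _ => ()) ε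

/-- The restriction of the maps `F_I` to `τ_{≤ 0} (Lie ⊗ Z)`. -/
def FTrunc {C : PTCat.{u, v, w} k} (B : CosimplicialLie C) (h : (LieEZ k).IsSub (LieEZ k).tau)
    (I : Type) [Fintype I] [LinearOrder I] [Nonempty I] (y : I → (LieEZTrunc k h).Ob)
    (x : (LieEZTrunc k h).Ob) (n : ℤ) :
    (LieEZTrunc k h).P I y x n →ₗ[k] (complexes C).P I (fun _ => MB B) (MB B) n :=
  (F B I y x n).comp ((LieEZ k).tau I y x n).subtype

end HomotopyLie

end

open HomotopyLie

/-! By the Yoneda lemma a natural map `Z([m]) → Z([m])^{⊗n}` is the same thing as the sequence of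
its values at the simplices `id_[m]` (`zhom_single`), that is, a recipe for feeding cosimplicial
operators into an `n`-ary Lie operation. Carrying out the recipe is linear in the chain (`ev`), so
the statements about `F` can be checked on tensors of simplices. Pushing a chain forward along `θ`
becomes composition with `B(θ)`, because `B(θ)` is a morphism of Lie algebras (`ev_push`). The
boundary of `id_[m]` becomes the differential of the target `MB` (`ev_bdry`), the differential of
`Z^{⊗n}` becomes the differentials of the arguments (`ev_zDTens`), and tensor products of maps
become compositions (`ev_zTensor`, `opOf_comp`). An `l`-simplex acts on the term of degree `l`, so
the Koszul signs of the two sides have exponents of the same parity.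

For complexes in `C` the terms sit in pairwise distinct degrees, hence at most one summand of a
composition of homogeneous operations is non-zero. The axioms thus reduce to those of `C` and to
identities between Koszul signs, which are products over pairs of places (`pairProd`). The
differential is split into composition with the differential of the target and with those of the
arguments; in the Leibniz rule (`Cx.dP_comp`) the differentials of the intermediate complexes
cancel.

The axioms of `Lie ⊗ Z` are not checked by hand. An injective functor into a structure satisfying
the axioms reflects them (`DGPTData.IsFunctor.lawful`), and `F` is injective for a universal
cosimplicial Lie algebra, made of the free Lie algebras on countably many copies of the simplices of
`Δ^m` (`F_injective`).

For the quasi-isomorphism, the cone with vertex `0` contracts the chains of a simplex, and tensoring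
contracts `Z([m])^{⊗n}` onto `k` (`exists_homotopy`). The contraction is not natural, but through
Yoneda the equation `D φ = χ` becomes a sequence of equations for the single values `φ(id_[l])`.
These are solved one after another, each obstruction being a cycle of augmentation zero
(`exists_zDiff_eq_of_value_zero`). In degrees `≤ 0` the cocycles of augmentation zero are therefore
coboundaries, and there is a cocycle of degree `0` and augmentation `1`. Flatness of `Lie(n)` over
`k` carries this over to `Lie ⊗ Z`. -/

noncomputable section

namespace HomotopyLie

variable {k : Type u} [Field k]

/-! ### Calculus of compositions with unary operations -/

namespace PTCat

variable (C : PTCat.{u, v, w} k)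

section

variable {I : Type} [Finite I] [Nonempty I] {J : I → Type} [∀ i, Finite (J i)]
  [∀ i, Nonempty (J i)]

/-- Associativity with a one-element outermost index set; in `comp_pre` the middle index sets and in
`pre_comp` the innermost ones have one element. The rest is relabelling: `map_trans` merges the
bijections, and the merged bijections agree pointwise by `rfl`, which is what `map_congr` asks for.
-/
lemma post_comp {z : ∀ i, J i → C.Ob} {y : I → C.Ob} {x x' : C.Ob}
    (h : C.P Unit (fun _ => x) x') (f : C.P I y x) (g : ∀ i, C.P (J i) (z i) (y i)) :
    C.post h (C.comp f g) = C.comp (C.post h f) g := by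
  have h2 := C.comp_map_left (unitSigma I) (J := J) (z := z) (y := y)
    (C.comp (J := fun _ => I) (z := fun _ => y) h (fun _ => f)) g
  have h3 := C.assoc (J := fun _ : Unit => I) (H := fun _ i => J i) (t := fun _ i => z i)
    (z := fun _ => y) h (fun _ => f) (fun _ i => g i)
  refine Eq.trans ?_ h2.symm
  refine (congrArg (C.map (y := fun p : Σ i, J i => z p.1 p.2) (unitSigma (Σ i, J i)))
    h3.symm).trans ?_
  refine (C.map_trans (y := fun p : Σ i, J i => z p.1 p.2)
    (Equiv.sigmaAssoc fun (_ : Unit) i => J i) _ _).symm.trans ?_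
  exact C.map_congr (fun _ => rfl) HEq.rfl

lemma comp_pre {z : ∀ i, J i → C.Ob} {y y' : I → C.Ob} {x : C.Ob}
    (f : C.P I y x) (u : ∀ i, C.P Unit (fun _ => y' i) (y i)) (g : ∀ i, C.P (J i) (z i) (y' i)) :
    C.comp (C.pre f u) g = C.comp f (fun i => C.post (u i) (g i)) := by
  have h1 := C.comp_map_right (J := fun i => Σ _ : Unit, J i) (J' := J)
    (fun i => unitSigma (J i)) (z := z) f
    (fun i => C.comp (J := fun _ => J i) (z := fun _ => z i) (u i) (fun _ => g i))
  have h2 := C.comp_map_left (sigmaUnit I) (J := J) (z := z) (y := y')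
    (C.comp (J := fun _ => Unit) (z := fun i _ => y' i) f u) g
  have h3 := C.assoc (J := fun _ : I => Unit) (H := fun i _ => J i) (t := fun i _ => z i)
    (z := fun i _ => y' i) f u (fun i _ => g i)
  refine h2.trans (Eq.trans ?_ h1.symm)
  refine Eq.trans ?_ (congrArg (C.map (y := fun p : Σ i, J i => z p.1 p.2)
    (Equiv.sigmaCongrRight fun i => unitSigma (J i))) h3)
  refine Eq.trans ?_ (C.map_trans (y := fun p : Σ i, J i => z p.1 p.2)
    (Equiv.sigmaAssoc fun i (_ : Unit) => J i) _ _)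
  exact C.map_congr (fun _ => rfl) HEq.rfl

lemma pre_comp {z z' : ∀ i, J i → C.Ob} {y : I → C.Ob} {x : C.Ob}
    (f : C.P I y x) (g : ∀ i, C.P (J i) (z i) (y i))
    (u : ∀ i j, C.P Unit (fun _ => z' i j) (z i j)) :
    C.pre (z := fun p : Σ i, J i => z' p.1 p.2) (C.comp f g) (fun p => u p.1 p.2) =
      C.comp f (fun i => C.pre (g i) (u i)) := by
  have h1 := C.comp_map_right (J := fun i => Σ _ : J i, Unit) (J' := J)
    (fun i => sigmaUnit (J i)) (z := z') f
    (fun i => C.comp (J := fun _ => Unit) (z := fun j _ => z' i j) (g i) (u i))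
  have h3 := C.assoc (J := J) (H := fun _ _ => Unit) (t := fun i j _ => z' i j)
    (z := z) f g u
  refine Eq.trans ?_ h1.symm
  refine Eq.trans ?_ (congrArg (C.map (y := fun p : Σ i, J i => z' p.1 p.2)
    (Equiv.sigmaCongrRight fun i => sigmaUnit (J i))) h3)
  refine Eq.trans ?_ (C.map_trans (y := fun p : Σ i, J i => z' p.1 p.2)
    (Equiv.sigmaAssoc fun i (_ : J i) => Unit) _ _)
  exact C.map_congr (fun _ => rfl) HEq.rfl

lemma post_map {I' : Type} [Finite I'] [Nonempty I'] (e : I ≃ I') {y : I' → C.Ob} {x x' : C.Ob}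
    (h : C.P Unit (fun _ => x) x') (f : C.P I (fun i => y (e i)) x) :
    C.post h (C.map (y := y) e f) = C.map (y := y) e (C.post h f) := by
  have h1 := C.comp_map_right (J := fun _ : Unit => I) (J' := fun _ => I')
    (fun _ => e) (z := fun _ => y) h (fun _ => f)
  refine (congrArg (C.map (y := y) (unitSigma I')) h1).trans ?_
  refine (C.map_trans (y := y) _ (unitSigma I') _).symm.trans
    (Eq.trans ?_ (C.map_trans (y := y) (unitSigma I) e _))
  exact C.map_congr (fun _ => rfl) HEq.rfl

lemma pre_map {I' : Type} [Finite I'] [Nonempty I'] (e : I ≃ I') {y y' : I' → C.Ob} {x : C.Ob}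
    (f : C.P I (fun i => y (e i)) x) (u : ∀ i, C.P Unit (fun _ => y' i) (y i)) :
    C.pre (C.map (y := y) e f) u = C.map (y := y') e (C.pre f (fun i => u (e i))) := by
  have h2 := C.comp_map_left e (J := fun _ => Unit) (z := fun i _ => y' i) (y := y) f u
  refine (congrArg (C.map (y := y') (sigmaUnit I')) h2).trans ?_
  refine (C.map_trans (y := y') _ (sigmaUnit I') _).symm.trans
    (Eq.trans ?_ (C.map_trans (y := y') (sigmaUnit I) e _))
  exact C.map_congr (fun _ => rfl) HEq.rfl

lemma post_pre {y y' : I → C.Ob} {x x' : C.Ob} (h : C.P Unit (fun _ => x) x')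
    (f : C.P I y x) (u : ∀ i, C.P Unit (fun _ => y' i) (y i)) :
    C.post h (C.pre f u) = C.pre (C.post h f) u := by
  rw [pre, post_map, post_comp, pre]

lemma pre_pre {y y' y'' : I → C.Ob} {x : C.Ob}
    (f : C.P I y x) (u : ∀ i, C.P Unit (fun _ => y' i) (y i))
    (u' : ∀ i, C.P Unit (fun _ => y'' i) (y' i)) :
    C.pre (C.pre f u) u' = C.pre f (fun i => C.post (u i) (u' i)) := by
  conv_lhs => rw [pre, comp_pre]
  rfl

lemma pre_id {y : I → C.Ob} {x : C.Ob} (f : C.P I y x) : C.pre f (fun i => C.id (y i)) = f :=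
  C.comp_id f

lemma pre_unit {x x' x'' : C.Ob} (g : C.P Unit (fun _ => x') x'')
    (h : C.P Unit (fun _ => x) x') : C.pre g (fun _ => h) = C.post g h :=
  C.map_congr (fun _ => rfl) HEq.rfl

/-- `pre` as a family of polylinear maps. -/
def preₗ (y y' : I → C.Ob) (x : C.Ob) :
    C.P I y x →ₗ[k] MultilinearMap k (fun i => C.P Unit (fun _ => y' i) (y i)) (C.P I y' x) where
  toFun f := (C.map (y := y') (sigmaUnit I)).compMultilinearMap
    (C.comp (J := fun _ => Unit) (z := fun i _ => y' i) f)
  map_add' f f' := by ext; simp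
  map_smul' r f := by ext; simp

lemma preₗ_apply {y y' : I → C.Ob} {x : C.Ob} (f : C.P I y x)
    (u : ∀ i, C.P Unit (fun _ => y' i) (y i)) : C.preₗ y y' x f u = C.pre f u := rfl

lemma postₗ_apply {y : I → C.Ob} {x x' : C.Ob} (h : C.P Unit (fun _ => x) x')
    (f : C.P I y x) : C.postₗ y x x' h f = C.post h f := rfl

end

end PTCat

/-! ### Koszul signs as products over pairs of places -/

section signs

variable {M : Type*} [CommMonoid M]

/-- The product over the pairs `i < i'`. -/
def pairProd {I : Type} [Fintype I] [LinearOrder I] (s : I → I → M) : M :=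
  ∏ i, ∏ i' with i < i', s i i'

lemma pairProd_eq_ite {I : Type} [Fintype I] [LinearOrder I] (s : I → I → M) :
    pairProd s = ∏ i, ∏ i', if i < i' then s i i' else 1 := by
  simp only [pairProd, Finset.prod_filter]

lemma pairProd_congr {I : Type} [Fintype I] [LinearOrder I] {s t : I → I → M}
    (h : ∀ i i', i < i' → s i i' = t i i') : pairProd s = pairProd t :=
  Finset.prod_congr rfl fun i _ => Finset.prod_congr rfl fun i' hi' =>
    h i i' (Finset.mem_filter.1 hi').2

lemma pairProd_mul {I : Type} [Fintype I] [LinearOrder I] (s t : I → I → M) :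
    pairProd (fun i i' => s i i' * t i i') = pairProd s * pairProd t := by
  simp only [pairProd, Finset.prod_mul_distrib]

lemma pairProd_eq_one {I : Type} [Fintype I] [LinearOrder I] {s : I → I → M}
    (h : ∀ i i', i < i' → s i i' = 1) : pairProd s = 1 :=
  Finset.prod_eq_one fun i _ => Finset.prod_eq_one fun i' hi' =>
    h i i' (Finset.mem_filter.1 hi').2

/-- Both sides run once over the unordered pairs; the right side lists them by the order of `I`, and
the `if` puts the two arguments of `s` back into the order of `I'`. -/
lemma pairProd_equiv {I I' : Type} [Fintype I] [LinearOrder I] [Fintype I'] [LinearOrder I']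
    (e : I ≃ I') (s : I' → I' → M) :
    pairProd s =
      pairProd (fun i i' => if e i < e i' then s (e i) (e i') else s (e i') (e i)) := by
  have h1 : pairProd s = ∏ i, ∏ i', if e i < e i' then s (e i) (e i') else 1 := by
    rw [pairProd_eq_ite, ← Equiv.prod_comp e]
    exact Finset.prod_congr rfl fun i _ => (Equiv.prod_comp e _).symm
  -- The ordered pairs are split by their order in `I`, the diagonal contributing `1`; the two
  -- variables are then exchanged in the second half.
  have h2 : ∀ i i', (if e i < e i' then s (e i) (e i') else 1) =
      (if i < i' then (if e i < e i' then s (e i) (e i') else 1) else 1) *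
      (if i' < i then (if e i < e i' then s (e i) (e i') else 1) else 1) := by
    intro i i'
    rcases lt_trichotomy i i' with h | h | h
    · simp [h, h.not_gt]
    · simp [h]
    · simp [h, h.not_gt]
  rw [h1, Finset.prod_congr rfl fun i _ => Finset.prod_congr rfl fun i' _ => h2 i i']
  simp only [Finset.prod_mul_distrib]
  rw [Finset.prod_comm (f := fun i i' => if i' < i then _ else _)]
  rw [pairProd_eq_ite]
  simp only [← Finset.prod_mul_distrib]
  refine Finset.prod_congr rfl fun i _ => Finset.prod_congr rfl fun i' _ => ?_
  split_ifs with h h3 h4 h4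
  · exact absurd h4 h3.not_gt
  · simp
  · simp
  · exact absurd (e.injective (le_antisymm (not_lt.1 h4) (not_lt.1 h3))) h.ne
  · simp

/-- The relation is spelled `lexLinearOrder.lt` to fix the lexicographic order, a sigma type also
carrying the sum order, in which different fibres are incomparable. -/
lemma sigma_lex_lt_iff {I : Type} {J : I → Type} [LinearOrder I] [∀ i, LinearOrder (J i)]
    {p q : Σ i, J i} :
    lexLinearOrder.lt p q ↔ p.1 < q.1 ∨ ∃ h : p.1 = q.1, h ▸ p.2 < q.2 :=
  Sigma.lex_iff.trans (by simp)

lemma sigma_mk_lt_iff {I : Type} {J : I → Type} [LinearOrder I] [∀ i, LinearOrder (J i)]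
    {i : I} (j j' : J i) :
    lexLinearOrder.lt (⟨i, j⟩ : Σ i, J i) ⟨i, j'⟩ ↔ j < j' := by
  simp [sigma_lex_lt_iff]

lemma sigma_mk_lt_iff_of_ne {I : Type} {J : I → Type} [LinearOrder I] [∀ i, LinearOrder (J i)]
    {i i' : I} (h : i ≠ i') (j : J i) (j' : J i') :
    lexLinearOrder.lt (⟨i, j⟩ : Σ i, J i) ⟨i', j'⟩ ↔ i < i' := by
  simp [sigma_lex_lt_iff, h]

/-- Lexicographically, two places in different fibres compare by their base points, and two places
in one fibre by the order of that fibre. -/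
lemma pairProd_sigma {I : Type} {J : I → Type} [Fintype I] [LinearOrder I] [∀ i, Fintype (J i)]
    [∀ i, LinearOrder (J i)] (s : (Σ i, J i) → (Σ i, J i) → M) :
    pairProd s = pairProd (fun i i' => ∏ j, ∏ j', s ⟨i, j⟩ ⟨i', j'⟩) *
      ∏ i, pairProd (fun j j' => s ⟨i, j⟩ ⟨i, j'⟩) := by
  simp only [pairProd_eq_ite]
  rw [Fintype.prod_sigma, ← Finset.prod_mul_distrib]
  refine Finset.prod_congr rfl fun i _ => ?_
  simp only [Fintype.prod_sigma]
  have h : ∀ j i', (∏ j', if lexLinearOrder.lt (⟨i, j⟩ : Σ i, J i) ⟨i', j'⟩ then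
      s ⟨i, j⟩ ⟨i', j'⟩ else 1) = (if i < i' then ∏ j', s ⟨i, j⟩ ⟨i', j'⟩ else 1) *
        (if i = i' then ∏ j', if lexLinearOrder.lt (⟨i, j⟩ : Σ i, J i) ⟨i', j'⟩ then
          s ⟨i, j⟩ ⟨i', j'⟩ else 1 else 1) := by
    intro j i'
    by_cases h : i = i'
    · subst h
      simp
    · simp only [sigma_mk_lt_iff_of_ne h, h, if_false, mul_one]
      split_ifs <;> simp
  refine (Finset.prod_congr rfl fun j _ => Finset.prod_congr rfl fun i' _ => h j i').trans ?_
  simp only [Finset.prod_mul_distrib, Finset.prod_ite_eq, Finset.mem_univ, if_true,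
    sigma_mk_lt_iff]
  congr 1
  rw [Finset.prod_comm]
  refine Finset.prod_congr rfl fun i' _ => ?_
  split_ifs <;> simp

lemma negOnePow_sum {ι : Type*} (s : Finset ι) (f : ι → ℤ) :
    Int.negOnePow (∑ i ∈ s, f i) = ∏ i ∈ s, Int.negOnePow (f i) := by
  classical
  induction s using Finset.induction_on with
  | empty => simp
  | insert a s ha ih => rw [Finset.sum_insert ha, Finset.prod_insert ha, Int.negOnePow_add, ih]

lemma negOnePow_congr {a b : ℤ} (h : Even (a - b)) : Int.negOnePow a = Int.negOnePow b :=
  (Int.negOnePow_eq_iff a b).2 h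

lemma shuffleSign_eq {I : Type} [Fintype I] [LinearOrder I] (m A : I → ℤ) :
    shuffleSign m A = pairProd (fun i i' => Int.negOnePow (A i * m i')) := rfl

lemma permSign_eq {I I' : Type} [Fintype I] [LinearOrder I] [LinearOrder I'] (e : I ≃ I')
    (a : I → ℤ) : permSign e a =
      pairProd (fun i i' => if e i' < e i then Int.negOnePow (a i * a i') else 1) := by
  simp only [permSign, pairProd, Finset.prod_filter, ite_and]

lemma permSign_of_monotone {I I' : Type} [Fintype I] [LinearOrder I] [LinearOrder I']
    (e : I ≃ I') (h : ∀ i i', i < i' → e i < e i') (a : I → ℤ) :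
    permSign e a = 1 := by
  rw [permSign_eq]
  exact pairProd_eq_one fun i i' hi => if_neg (h i i' hi).not_gt

/-- Meant for families of degrees with at most one non-zero member, such as that of `(1, …, d, …,
1)`. -/
lemma permSign_of_mul_even {I I' : Type} [Fintype I] [LinearOrder I] [LinearOrder I']
    (e : I ≃ I') (a : I → ℤ) (h : ∀ i i', i ≠ i' → a i * a i' = 0) :
    permSign e a = 1 := by
  rw [permSign_eq]
  refine pairProd_eq_one fun i i' hi => ?_
  rw [h i i' hi.ne]
  simp

variable {I I' I'' : Type} [Fintype I] [LinearOrder I] [Fintype I'] [LinearOrder I']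
  [LinearOrder I'']

lemma shuffleSign_add_left (m m' A : I → ℤ) :
    shuffleSign (fun i => m i + m' i) A = shuffleSign m A * shuffleSign m' A := by
  simp only [shuffleSign_eq, ← pairProd_mul, mul_add, Int.negOnePow_add]

lemma shuffleSign_add_right (m A A' : I → ℤ) :
    shuffleSign m (fun i => A i + A' i) = shuffleSign m A * shuffleSign m A' := by
  simp only [shuffleSign_eq, ← pairProd_mul, add_mul, Int.negOnePow_add]

lemma shuffleSign_sigma {J : I → Type} [∀ i, Fintype (J i)] [∀ i, LinearOrder (J i)]
    (m A : (Σ i, J i) → ℤ) :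
    shuffleSign m A = shuffleSign (fun i => ∑ j, m ⟨i, j⟩) (fun i => ∑ j, A ⟨i, j⟩) *
      ∏ i, shuffleSign (fun j => m ⟨i, j⟩) (fun j => A ⟨i, j⟩) := by
  simp only [shuffleSign_eq]
  rw [pairProd_sigma]
  simp only [Finset.sum_mul_sum, negOnePow_sum]

lemma shuffleSign_subsingleton [Subsingleton I] (m A : I → ℤ) : shuffleSign m A = 1 :=
  pairProd_eq_one fun i i' h => absurd (Subsingleton.elim i i') h.ne

lemma shuffleSign_zero_left (A : I → ℤ) : shuffleSign (fun _ => 0) A = 1 := by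
  simp [shuffleSign]

/-- The composite inverts a pair exactly when one of the two bijections does; if both do, the sign
of the pair occurs twice and drops out. -/
lemma permSign_trans (e : I ≃ I') (e' : I' ≃ I'') (a : I' → ℤ) :
    permSign (e.trans e') (fun i => a (e i)) = permSign e (fun i => a (e i)) * permSign e' a := by
  simp only [permSign_eq]
  rw [pairProd_equiv e (fun i i' => if e' i' < e' i then Int.negOnePow (a i * a i') else 1),
    ← pairProd_mul]
  refine pairProd_congr fun i i' hi => ?_
  have h1 : e i ≠ e i' := fun h => hi.ne (e.injective h)
  have h2 : e' (e i) ≠ e' (e i') := fun h => h1 (e'.injective h)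
  simp only [Equiv.trans_apply]
  rcases lt_or_gt_of_ne h1 with h3 | h3 <;> rcases lt_or_gt_of_ne h2 with h4 | h4 <;>
    simp [h3, h4, h3.not_gt, h4.not_gt, mul_comm (a (e i'))]

/-- The compatibility of `shuffleSign` with the Koszul signs of a permutation. -/
lemma shuffleSign_mul_permSign (e : I ≃ I') (m A : I' → ℤ) :
    shuffleSign m A * permSign e (fun i => A (e i) + m (e i)) =
      permSign e (fun i => m (e i)) * permSign e (fun i => A (e i)) *
        shuffleSign (fun i => m (e i)) (fun i => A (e i)) := by
  simp only [permSign_eq, shuffleSign_eq]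
  rw [pairProd_equiv e (fun i i' => Int.negOnePow (A i * m i')), ← pairProd_mul,
    ← pairProd_mul, ← pairProd_mul]
  refine pairProd_congr fun i i' hi => ?_
  have h1 : e i ≠ e i' := fun h => hi.ne (e.injective h)
  rcases lt_or_gt_of_ne h1 with h3 | h3
  · simp [h3, h3.not_gt]
  -- For an inverted pair the cross term `A (e i') * m (e i)` occurs twice on the left: in the
  -- shuffle sign, and in the expanded product of the total degrees.
  · simp only [h3, h3.not_gt, if_true, if_false, ← Int.negOnePow_add]
    refine negOnePow_congr ⟨A (e i') * m (e i), by ring⟩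

/-- Blocks move as wholes: pairs inside a block keep their order, and the pairs from two
interchanged blocks together contribute the product of the total degrees. -/
lemma permSign_sigmaCongrLeft {J : I' → Type} [∀ i, Fintype (J i)] [∀ i, LinearOrder (J i)]
    (e : I ≃ I') (a : (Σ i, J (e i)) → ℤ) :
    permSign (Equiv.sigmaCongrLeft e : (Σ i, J (e i)) ≃ Σ i, J i) a =
      permSign e (fun i => ∑ j, a ⟨i, j⟩) := by
  have h1 : ∀ i (j j' : J (e i)), j < j' → (if lexLinearOrder.lt (⟨e i, j'⟩ : Σ i, J i) ⟨e i, j⟩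
      then Int.negOnePow (a ⟨i, j⟩ * a ⟨i, j'⟩) else 1) = 1 := by
    intro i j j' h
    exact if_neg fun h' => h.not_gt ((sigma_mk_lt_iff _ _).1 h')
  have h2 : ∀ i i', i < i' → (∏ j, ∏ j', if lexLinearOrder.lt (⟨e i', j'⟩ : Σ i, J i) ⟨e i, j⟩
      then Int.negOnePow (a ⟨i, j⟩ * a ⟨i', j'⟩) else 1) = if e i' < e i then
        Int.negOnePow ((∑ j, a ⟨i, j⟩) * ∑ j, a ⟨i', j⟩) else 1 := by
    intro i i' h
    simp only [sigma_mk_lt_iff_of_ne (fun h' => h.ne (e.injective h'.symm))]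
    rw [Finset.sum_mul_sum, negOnePow_sum]
    split_ifs <;> simp [negOnePow_sum]
  rw [permSign_eq, permSign_eq, pairProd_sigma]
  refine (congrArg₂ _ (pairProd_congr h2)
    (Finset.prod_eq_one fun i _ => pairProd_eq_one (h1 i))).trans (mul_one _)

/-- Permutations inside the blocks never invert a pair from different blocks. -/
lemma permSign_sigmaCongrRight {J J' : I → Type} [∀ i, Fintype (J i)] [∀ i, LinearOrder (J i)]
    [∀ i, LinearOrder (J' i)] (e : ∀ i, J i ≃ J' i) (a : (Σ i, J i) → ℤ) :
    permSign (Equiv.sigmaCongrRight e) a = ∏ i, permSign (e i) (fun j => a ⟨i, j⟩) := by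
  have h1 : ∀ i (j j' : J i), (if lexLinearOrder.lt (⟨i, e i j'⟩ : Σ i, J' i) ⟨i, e i j⟩
      then Int.negOnePow (a ⟨i, j⟩ * a ⟨i, j'⟩) else 1) = if e i j' < e i j then
        Int.negOnePow (a ⟨i, j⟩ * a ⟨i, j'⟩) else 1 := by
    intro i j j'
    simp only [sigma_mk_lt_iff]
  have h2 : ∀ i i', i < i' → (∏ j, ∏ j', if lexLinearOrder.lt (⟨i', e i' j'⟩ : Σ i, J' i) ⟨i, e i j⟩
      then Int.negOnePow (a ⟨i, j⟩ * a ⟨i', j'⟩) else 1) = 1 := by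
    intro i i' h
    simp only [sigma_mk_lt_iff_of_ne h.ne', h.not_gt, if_false, Finset.prod_const_one]
  simp only [permSign_eq]
  rw [pairProd_sigma]
  exact (congrArg₂ _ (pairProd_eq_one h2) (Finset.prod_congr rfl fun i _ =>
    pairProd_congr fun j j' _ => h1 i j j')).trans (one_mul _)

end signs

section monotone

variable {I : Type} [Fintype I] [LinearOrder I]

lemma permSign_unitSigma (a : (Σ _ : Unit, I) → ℤ) : permSign (unitSigma I) a = 1 :=
  permSign_of_monotone _ (fun ⟨_, _⟩ ⟨_, _⟩ h => (sigma_mk_lt_iff _ _).1 h) a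

lemma permSign_sigmaUnit (a : (Σ _ : I, Unit) → ℤ) : permSign (sigmaUnit I) a = 1 := by
  refine permSign_of_monotone _ (fun ⟨i, _⟩ ⟨i', _⟩ h => ?_) a
  by_cases hi : i = i'
  · subst hi
    exact absurd ((sigma_mk_lt_iff _ _).1 h) (lt_irrefl _)
  · exact (sigma_mk_lt_iff_of_ne hi _ _).1 h

/-- Reassociation preserves the lexicographic order, so it inverts no pair. -/
lemma permSign_sigmaAssoc {J : I → Type} [∀ i, Fintype (J i)] [∀ i, LinearOrder (J i)]
    {H : ∀ i, J i → Type} [∀ i j, Fintype (H i j)] [∀ i j, LinearOrder (H i j)]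
    (a : (Σ p : Σ i, J i, H p.1 p.2) → ℤ) : permSign (Equiv.sigmaAssoc H) a = 1 := by
  refine permSign_of_monotone _ ?_ a
  rintro ⟨⟨i, j⟩, l⟩ ⟨⟨i', j'⟩, l'⟩ h
  change lexLinearOrder.lt (⟨i, j, l⟩ : Σ i, Σ j, H i j) ⟨i', j', l'⟩
  by_cases hi : i = i'
  · subst hi
    rw [sigma_mk_lt_iff]
    change lexLinearOrder.lt (⟨j, l⟩ : Σ j, H i j) ⟨j', l'⟩
    by_cases hj : j = j'
    · subst hj
      exact (sigma_mk_lt_iff _ _).2 ((sigma_mk_lt_iff (I := Σ i, J i) _ _).1 h)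
    · refine (sigma_mk_lt_iff_of_ne hj _ _).2 ((sigma_mk_lt_iff _ _).1
        ((sigma_mk_lt_iff_of_ne (I := Σ i, J i) ?_ _ _).1 h))
      simpa using hj
  · refine (sigma_mk_lt_iff_of_ne hi _ _).2 ((sigma_mk_lt_iff_of_ne hi _ _).1
      ((sigma_mk_lt_iff_of_ne (I := Σ i, J i) (fun h' => hi (congrArg Sigma.fst h')) _ _).1 h))

end monotone

section signSmul

variable {M N : Type*} [AddCommGroup M] [Module k M] [AddCommGroup N] [Module k N]

lemma map_sign_smul (L : M →ₗ[k] N) (s : ℤˣ) (x : M) : L (s • x) = s • L x := by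
  rw [Units.smul_def, Units.smul_def, map_zsmul]

variable (k) in
-- Signs become scalars of `k`, so that they can be part of `k`-linear maps.
lemma sign_smul_eq (s : ℤˣ) (x : M) : s • x = ((s : ℤ) : k) • x := by
  rw [Units.smul_def, Int.cast_smul_eq_zsmul]

lemma multilinear_sign_smul {ι : Type*} [Fintype ι] {E : ι → Type*} [∀ i, AddCommGroup (E i)]
    [∀ i, Module k (E i)] (L : MultilinearMap k E M) (s : ι → ℤˣ) (x : ∀ i, E i) :
    L (fun i => s i • x i) = (∏ i, s i) • L x := by
  simp only [sign_smul_eq k]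
  rw [L.map_smul_univ]
  simp

end signSmul

namespace PTCat

variable (C : PTCat.{u, v, w} k)

lemma post_sign {I : Type} [Finite I] [Nonempty I] {y : I → C.Ob} {x x' : C.Ob}
    (h : C.P Unit (fun _ => x) x') (s : ℤˣ) (f : C.P I y x) :
    C.post h (s • f) = s • C.post h f :=
  map_sign_smul (C.postₗ y x x' h) s f

lemma post_zero {I : Type} [Finite I] [Nonempty I] {y : I → C.Ob} {x x' : C.Ob}
    (h : C.P Unit (fun _ => x) x') : C.post h (0 : C.P I y x) = 0 :=
  map_zero (C.postₗ y x x' h)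

lemma zero_post {I : Type} [Finite I] [Nonempty I] {y : I → C.Ob} {x x' : C.Ob}
    (f : C.P I y x) : C.post (0 : C.P Unit (fun _ => x) x') f = 0 :=
  LinearMap.map_zero₂ (C.postₗ y x x') f

lemma pre_sign {I : Type} [Finite I] [Nonempty I] {y y' : I → C.Ob} {x : C.Ob}
    (s : ℤˣ) (f : C.P I y x) (u : ∀ i, C.P Unit (fun _ => y' i) (y i)) :
    C.pre (s • f) u = s • C.pre f u := by
  exact congrArg (fun L => L u) (map_sign_smul (C.preₗ y y' x) s f)

lemma zero_pre {I : Type} [Finite I] [Nonempty I] {y y' : I → C.Ob} {x : C.Ob}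
    (u : ∀ i, C.P Unit (fun _ => y' i) (y i)) : C.pre (0 : C.P I y x) u = 0 := by
  rw [← preₗ_apply, map_zero, zero_apply]

lemma pre_zero {I : Type} [Finite I] [Nonempty I] {y y' : I → C.Ob} {x : C.Ob}
    (f : C.P I y x) (u : ∀ i, C.P Unit (fun _ => y' i) (y i)) (i : I) (hi : u i = 0) :
    C.pre f u = 0 := by
  rw [← preₗ_apply, MultilinearMap.map_coord_zero _ i hi]

end PTCat

/-! ### Graded families of operations between complexes -/

namespace Cx

variable {C : PTCat.{u, v, w} k}

/-- Families of operations, of arbitrary degrees, between the terms of complexes. -/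
abbrev Fam (I : Type) [Finite I] [Nonempty I] (y : I → Cx C) (x : Cx C) : Type w :=
  ∀ (a : ∀ i, (y i).ι) (b : x.ι), C.P I (fun i => (y i).X (a i)) (x.X b)

section

variable {I : Type} [Fintype I] [Nonempty I]

lemma Op_unit_eq_zero {x x' : Cx C} {s : ℤ} {u : Fam Unit (fun _ => x) x'}
    (hu : u ∈ Op Unit (fun _ => x) x' s) {a : Unit → x.ι} {b : x'.ι}
    (h : x'.deg b ≠ x.deg (a ()) + s) : u a b = 0 :=
  hu a b (by simpa using h)

/-- The composition of a family and a unary family. -/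
def pval {y : I → Cx C} {x x' : Cx C} (h : Fam Unit (fun _ => x) x') (f : Fam I y x) :
    Fam I y x' :=
  fun a b => ∑ᶠ c, C.post (h (fun _ => c) b) (f a c)

/-- A complex has at most one term in each degree, so a homogeneous `f` can reach only `c`. If the
complex has no term in the required degree, `pval_zero` applies instead; `qval` and `cval` have
analogous pairs of lemmas, and the identities below are proved by this case distinction. -/
lemma pval_of {y : I → Cx C} {x x' : Cx C} {h : Fam Unit (fun _ => x) x'} {f : Fam I y x} {n : ℤ}
    (hf : f ∈ Op I y x n) {a : ∀ i, (y i).ι} (b : x'.ι) (c : x.ι)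
    (hc : x.deg c = ∑ i, (y i).deg (a i) + n) :
    pval h f a b = C.post (h (fun _ => c) b) (f a c) := by
  refine finsum_eq_single _ c fun c' hc' => ?_
  rw [hf a c' (fun h' => hc' (x.deg_injective (h'.trans hc.symm))), C.post_zero]

lemma pval_zero {y : I → Cx C} {x x' : Cx C} {h : Fam Unit (fun _ => x) x'} {f : Fam I y x}
    {a : ∀ i, (y i).ι} (b : x'.ι) (hc : ∀ c, f a c = 0) :
    pval h f a b = 0 :=
  finsum_eq_zero_of_forall_eq_zero fun c => by rw [hc c, C.post_zero]

variable [LinearOrder I]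

/-- The composition of a family and unary families of degrees `s i`. -/
def qval {y y' : I → Cx C} {x : Cx C} (s : I → ℤ) (f : Fam I y x)
    (v : ∀ i, Fam Unit (fun _ => y' i) (y i)) : Fam I y' x :=
  fun a b => shuffleSign s (fun i => (y' i).deg (a i)) •
    ∑ᶠ c : ∀ i, (y i).ι, C.pre (f c b) (fun i => v i (fun _ => a i) (c i))

lemma qval_of {y y' : I → Cx C} {x : Cx C} {s : I → ℤ} {f : Fam I y x}
    {v : ∀ i, Fam Unit (fun _ => y' i) (y i)} (hv : ∀ i, v i ∈ Op Unit (fun _ => y' i) (y i) (s i))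
    {a : ∀ i, (y' i).ι} (b : x.ι) (c : ∀ i, (y i).ι)
    (hc : ∀ i, (y i).deg (c i) = (y' i).deg (a i) + s i) :
    qval s f v a b = shuffleSign s (fun i => (y' i).deg (a i)) •
      C.pre (f c b) (fun i => v i (fun _ => a i) (c i)) := by
  refine congrArg _ (finsum_eq_single _ c fun c' hc' => ?_)
  obtain ⟨i, hi⟩ := Function.ne_iff.1 hc'
  exact C.pre_zero _ _ i (Op_unit_eq_zero (hv i)
    fun h' => hi ((y i).deg_injective (h'.trans (hc i).symm)))

lemma qval_zero {y y' : I → Cx C} {x : Cx C} {s : I → ℤ} {f : Fam I y x}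
    {v : ∀ i, Fam Unit (fun _ => y' i) (y i)} (hv : ∀ i, v i ∈ Op Unit (fun _ => y' i) (y i) (s i))
    {a : ∀ i, (y' i).ι} (b : x.ι) (i : I) (hi : ∀ c, (y i).deg c ≠ (y' i).deg (a i) + s i) :
    qval s f v a b = 0 := by
  refine (congrArg _ (finsum_eq_zero_of_forall_eq_zero fun c => ?_)).trans (smul_zero _)
  exact C.pre_zero _ _ i (Op_unit_eq_zero (hv i) (hi _))

/-- Transport of a family along a bijection, with the Koszul sign. -/
def mval {I' : Type} [Fintype I'] [LinearOrder I'] [Nonempty I'] (e : I ≃ I') {y : I' → Cx C}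
    {x : Cx C} (f : Fam I (fun i => y (e i)) x) : Fam I' y x :=
  fun a b => permSign e (fun i => (y (e i)).deg (a (e i))) •
    C.map (y := fun i => (y i).X (a i)) e (f (fun i => a (e i)) b)

variable {J : I → Type} [∀ i, Fintype (J i)] [∀ i, Nonempty (J i)] [∀ i, LinearOrder (J i)]
  {z z' : ∀ i, J i → Cx C} {y : I → Cx C} {x : Cx C}

/-- The composition of families, with the sign for `g i` of degree `m i`. -/
def cval (m : I → ℤ) (f : Fam I y x) (g : ∀ i, Fam (J i) (z i) (y i)) :
    Fam (Σ i, J i) (fun p => z p.1 p.2) x :=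
  fun a b => shuffleSign m (fun i => ∑ j, (z i j).deg (a ⟨i, j⟩)) • ∑ᶠ c, compTerm a b c f g

variable {m : I → ℤ} {f : Fam I y x} {g : ∀ i, Fam (J i) (z i) (y i)}

lemma cval_mem {n N : ℤ} (hf : f ∈ Op I y x n) (hg : ∀ i, g i ∈ Op (J i) (z i) (y i) (m i))
    (h : n + ∑ i, m i = N) : cval m f g ∈ Op (Σ i, J i) (fun p => z p.1 p.2) x N :=
  (compFun n m N h ⟨f, hf⟩ (fun i => ⟨g i, hg i⟩)).2

lemma cval_of (hg : ∀ i, g i ∈ Op (J i) (z i) (y i) (m i)) {a : ∀ p : Σ i, J i, (z p.1 p.2).ι}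
    (b : x.ι) (c : ∀ i, (y i).ι)
    (hc : ∀ i, (y i).deg (c i) = ∑ j, (z i j).deg (a ⟨i, j⟩) + m i) :
    cval m f g a b = shuffleSign m (fun i => ∑ j, (z i j).deg (a ⟨i, j⟩)) •
      C.comp (J := J) (z := fun i j => (z i j).X (a ⟨i, j⟩)) (f c b)
        (fun i => g i (fun j => a ⟨i, j⟩) (c i)) := by
  refine congrArg _ (finsum_eq_single _ c fun c' hc' => ?_)
  obtain ⟨i, hi⟩ := Function.ne_iff.1 hc'
  exact (C.comp (f c' b)).map_coord_zero i (hg i _ _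
    fun h' => hi ((y i).deg_injective (h'.trans (hc i).symm)))

lemma cval_zero (hg : ∀ i, g i ∈ Op (J i) (z i) (y i) (m i)) {a : ∀ p : Σ i, J i, (z p.1 p.2).ι}
    (b : x.ι) (i : I) (hi : ∀ c, (y i).deg c ≠ ∑ j, (z i j).deg (a ⟨i, j⟩) + m i) :
    cval m f g a b = 0 := by
  refine (congrArg _ (finsum_eq_zero_of_forall_eq_zero fun c => ?_)).trans (smul_zero _)
  exact (C.comp (f c b)).map_coord_zero i (hg i _ _ (hi _))

lemma cval_zero_right {a : ∀ p : Σ i, J i, (z p.1 p.2).ι} (b : x.ι) (i : I)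
    (hi : ∀ c, g i (fun j => a ⟨i, j⟩) c = 0) : cval m f g a b = 0 := by
  refine (congrArg _ (finsum_eq_zero_of_forall_eq_zero fun c => ?_)).trans (smul_zero _)
  exact (C.comp (f c b)).map_coord_zero i (hi _)

/-- No sign arises: `h` stands to the left of everything and passes nothing. -/
lemma pval_cval {x' : Cx C} {n : ℤ} (h : Fam Unit (fun _ => x) x') (hf : f ∈ Op I y x n)
    (hg : ∀ i, g i ∈ Op (J i) (z i) (y i) (m i)) :
    pval h (cval m f g) = cval m (pval h f) g := by
  funext a b
  by_cases hc : ∀ i, ∃ c, (y i).deg c = ∑ j, (z i j).deg (a ⟨i, j⟩) + m i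
  · choose c hc using hc
    have hsum : ∑ i, (y i).deg (c i) = ∑ p : Σ i, J i, (z p.1 p.2).deg (a p) + ∑ i, m i := by
      rw [Finset.sum_congr rfl fun i _ => hc i, Finset.sum_add_distrib, Fintype.sum_sigma]
    rw [cval_of hg b c hc]
    by_cases he : ∃ e, x.deg e = ∑ i, (y i).deg (c i) + n
    · obtain ⟨e, he⟩ := he
      rw [pval_of hf b e he, pval_of (cval_mem hf hg rfl) b e (by rw [he, hsum]; ring),
        cval_of hg e c hc, C.post_sign, C.post_comp]
    · push Not at he
      have hf0 : ∀ e, f c e = 0 := fun e => hf c e (he e)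
      rw [pval_zero b hf0, pval_zero b, map_zero, zero_apply, smul_zero]
      intro e
      rw [cval_of hg e c hc, hf0, map_zero, zero_apply, smul_zero]
  · push Not at hc
    obtain ⟨i, hi⟩ := hc
    rw [cval_zero hg b i hi, pval_zero b fun e => cval_zero hg e i hi]

lemma pval_mem {x' : Cx C} {n s N : ℤ} {h : Fam Unit (fun _ => x) x'}
    (hh : h ∈ Op Unit (fun _ => x) x' s) (hf : f ∈ Op I y x n) (hN : n + s = N) :
    pval h f ∈ Op I y x' N := by
  intro a b hb
  by_cases he : ∃ e, x.deg e = ∑ i, (y i).deg (a i) + n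
  · obtain ⟨e, he⟩ := he
    rw [pval_of hf b e he, Op_unit_eq_zero hh, C.zero_post]
    omega
  · push Not at he
    exact pval_zero b fun e => hf a e (he e)

lemma qval_mem {y' : I → Cx C} {n N : ℤ} {s : I → ℤ} (hf : f ∈ Op I y x n)
    {v : ∀ i, Fam Unit (fun _ => y' i) (y i)} (hv : ∀ i, v i ∈ Op Unit (fun _ => y' i) (y i) (s i))
    (hN : n + ∑ i, s i = N) : qval s f v ∈ Op I y' x N := by
  intro a b hb
  by_cases hc : ∀ i, ∃ c, (y i).deg c = (y' i).deg (a i) + s i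
  · choose c hc using hc
    rw [qval_of hv b c hc, hf, C.zero_pre, smul_zero]
    rw [Finset.sum_congr rfl fun i _ => hc i, Finset.sum_add_distrib]
    omega
  · push Not at hc
    obtain ⟨i, hi⟩ := hc
    exact qval_zero hv b i hi

lemma pval_pval {x' x'' : Cx C} {n s : ℤ} {h' : Fam Unit (fun _ => x') x''}
    {h : Fam Unit (fun _ => x) x'} (hh : h ∈ Op Unit (fun _ => x) x' s) (hf : f ∈ Op I y x n) :
    pval h' (pval h f) = pval (pval h' h) f := by
  funext a b
  by_cases he : ∃ e, x.deg e = ∑ i, (y i).deg (a i) + n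
  · obtain ⟨e, he⟩ := he
    rw [pval_of hf b e he]
    by_cases hc : ∃ c, x'.deg c = x.deg e + s
    · obtain ⟨c, hc⟩ := hc
      rw [pval_of (n := n + s) (pval_mem hh hf rfl) b c (by rw [hc, he]; ring),
        pval_of hf c e he, pval_of (a := fun _ => e) hh b c (by simpa using hc), C.post_post]
    · push Not at hc
      rw [pval_zero (f := h) b fun c => Op_unit_eq_zero hh (hc c), C.zero_post, pval_zero]
      intro c
      rw [pval_of hf c e he, Op_unit_eq_zero hh (hc c), C.zero_post]
  · push Not at he
    have h0 : ∀ c, f a c = 0 := fun e => hf a e (he e)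
    rw [pval_zero (f := f) b h0, pval_zero]
    intro c
    rw [pval_zero c h0]

lemma pval_qval {x' : Cx C} {y' : I → Cx C} {n : ℤ} {s : I → ℤ} (h : Fam Unit (fun _ => x) x')
    (hf : f ∈ Op I y x n)
    {v : ∀ i, Fam Unit (fun _ => y' i) (y i)} (hv : ∀ i, v i ∈ Op Unit (fun _ => y' i) (y i) (s i)) :
    pval h (qval s f v) = qval s (pval h f) v := by
  funext a b
  by_cases hc : ∀ i, ∃ c, (y i).deg c = (y' i).deg (a i) + s i
  · choose c hc using hc
    have hsum : ∑ i, (y i).deg (c i) = ∑ i, (y' i).deg (a i) + ∑ i, s i := by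
      rw [Finset.sum_congr rfl fun i _ => hc i, Finset.sum_add_distrib]
    rw [qval_of hv b c hc]
    by_cases he : ∃ e, x.deg e = ∑ i, (y i).deg (c i) + n
    · obtain ⟨e, he⟩ := he
      rw [pval_of hf b e he, pval_of (qval_mem hf hv rfl) b e (by rw [he, hsum]; ring),
        qval_of hv e c hc, C.post_sign, C.post_pre]
    · push Not at he
      have hf0 : ∀ e, f c e = 0 := fun e => hf c e (he e)
      rw [pval_zero b hf0, pval_zero b, C.zero_pre, smul_zero]
      intro e
      rw [qval_of hv e c hc, hf0, C.zero_pre, smul_zero]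
  · push Not at hc
    obtain ⟨i, hi⟩ := hc
    rw [qval_zero hv b i hi, pval_zero b fun e => qval_zero hv e i hi]

/-- The sign belongs to the rearrangement `(v₁, …, vₙ, g₁, …, gₙ) ↦ (v₁, g₁, …, vₙ, gₙ)`. -/
lemma cval_qval {y' : I → Cx C} {s : I → ℤ} {g : ∀ i, Fam (J i) (z i) (y' i)}
    {v : ∀ i, Fam Unit (fun _ => y' i) (y i)} (hv : ∀ i, v i ∈ Op Unit (fun _ => y' i) (y i) (s i))
    (hg : ∀ i, g i ∈ Op (J i) (z i) (y' i) (m i)) :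
    cval m (qval s f v) g =
      shuffleSign s m • cval (fun i => m i + s i) f (fun i => pval (v i) (g i)) := by
  have hvg : ∀ i, pval (v i) (g i) ∈ Op (J i) (z i) (y i) (m i + s i) :=
    fun i => pval_mem (hv i) (hg i) rfl
  funext a b
  rw [Pi.smul_apply, Pi.smul_apply]
  by_cases hc : ∀ i, ∃ c, (y' i).deg c = ∑ j, (z i j).deg (a ⟨i, j⟩) + m i
  · choose c hc using hc
    rw [cval_of hg b c hc]
    by_cases he : ∀ i, ∃ e, (y i).deg e = (y' i).deg (c i) + s i
    · choose e he using he
      rw [qval_of hv b e he, cval_of hvg b e (fun i => by rw [he, hc]; ring), map_sign_smul,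
        smul_apply, C.comp_pre, smul_smul, smul_smul]
      congr 1
      · simp only [hc, shuffleSign_add_left, shuffleSign_add_right]
        ac_rfl
      · congr 1
        funext i
        rw [pval_of (hg i) (e i) (c i) (hc i)]
    · push Not at he
      obtain ⟨i, hi⟩ := he
      rw [qval_zero hv b i hi, map_zero, zero_apply, smul_zero,
        cval_zero hvg b i, smul_zero]
      intro e he
      exact hi e (by rw [he, hc]; ring)
  · push Not at hc
    obtain ⟨i, hi⟩ := hc
    rw [cval_zero hg b i hi, cval_zero_right b i, smul_zero]
    exact fun e => pval_zero e fun c => hg i _ _ (hi c)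

lemma qval_qval {y' y'' : I → Cx C} {s r : I → ℤ}
    {v : ∀ i, Fam Unit (fun _ => y' i) (y i)} (hv : ∀ i, v i ∈ Op Unit (fun _ => y' i) (y i) (s i))
    {v' : ∀ i, Fam Unit (fun _ => y'' i) (y' i)}
    (hv' : ∀ i, v' i ∈ Op Unit (fun _ => y'' i) (y' i) (r i)) :
    qval r (qval s f v) v' =
      shuffleSign s r • qval (fun i => r i + s i) f (fun i => pval (v i) (v' i)) := by
  have hvg : ∀ i, pval (v i) (v' i) ∈ Op Unit (fun _ => y'' i) (y i) (r i + s i) :=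
    fun i => pval_mem (hv i) (hv' i) rfl
  funext a b
  rw [Pi.smul_apply, Pi.smul_apply]
  by_cases hc : ∀ i, ∃ c, (y' i).deg c = (y'' i).deg (a i) + r i
  · choose c hc using hc
    rw [qval_of hv' b c hc]
    by_cases he : ∀ i, ∃ e, (y i).deg e = (y' i).deg (c i) + s i
    · choose e he using he
      rw [qval_of hv b e he, qval_of hvg b e (fun i => by rw [he, hc]; ring), C.pre_sign,
        C.pre_pre, smul_smul, smul_smul]
      congr 1
      · simp only [hc, shuffleSign_add_left, shuffleSign_add_right]
        ac_rfl
      · congr 1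
        funext i
        rw [pval_of (hv' i) (e i) (c i) (by simpa using hc i)]
    · push Not at he
      obtain ⟨i, hi⟩ := he
      rw [qval_zero hv b i hi, C.zero_pre, smul_zero, qval_zero hvg b i, smul_zero]
      intro e he
      exact hi e (by rw [he, hc]; ring)
  · push Not at hc
    obtain ⟨i, hi⟩ := hc
    rw [qval_zero hv' b i hi, qval, finsum_eq_zero_of_forall_eq_zero, smul_zero, smul_zero]
    intro e
    refine C.pre_zero _ _ i (pval_zero _ fun c => Op_unit_eq_zero (hv' i) (hi c))

lemma qval_cval {r : ∀ i, J i → ℤ} (hg : ∀ i, g i ∈ Op (J i) (z i) (y i) (m i))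
    {v : ∀ i j, Fam Unit (fun _ => z' i j) (z i j)}
    (hv : ∀ i j, v i j ∈ Op Unit (fun _ => z' i j) (z i j) (r i j)) :
    qval (y' := fun p : Σ i, J i => z' p.1 p.2) (fun p => r p.1 p.2) (cval m f g)
        (fun p => v p.1 p.2) =
      shuffleSign m (fun i => ∑ j, r i j) •
        cval (fun i => m i + ∑ j, r i j) f (fun i => qval (r i) (g i) (v i)) := by
  have hvg : ∀ i, qval (r i) (g i) (v i) ∈ Op (J i) (z' i) (y i) (m i + ∑ j, r i j) :=
    fun i => qval_mem (hg i) (hv i) rfl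
  funext a b
  rw [Pi.smul_apply, Pi.smul_apply]
  by_cases hc : ∀ i j, ∃ c, (z i j).deg c = (z' i j).deg (a ⟨i, j⟩) + r i j
  · choose c hc using hc
    have hsum : ∀ i, ∑ j, (z i j).deg (c i j) = ∑ j, (z' i j).deg (a ⟨i, j⟩) + ∑ j, r i j :=
      fun i => by rw [Finset.sum_congr rfl fun j _ => hc i j, Finset.sum_add_distrib]
    rw [qval_of (fun p : Σ i, J i => hv p.1 p.2) b (fun p => c p.1 p.2) (fun p => hc p.1 p.2)]
    by_cases he : ∀ i, ∃ e, (y i).deg e = ∑ j, (z i j).deg (c i j) + m i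
    · choose e he using he
      rw [cval_of hg b e he, cval_of hvg b e (fun i => by rw [he, hsum]; ring), C.pre_sign]
      refine (congrArg (fun t => shuffleSign _ _ • shuffleSign _ _ • t) (C.pre_comp (f e b)
        (fun i => g i (c i) (e i)) (fun i j => v i j (fun _ => a ⟨i, j⟩) (c i j)))).trans ?_
      rw [smul_smul, smul_smul]
      have h1 : ∀ i, qval (r i) (g i) (v i) (fun j => a ⟨i, j⟩) (e i) =
          shuffleSign (r i) (fun j => (z' i j).deg (a ⟨i, j⟩)) •
            C.pre (g i (c i) (e i)) (fun j => v i j (fun _ => a ⟨i, j⟩) (c i j)) :=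
        fun i => qval_of (hv i) (e i) (c i) (hc i)
      simp only [h1]
      rw [multilinear_sign_smul, smul_smul]
      congr 1
      -- The sign of the outer composition falls into a part between blocks and parts inside the
      -- blocks; the latter are the signs of the inner `qval`.
      rw [shuffleSign_sigma]
      simp only [hsum, shuffleSign_add_left, shuffleSign_add_right]
      ac_rfl
    · push Not at he
      obtain ⟨i, hi⟩ := he
      rw [cval_zero hg b i hi, C.zero_pre, smul_zero, cval_zero hvg b i, smul_zero]
      intro e he
      exact hi e (by rw [he, hsum]; ring)
  · push Not at hc
    obtain ⟨i, j, hi⟩ := hc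
    rw [qval_zero (fun p : Σ i, J i => hv p.1 p.2) b ⟨i, j⟩ hi, cval_zero_right b i, smul_zero]
    exact fun e => qval_zero (hv i) e j hi

end

end Cx

namespace Cx

variable {C : PTCat.{u, v, w} k}

section

variable {I : Type} [Fintype I] [Nonempty I] [LinearOrder I]

lemma mval_of_permSign {I' : Type} [Fintype I'] [LinearOrder I'] [Nonempty I'] (e : I ≃ I')
    (he : ∀ a, permSign e a = 1) {y : I' → Cx C} {x : Cx C} (f : Fam I (fun i => y (e i)) x)
    (a : ∀ i, (y i).ι) (b : x.ι) :
    mval e f a b = C.map (y := fun i => (y i).X (a i)) e (f (fun i => a (e i)) b) := by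
  rw [mval, he, one_smul]

lemma mval_refl {y : I → Cx C} {x : Cx C} (f : Fam I y x) : mval (Equiv.refl I) f = f := by
  funext a b
  exact (mval_of_permSign (Equiv.refl I) (permSign_of_monotone _ fun _ _ h => h) f a b).trans
    (C.map_refl _)

lemma mval_trans {I' I'' : Type} [Fintype I'] [LinearOrder I'] [Nonempty I'] [Fintype I'']
    [LinearOrder I''] [Nonempty I''] (e : I ≃ I') (e' : I' ≃ I'') {y : I'' → Cx C} {x : Cx C}
    (f : Fam I (fun i => y (e' (e i))) x) :
    mval (y := y) (e.trans e') f = mval e' (mval (y := fun i => y (e' i)) e f) := by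
  funext a b
  change permSign (e.trans e') (fun i => (y (e' (e i))).deg (a (e' (e i)))) •
      C.map (y := fun i => (y i).X (a i)) (e.trans e') (f (fun i => a (e' (e i))) b) =
    permSign e' (fun i => (y (e' i)).deg (a (e' i))) • C.map (y := fun i => (y i).X (a i)) e'
      (permSign e (fun i => (y (e' (e i))).deg (a (e' (e i)))) •
        C.map (y := fun i => (y (e' i)).X (a (e' i))) e (f (fun i => a (e' (e i))) b))
  rw [map_sign_smul, smul_smul, permSign_trans e e' (fun i => (y (e' i)).deg (a (e' i))),
    mul_comm (permSign e _)]
  exact congrArg _ (C.map_trans (y := fun i => (y i).X (a i)) e e' _)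

variable {J : I → Type} [∀ i, Fintype (J i)] [∀ i, Nonempty (J i)] [∀ i, LinearOrder (J i)]

lemma cval_assoc {H : ∀ i, J i → Type} [∀ i j, Fintype (H i j)] [∀ i j, LinearOrder (H i j)]
    [∀ i j, Nonempty (H i j)] {t : ∀ i j, H i j → Cx C} {z : ∀ i, J i → Cx C} {y : I → Cx C}
    {x : Cx C} {m : I → ℤ} {r : ∀ i, J i → ℤ} {f : Fam I y x} {g : ∀ i, Fam (J i) (z i) (y i)}
    {h : ∀ i j, Fam (H i j) (t i j) (z i j)}
    (hg : ∀ i, g i ∈ Op (J i) (z i) (y i) (m i))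
    (hh : ∀ i j, h i j ∈ Op (H i j) (t i j) (z i j) (r i j)) :
    mval (y := fun p => t p.1 p.2.1 p.2.2) (Equiv.sigmaAssoc H)
        (cval (J := fun p : Σ i, J i => H p.1 p.2) (z := fun p => t p.1 p.2)
          (y := fun p => z p.1 p.2) (fun p => r p.1 p.2) (cval m f g) (fun p => h p.1 p.2)) =
      shuffleSign m (fun i => ∑ j, r i j) •
        cval (J := fun i => Σ j, H i j) (z := fun i p => t i p.1 p.2)
          (fun i => m i + ∑ j, r i j) f
          (fun i => cval (J := H i) (z := t i) (y := z i) (r i) (g i) (h i)) := by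
  have hvg : ∀ i, cval (r i) (g i) (h i) ∈
      Op (Σ j, H i j) (fun p => t i p.1 p.2) (y i) (m i + ∑ j, r i j) :=
    fun i => cval_mem (hg i) (hh i) rfl
  funext a b
  rw [Pi.smul_apply, Pi.smul_apply]
  refine (mval_of_permSign (y := fun p => t p.1 p.2.1 p.2.2) (Equiv.sigmaAssoc H)
    permSign_sigmaAssoc _ a b).trans ?_
  let a' : ∀ p : Σ p : Σ i, J i, H p.1 p.2, (t p.1.1 p.1.2 p.2).ι := fun p => a ⟨p.1.1, p.1.2, p.2⟩
  -- The transport is replaced by an opaque linear map `L`, so that rewriting only sees linearity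
  -- and not the dependent types of `C.map`; the equation for `L` is used once, to apply `C.assoc`.
  suffices key : ∀ L : C.P (Σ p : Σ i, J i, H p.1 p.2) (fun p => (t p.1.1 p.1.2 p.2).X (a' p))
      (x.X b) →ₗ[k] C.P (Σ i, Σ j, H i j) (fun p => (t p.1 p.2.1 p.2.2).X (a p)) (x.X b),
      L = C.map (y := fun p => (t p.1 p.2.1 p.2.2).X (a p)) (Equiv.sigmaAssoc H) →
      L (cval (J := fun p : Σ i, J i => H p.1 p.2) (z := fun p => t p.1 p.2)
          (y := fun p => z p.1 p.2) (fun p => r p.1 p.2) (cval m f g) (fun p => h p.1 p.2) a' b) =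
        shuffleSign m (fun i => ∑ j, r i j) •
        cval (J := fun i => Σ j, H i j) (z := fun i p => t i p.1 p.2)
          (fun i => m i + ∑ j, r i j) f
          (fun i => cval (J := H i) (z := t i) (y := z i) (r i) (g i) (h i)) a b from key _ rfl
  intro L hL
  by_cases hc : ∀ i j, ∃ c, (z i j).deg c = ∑ l, (t i j l).deg (a ⟨i, j, l⟩) + r i j
  · choose c hc using hc
    have hsum : ∀ i, ∑ j, (z i j).deg (c i j) =
        ∑ j, ∑ l, (t i j l).deg (a ⟨i, j, l⟩) + ∑ j, r i j :=
      fun i => by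
        rw [Finset.sum_congr rfl fun j _ => hc i j, Finset.sum_add_distrib]
    have hsum' : ∀ i, ∑ p : Σ j, H i j, (t i p.1 p.2).deg (a ⟨i, p⟩) =
        ∑ j, ∑ l, (t i j l).deg (a ⟨i, j, l⟩) := fun i => Fintype.sum_sigma _
    rw [cval_of (J := fun p : Σ i, J i => H p.1 p.2) (a := a')
        (fun p : Σ i, J i => hh p.1 p.2) b (fun p => c p.1 p.2) (fun p => hc p.1 p.2)]
    by_cases he : ∀ i, ∃ e, (y i).deg e = ∑ j, (z i j).deg (c i j) + m i
    · choose e he using he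
      rw [cval_of hg b e he, cval_of (J := fun i => Σ j, H i j) hvg b e
        (fun i => by rw [he, hsum, hsum']; ring), map_sign_smul, map_sign_smul, smul_apply,
        map_sign_smul, smul_smul, smul_smul]
      have h1 : ∀ i, cval (r i) (g i) (h i) (fun p => a ⟨i, p⟩) (e i) =
          shuffleSign (r i) (fun j => ∑ l, (t i j l).deg (a ⟨i, j, l⟩)) •
            C.comp (J := H i) (z := fun j l => (t i j l).X (a ⟨i, j, l⟩)) (g i (c i) (e i))
              (fun j => h i j (fun l => a ⟨i, j, l⟩) (c i j)) :=
        fun i => cval_of (hh i) (e i) (c i) (hc i)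
      simp only [h1]
      rw [multilinear_sign_smul (C.comp (f e b)), smul_smul]
      refine congrArg₂ (fun (s : ℤˣ) X => s • X) ?_ ?_
      · rw [shuffleSign_sigma]
        simp only [hsum, hsum', shuffleSign_add_left, shuffleSign_add_right]
        simp only [a']
        ac_rfl
      · rw [hL]
        exact C.assoc (t := fun i j l => (t i j l).X (a ⟨i, j, l⟩))
          (z := fun i j => (z i j).X (c i j)) (f e b) (fun i => g i (c i) (e i))
          (fun i j => h i j (fun l => a ⟨i, j, l⟩) (c i j))
    · push Not at he
      obtain ⟨i, hi⟩ := he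
      rw [cval_zero hg b i hi, map_zero, zero_apply, smul_zero, map_zero,
        cval_zero (J := fun i => Σ j, H i j) hvg b i, smul_zero]
      intro e he
      exact hi e (by rw [he, hsum, hsum']; ring)
  · push Not at hc
    obtain ⟨i, j, hi⟩ := hc
    rw [cval_zero (J := fun p : Σ i, J i => H p.1 p.2) (a := a')
        (fun p : Σ i, J i => hh p.1 p.2) b ⟨i, j⟩ hi, map_zero,
      cval_zero_right (J := fun i => Σ j, H i j) b i, smul_zero]
    exact fun e => cval_zero (hh i) e j hi

lemma cval_mval_left {I' : Type} [Fintype I'] [Nonempty I'] [LinearOrder I'] (e : I ≃ I')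
    {J : I' → Type} [∀ i, Fintype (J i)] [∀ i, LinearOrder (J i)] [∀ i, Nonempty (J i)]
    {z : ∀ i, J i → Cx C} {y : I' → Cx C} {x : Cx C} {m : I' → ℤ}
    {f : Fam I (fun i => y (e i)) x} {g : ∀ i, Fam (J i) (z i) (y i)}
    (hg : ∀ i, g i ∈ Op (J i) (z i) (y i) (m i)) :
    cval m (mval (y := y) e f) g =
      permSign e (fun i => m (e i)) •
        mval (y := fun p => z p.1 p.2) (Equiv.sigmaCongrLeft e)
          (cval (z := fun i => z (e i)) (fun i => m (e i)) f (fun i => g (e i))) := by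
  funext a b
  rw [Pi.smul_apply, Pi.smul_apply]
  let a' : ∀ p : Σ i, J (e i), (z (e p.1) p.2).ι := fun p => a ⟨e p.1, p.2⟩
  suffices key : ∀ L : C.P (Σ i, J (e i)) (fun p => (z (e p.1) p.2).X (a' p)) (x.X b) →ₗ[k]
      C.P (Σ i, J i) (fun p => (z p.1 p.2).X (a p)) (x.X b),
      L = C.map (y := fun p => (z p.1 p.2).X (a p))
        (Equiv.sigmaCongrLeft e : (Σ i, J (e i)) ≃ Σ i, J i) →
      cval m (mval (y := y) e f) g a b = permSign e (fun i => m (e i)) •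
        permSign (Equiv.sigmaCongrLeft e : (Σ i, J (e i)) ≃ Σ i, J i)
          (fun p => (z (e p.1) p.2).deg (a' p)) •
        L (cval (z := fun i => z (e i)) (fun i => m (e i)) f (fun i => g (e i)) a' b) from
    key _ rfl
  intro L hL
  by_cases hc : ∀ i, ∃ c, (y i).deg c = ∑ j, (z i j).deg (a ⟨i, j⟩) + m i
  · choose c hc using hc
    rw [cval_of hg b c hc, cval_of (a := a') (fun i => hg (e i)) b (fun i => c (e i))
      (fun i => hc (e i)), mval, map_sign_smul, map_sign_smul, smul_apply, smul_smul, smul_smul,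
      smul_smul, permSign_sigmaCongrLeft]
    refine congrArg₂ (fun (s : ℤˣ) X => s • X) ?_ ?_
    -- The intermediate degrees are sums of the degrees of the arguments and of `m i`, which is the
    -- shape required by `shuffleSign_mul_permSign`.
    · simp only [hc]
      rw [shuffleSign_mul_permSign]
    · rw [hL]
      exact C.comp_map_left (z := fun i j => (z i j).X (a ⟨i, j⟩)) (y := fun i => (y i).X (c i)) e
        (f (fun i => c (e i)) b) (fun i => g i (fun j => a ⟨i, j⟩) (c i))
  · push Not at hc
    obtain ⟨i, hi⟩ := hc
    obtain ⟨i, rfl⟩ := e.surjective i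
    rw [cval_zero hg b _ hi, cval_zero (a := a') (fun i => hg (e i)) b i hi, map_zero, smul_zero,
      smul_zero]

lemma cval_mval_right {J' : I → Type} [∀ i, Fintype (J' i)] [∀ i, Nonempty (J' i)]
    [∀ i, LinearOrder (J' i)] (e : ∀ i, J i ≃ J' i) {z : ∀ i, J' i → Cx C}
    {y : I → Cx C} {x : Cx C} {m : I → ℤ} {f : Fam I y x}
    {g : ∀ i, Fam (J i) (fun j => z i (e i j)) (y i)}
    (hg : ∀ i, g i ∈ Op (J i) (fun j => z i (e i j)) (y i) (m i)) :
    cval m f (fun i => mval (y := z i) (e i) (g i)) =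
      mval (y := fun p => z p.1 p.2) (Equiv.sigmaCongrRight e) (cval m f g) := by
  have hvg : ∀ i, mval (y := z i) (e i) (g i) ∈ Op (J' i) (z i) (y i) (m i) :=
    fun i => (mapOp (e i) (m i) ⟨g i, hg i⟩).2
  have hsum : ∀ (a : ∀ p : Σ i, J' i, (z p.1 p.2).ι) i, ∑ j, (z i (e i j)).deg (a ⟨i, e i j⟩) =
      ∑ j, (z i j).deg (a ⟨i, j⟩) :=
    fun a i => Equiv.sum_comp (e i) fun j => (z i j).deg (a ⟨i, j⟩)
  funext a b
  let a' : ∀ p : Σ i, J i, (z p.1 (e p.1 p.2)).ι := fun p => a ⟨p.1, e p.1 p.2⟩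
  suffices key : ∀ L : C.P (Σ i, J i) (fun p => (z p.1 (e p.1 p.2)).X (a' p)) (x.X b) →ₗ[k]
      C.P (Σ i, J' i) (fun p => (z p.1 p.2).X (a p)) (x.X b),
      L = C.map (y := fun p => (z p.1 p.2).X (a p)) (Equiv.sigmaCongrRight e) →
      cval m f (fun i => mval (y := z i) (e i) (g i)) a b =
        permSign (Equiv.sigmaCongrRight e) (fun p => (z p.1 (e p.1 p.2)).deg (a' p)) •
        L (cval m f g a' b) from key _ rfl
  intro L hL
  by_cases hc : ∀ i, ∃ c, (y i).deg c = ∑ j, (z i j).deg (a ⟨i, j⟩) + m i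
  · choose c hc using hc
    rw [cval_of hvg b c hc, cval_of (a := a') hg b c (fun i => by rw [hc, ← hsum]), map_sign_smul,
      smul_smul, permSign_sigmaCongrRight]
    have h1 : ∀ i, mval (y := z i) (e i) (g i) (fun j => a ⟨i, j⟩) (c i) =
          permSign (e i) (fun j => (z i (e i j)).deg (a ⟨i, e i j⟩)) •
            C.map (y := fun j => (z i j).X (a ⟨i, j⟩)) (e i)
              (g i (fun j => a ⟨i, e i j⟩) (c i)) := fun i => rfl
    simp only [h1]
    rw [multilinear_sign_smul (C.comp (f c b)), smul_smul, mul_comm]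
    refine congrArg₂ (fun (s : ℤˣ) X => s • X) (congrArg _ ?_) ?_
    swap
    · rw [hL]
      exact C.comp_map_right e (z := fun i j => (z i j).X (a ⟨i, j⟩)) (f c b)
        (fun i => g i (fun j => a ⟨i, e i j⟩) (c i))
    exact congrArg (shuffleSign m) (funext fun i => (hsum a i).symm)
  · push Not at hc
    obtain ⟨i, hi⟩ := hc
    rw [cval_zero hvg b i hi, cval_zero (a := a') hg b i, map_zero, smul_zero]
    intro c hc
    exact hi c (by rw [hc, ← hsum])

lemma pval_mval {I' : Type} [Fintype I'] [Nonempty I'] [LinearOrder I'] (e : I ≃ I')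
    {y : I' → Cx C} {x x' : Cx C} {n : ℤ} (h : Fam Unit (fun _ => x) x')
    {f : Fam I (fun i => y (e i)) x} (hf : f ∈ Op I (fun i => y (e i)) x n) :
    pval h (mval (y := y) e f) = mval e (pval h f) := by
  have hmf : mval (y := y) e f ∈ Op I' y x n := (mapOp e n ⟨f, hf⟩).2
  have hsum : ∀ (a : ∀ i, (y i).ι), ∑ i, (y (e i)).deg (a (e i)) = ∑ i, (y i).deg (a i) :=
    fun a => Equiv.sum_comp e fun i => (y i).deg (a i)
  funext a b
  by_cases hc : ∃ c, x.deg c = ∑ i, (y i).deg (a i) + n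
  · obtain ⟨c, hc⟩ := hc
    rw [pval_of hmf b c hc, mval, mval, C.post_sign, C.post_map,
      pval_of hf b c (by rw [hc, ← hsum])]
  · push Not at hc
    rw [pval_zero b fun c => hmf a c (hc c), mval, pval_zero, map_zero, smul_zero]
    exact fun c => hf _ c (by rw [hsum]; exact hc c)

lemma qval_mval {I' : Type} [Fintype I'] [Nonempty I'] [LinearOrder I'] (e : I ≃ I')
    {y y' : I' → Cx C} {x : Cx C} {s : I' → ℤ}
    {f : Fam I (fun i => y (e i)) x} {v : ∀ i, Fam Unit (fun _ => y' i) (y i)}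
    (hv : ∀ i, v i ∈ Op Unit (fun _ => y' i) (y i) (s i)) :
    qval s (mval (y := y) e f) v = permSign e (fun i => s (e i)) •
      mval (y := y') e (qval (fun i => s (e i)) f (fun i => v (e i))) := by
  funext a b
  rw [Pi.smul_apply, Pi.smul_apply, mval]
  by_cases hc : ∀ i, ∃ c, (y i).deg c = (y' i).deg (a i) + s i
  · choose c hc using hc
    rw [qval_of hv b c hc, qval_of (fun i => hv (e i)) b (fun i => c (e i)) (fun i => hc (e i)),
      mval, map_sign_smul, C.pre_sign, C.pre_map, smul_smul, smul_smul, smul_smul]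
    simp only [hc]
    rw [shuffleSign_mul_permSign]
  · push Not at hc
    obtain ⟨i, hi⟩ := hc
    obtain ⟨i, rfl⟩ := e.surjective i
    rw [qval_zero hv b _ hi, qval_zero (fun i => hv (e i)) b i hi, map_zero, smul_zero, smul_zero]

/-- Together with `mval_sigmaUnit` this expresses the two kinds of terms in `dP` by `pval` and
`qval`; the relabellings are monotone and give no sign. -/
lemma mval_unitSigma {y : I → Cx C} {x x' : Cx C} {n : ℤ} {h : Fam Unit (fun _ => x) x'}
    {f : Fam I y x} (hf : f ∈ Op I y x n) :
    mval (unitSigma I) (cval (J := fun _ => I) (z := fun _ => y) (fun _ => n) h (fun _ => f)) =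
      pval h f := by
  funext a b
  rw [mval_of_permSign _ permSign_unitSigma]
  by_cases hc : ∃ c, x.deg c = ∑ i, (y i).deg (a i) + n
  · obtain ⟨c, hc⟩ := hc
    rw [pval_of hf b c hc, cval_of (fun _ => hf) b (fun _ => c) (fun _ => hc),
      shuffleSign_subsingleton, one_smul]
    rfl
  · push Not at hc
    rw [pval_zero b fun c => hf a c (hc c), cval_zero (fun _ => hf) b () hc, map_zero]

lemma mval_sigmaUnit {y y' : I → Cx C} {x : Cx C} {s : I → ℤ} {f : Fam I y x}
    {v : ∀ i, Fam Unit (fun _ => y' i) (y i)} (hv : ∀ i, v i ∈ Op Unit (fun _ => y' i) (y i) (s i)) :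
    mval (sigmaUnit I) (cval (J := fun _ => Unit) (z := fun i _ => y' i) s f v) =
      qval s f v := by
  funext a b
  rw [mval_of_permSign _ permSign_sigmaUnit]
  by_cases hc : ∀ i, ∃ c, (y i).deg c = (y' i).deg (a i) + s i
  · choose c hc using hc
    rw [qval_of hv b c hc, cval_of hv b c (fun i => by simpa using hc i), map_sign_smul]
    simp only [Fintype.sum_unique]
    rfl
  · push Not at hc
    obtain ⟨i, hi⟩ := hc
    rw [qval_zero hv b i hi, cval_zero hv b i (fun c => by simpa using hi c), map_zero]

lemma one_apply_self (x : Cx C) (a : Unit → x.ι) : x.one.1 a (a ()) = C.id (x.X (a ())) := by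
  simp [one]

lemma one_apply_ne (x : Cx C) (a : Unit → x.ι) (b : x.ι) (h : a () ≠ b) : x.one.1 a b = 0 := by
  simp [one, h]

lemma pval_one {y : I → Cx C} {x : Cx C} {f : Fam I y x} :
    pval x.one.1 f = f := by
  funext a b
  refine (finsum_eq_single _ b fun c hc => ?_).trans ?_
  · rw [one_apply_ne x _ b hc, C.zero_post]
  · exact (congrArg (fun h => C.post h (f a b)) (one_apply_self x fun _ => b)).trans (C.post_id _)

lemma qval_one {y : I → Cx C} {x : Cx C} {f : Fam I y x} :
    qval (fun _ => 0) f (fun i => (y i).one.1) = f := by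
  funext a b
  rw [qval_of (fun i => (y i).one.2) b a (by simp), shuffleSign_zero_left, one_smul]
  exact (congrArg (C.pre (f a b)) (funext fun i => one_apply_self (y i) fun _ => a i)).trans
    (C.pre_id _)

lemma unit_pval_one {x x' : Cx C} {f : Fam Unit (fun _ => x) x'} : pval f x.one.1 = f := by
  funext a b
  rw [pval_of x.one.2 b (a ()) (by simp)]
  exact (congrArg (C.post (f a b)) (one_apply_self x a)).trans (C.id_post _)

lemma pval_dOp_dOp (x : Cx C) : pval x.dOp.1 x.dOp.1 = 0 := by
  funext a b
  refine finsum_eq_zero_of_forall_eq_zero fun c => x.d_d _ _ _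

end

end Cx

/-! ### The differential on operations and the Leibniz rule -/

section indicator

variable {I : Type} [Fintype I] [LinearOrder I]

/-- The family of degrees of `(1, …, d, …, 1)` with `d` at the place `i`. -/
abbrev indDeg {I : Type} [LinearOrder I] (i j : I) : ℤ := if j = i then 1 else 0

lemma sum_indDeg (i : I) : ∑ j, indDeg i j = 1 := by simp

/-- A single odd operation at the place `i` passes only what stands before `i`. In
`shuffleSign_indDeg_right` it is the operations after `i` that pass the odd entry. -/
lemma shuffleSign_indDeg_left (i : I) (A : I → ℤ) :
    shuffleSign (indDeg i) A = Int.negOnePow (∑ j with j < i, A j) := by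
  rw [negOnePow_sum, Finset.prod_filter, shuffleSign_eq, pairProd_eq_ite]
  refine Finset.prod_congr rfl fun j _ => ?_
  rw [Finset.prod_eq_single i]
  · simp
  · intro b _ hb
    simp [hb]
  · simp

lemma shuffleSign_indDeg_right (i : I) (m : I → ℤ) :
    shuffleSign m (indDeg i) = Int.negOnePow (∑ j with i < j, m j) := by
  rw [negOnePow_sum, Finset.prod_filter, shuffleSign_eq, pairProd_eq_ite, Finset.prod_eq_single i]
  · simp
  · intro b _ hb
    simp [hb]
  · simp

/-- In exactly one of the two orders do the odd operations have to pass each other. -/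
lemma shuffleSign_indDeg_indDeg {i j : I} (h : i ≠ j) :
    shuffleSign (indDeg i) (indDeg j) = -shuffleSign (indDeg j) (indDeg i) := by
  simp only [shuffleSign_indDeg_left, Finset.sum_ite_eq', Finset.mem_filter, Finset.mem_univ,
    true_and]
  rcases lt_or_gt_of_ne h with h | h <;> simp [h, h.not_gt]

lemma sum_lt_add_sum_gt (i : I) (m : I → ℤ) :
    ∑ j, m j = ∑ j with j < i, m j + m i + ∑ j with i < j, m j := by
  have h1 : ∀ j, m j = (if j < i then m j else 0) + (if j = i then m j else 0) +
      (if i < j then m j else 0) := by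
    intro j
    rcases lt_trichotomy j i with h | h | h
    · simp [h, h.not_gt, h.ne]
    · simp [h]
    · simp [h, h.not_gt, h.ne']
  simp only [Finset.sum_filter]
  rw [Finset.sum_congr rfl fun j _ => h1 j, Finset.sum_add_distrib, Finset.sum_add_distrib]
  simp

/-- Swapping the indices is a sign-reversing involution; the diagonal terms are fixed by it and have
to vanish by themselves. -/
lemma sum_sum_eq_zero_of_antisymm {ι M : Type*} [Fintype ι] [AddCommGroup M] (A : ι → ι → M)
    (h : ∀ i j, i ≠ j → A i j = -A j i) (h' : ∀ i, A i i = 0) : ∑ i, ∑ j, A i j = 0 := by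
  classical
  rw [← Fintype.sum_prod_type']
  refine Finset.sum_involution (fun p _ => p.swap) (fun p _ => ?_) (fun p _ hp h2 => hp ?_)
    (fun _ _ => Finset.mem_univ _) (fun p _ => Prod.swap_swap p)
  · by_cases hp : p.1 = p.2
    · simp [hp, h']
    · simp [h _ _ hp]
  · rw [show p.1 = p.2 from congrArg Prod.snd h2, h']

end indicator

namespace PTCat

variable (C : PTCat.{u, v, w} k)

lemma add_pre {I : Type} [Finite I] [Nonempty I] {y y' : I → C.Ob} {x : C.Ob} (f f' : C.P I y x)
    (u : ∀ i, C.P Unit (fun _ => y' i) (y i)) : C.pre (f + f') u = C.pre f u + C.pre f' u := by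
  simp only [← preₗ_apply, map_add, add_apply]

lemma smul_pre {I : Type} [Finite I] [Nonempty I] {y y' : I → C.Ob} {x : C.Ob} (r : k)
    (f : C.P I y x) (u : ∀ i, C.P Unit (fun _ => y' i) (y i)) :
    C.pre (r • f) u = r • C.pre f u := by
  simp only [← preₗ_apply, map_smul, smul_apply]

end PTCat

namespace Cx

variable {C : PTCat.{u, v, w} k}

section

variable {I : Type} [Fintype I] [Nonempty I] [LinearOrder I]

/-- The underlying families of `dFamily`. -/
abbrev dfam (y : I → Cx C) (i j : I) : Fam Unit (fun _ => y j) (y j) := (dFamily y i j).1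

lemma dfam_mem (y : I → Cx C) (i j : I) :
    dfam y i j ∈ Op Unit (fun _ => y j) (y j) (indDeg i j) :=
  (dFamily y i j).2

lemma dfam_self (y : I → Cx C) (i : I) : dfam y i i = (y i).dOp.1 := by
  simp [dfam, dFamily]

lemma dfam_ne (y : I → Cx C) {i j : I} (h : j ≠ i) : dfam y i j = (y j).one.1 := by
  simp [dfam, dFamily, h]

/-- The composition with the differential of the target. -/
def pOp {y : I → Cx C} {x : Cx C} {n n' : ℤ} (h : n + 1 = n') : Op I y x n →ₗ[k] Op I y x n' where
  toFun f := ⟨pval x.dOp.1 f.1, pval_mem x.dOp.2 f.2 h⟩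
  map_add' f f' := by
    apply Subtype.ext
    funext a b
    by_cases hc : ∃ c, x.deg c = ∑ i, (y i).deg (a i) + n
    · obtain ⟨c, hc⟩ := hc
      refine (pval_of (f + f').2 b c hc).trans (Eq.trans ?_
        (congrArg₂ _ (pval_of f.2 b c hc) (pval_of f'.2 b c hc)).symm)
      exact map_add (C.postₗ _ _ _ _) _ _
    · push Not at hc
      refine (pval_zero b fun c => (f + f').2 a c (hc c)).trans (Eq.trans (add_zero 0).symm
        (congrArg₂ _ (pval_zero b fun c => f.2 a c (hc c))
          (pval_zero b fun c => f'.2 a c (hc c))).symm)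
  map_smul' r f := by
    apply Subtype.ext
    funext a b
    by_cases hc : ∃ c, x.deg c = ∑ i, (y i).deg (a i) + n
    · obtain ⟨c, hc⟩ := hc
      refine (pval_of (r • f).2 b c hc).trans (Eq.trans ?_
        (congrArg (r • ·) (pval_of f.2 b c hc)).symm)
      exact map_smul (C.postₗ _ _ _ _) _ _
    · push Not at hc
      exact (pval_zero b fun c => (r • f).2 a c (hc c)).trans (Eq.trans (smul_zero r).symm
        (congrArg (r • ·) (pval_zero b fun c => f.2 a c (hc c))).symm)

/-- The composition with the differential of the source at the place `i`. -/
def qOp {y : I → Cx C} {x : Cx C} {n n' : ℤ} (h : n + 1 = n') (i : I) :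
    Op I y x n →ₗ[k] Op I y x n' where
  toFun f := ⟨qval (indDeg i) f.1 (dfam y i),
    qval_mem f.2 (dfam_mem y i) (by rw [sum_indDeg]; exact h)⟩
  map_add' f f' := by
    apply Subtype.ext
    funext a b
    by_cases hc : ∀ j, ∃ c, (y j).deg c = (y j).deg (a j) + indDeg i j
    · choose c hc using hc
      refine (qval_of (dfam_mem y i) b c hc).trans (Eq.trans ?_
        (congrArg₂ _ (qval_of (dfam_mem y i) b c hc) (qval_of (dfam_mem y i) b c hc)).symm)
      refine Eq.trans (congrArg _ ?_) (smul_add _ _ _)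
      exact C.add_pre _ _ _
    · push Not at hc
      obtain ⟨j, hj⟩ := hc
      refine (qval_zero (dfam_mem y i) b j hj).trans (Eq.trans (add_zero 0).symm
        (congrArg₂ _ (qval_zero (dfam_mem y i) b j hj) (qval_zero (dfam_mem y i) b j hj)).symm)
  map_smul' r f := by
    apply Subtype.ext
    funext a b
    by_cases hc : ∀ j, ∃ c, (y j).deg c = (y j).deg (a j) + indDeg i j
    · choose c hc using hc
      refine (qval_of (dfam_mem y i) b c hc).trans (Eq.trans ?_
        (congrArg (r • ·) (qval_of (dfam_mem y i) b c hc)).symm)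
      refine Eq.trans (congrArg _ ?_) (smul_comm _ _ _)
      exact C.smul_pre _ _ _
    · push Not at hc
      obtain ⟨j, hj⟩ := hc
      exact (qval_zero (dfam_mem y i) b j hj).trans (Eq.trans (smul_zero r).symm
        (congrArg (r • ·) (qval_zero (dfam_mem y i) b j hj)).symm)

/-- From here on the differential is handled through these operators: `pOp` squares to zero and
commutes with each `qOp`, and the `qOp` square to zero and anticommute. -/
lemma dP_eq {y : I → Cx C} {x : Cx C} {n n' : ℤ} (h : n + 1 = n') (f : Op I y x n) :
    dP n n' h f = pOp h f - Int.negOnePow n • ∑ i, qOp h i f := by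
  have h1 : mapOp (unitSigma I) n' (comp (J := fun _ => I) (z := fun _ => y) 1 (fun _ => n) n'
      (by simp; omega) x.dOp (fun _ => f)) = pOp h f := Subtype.ext (mval_unitSigma f.2)
  have h2 : ∀ i, mapOp (sigmaUnit I) n' (comp (J := fun _ => Unit) (z := fun j _ => y j) n
      (fun j => if j = i then 1 else 0) n' (by simpa using h) f (dFamily y i)) = qOp h i f :=
    fun i => Subtype.ext (mval_sigmaUnit (dfam_mem y i))
  exact congrArg₂ (fun X Y => X - Int.negOnePow n • Y) h1 (Finset.sum_congr rfl fun i _ => h2 i)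

lemma pOp_pOp {y : I → Cx C} {x : Cx C} {n n' n'' : ℤ} (h : n + 1 = n') (h' : n' + 1 = n'')
    (f : Op I y x n) : pOp h' (pOp h f) = 0 := by
  apply Subtype.ext
  refine (pval_pval x.dOp.2 f.2).trans ?_
  rw [pval_dOp_dOp]
  funext a b
  exact finsum_eq_zero_of_forall_eq_zero fun c => C.zero_post _

lemma pOp_qOp {y : I → Cx C} {x : Cx C} {n n' n'' : ℤ} (h : n + 1 = n') (h' : n' + 1 = n'') (i : I)
    (f : Op I y x n) : pOp h' (qOp h i f) = qOp h' i (pOp h f) :=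
  Subtype.ext (pval_qval x.dOp.1 f.2 (dfam_mem y i))

lemma qOp_qOp_self {y : I → Cx C} {x : Cx C} {n n' n'' : ℤ} (h : n + 1 = n') (h' : n' + 1 = n'')
    (i : I) (f : Op I y x n) : qOp h' i (qOp h i f) = 0 := by
  apply Subtype.ext
  have h0 : qval (fun j => indDeg i j + indDeg i j) f.1
      (fun j => pval (dfam y i j) (dfam y i j)) = 0 := by
    funext a b
    refine (congrArg _ (finsum_eq_zero_of_forall_eq_zero fun c => ?_)).trans (smul_zero _)
    refine C.pre_zero _ _ i ?_
    change pval (dfam y i i) (dfam y i i) _ _ = 0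
    rw [dfam_self, pval_dOp_dOp]
    rfl
  exact (qval_qval (dfam_mem y i) (dfam_mem y i)).trans ((congrArg _ h0).trans (smul_zero _))

/-- At every place at least one of the two unary operations is an identity, so both orders give the
same merged family; only the sign of two odd operations passing each other remains. -/
lemma qOp_qOp {y : I → Cx C} {x : Cx C} {n n' n'' : ℤ} (h : n + 1 = n') (h' : n' + 1 = n'')
    {i j : I} (hij : i ≠ j) (f : Op I y x n) :
    qOp h' i (qOp h j f) = -qOp h' j (qOp h i f) := by
  apply Subtype.ext
  refine (qval_qval (dfam_mem y j) (dfam_mem y i)).trans (Eq.trans ?_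
    (congrArg Neg.neg (qval_qval (dfam_mem y i) (dfam_mem y j))).symm)
  have h1 : (fun l => pval (dfam y j l) (dfam y i l)) = fun l => pval (dfam y i l) (dfam y j l) := by
    funext l
    by_cases hi : l = i
    · subst hi
      rw [dfam_ne y hij, pval_one, unit_pval_one]
    · rw [dfam_ne y hi, pval_one, unit_pval_one]
  rw [h1, shuffleSign_indDeg_indDeg hij.symm, Units.smul_def, Units.smul_def]
  simp only [Units.val_neg, neg_smul]
  refine congrArg Neg.neg (congrArg _ ?_)
  exact congrArg (fun s => qval s f.1 _) (funext fun l => add_comm _ _)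

/-- The mixed terms cancel because `(-1)^(n+1) = -(-1)^n`, and the double sum of the `qOp` vanishes
by antisymmetry. -/
lemma dP_dP {y : I → Cx C} {x : Cx C} {n n' n'' : ℤ} (h : n + 1 = n') (h' : n' + 1 = n'')
    (f : Op I y x n) : dP n' n'' h' (dP n n' h f) = 0 := by
  have h1 : ∑ j, ∑ i, qOp h' i (qOp h j f) = 0 :=
    sum_sum_eq_zero_of_antisymm _ (fun i j hij => qOp_qOp h h' hij.symm f)
      (fun i => qOp_qOp_self h h' i f)
  have h2 : Int.negOnePow n' = -Int.negOnePow n := by rw [← h, Int.negOnePow_succ]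
  simp only [dP_eq, map_sub, pOp_pOp, map_sign_smul, map_sum, pOp_qOp h h']
  rw [Finset.sum_sub_distrib, ← Finset.smul_sum, h1, h2, Units.smul_def, Units.smul_def]
  simp

lemma qval_unit {x x' x'' : Cx C} {s : Unit → ℤ} {f : Fam Unit (fun _ => x') x''}
    {v : ∀ _ : Unit, Fam Unit (fun _ => x) x'}
    (hv : ∀ i, v i ∈ Op Unit (fun _ => x) x' (s i)) : qval s f v = pval f (v ()) := by
  funext a b
  by_cases hc : ∃ c, x'.deg c = x.deg (a ()) + s ()
  · obtain ⟨c, hc⟩ := hc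
    rw [pval_of (hv ()) b c (by simpa using hc), qval_of hv b (fun _ => c) (fun _ => hc),
      shuffleSign_subsingleton, one_smul]
    exact PTCat.pre_unit C (x := x.X (a ())) (f (fun _ => c) b) (v () a c)
  · push Not at hc
    rw [pval_zero b fun c => Op_unit_eq_zero (hv ()) (hc c), qval_zero hv b () hc]

lemma dP_one (x : Cx C) : dP 0 1 (by norm_num) x.one = 0 := by
  rw [dP_eq, sub_eq_zero, Fintype.sum_unique, Int.negOnePow_zero, one_smul]
  apply Subtype.ext
  refine (unit_pval_one (f := x.dOp.1)).trans (Eq.trans ?_ (qval_unit (dfam_mem (fun _ => x) ())).symm)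
  rw [dfam_self, pval_one]

lemma dP_mapOp {I' : Type} [Fintype I'] [Nonempty I'] [LinearOrder I'] (e : I ≃ I')
    {y : I' → Cx C} {x : Cx C} {n n' : ℤ} (h : n + 1 = n') (f : Op I (fun i => y (e i)) x n) :
    dP n n' h (mapOp (y := y) e n f) = mapOp e n' (dP n n' h f) := by
  rw [dP_eq, dP_eq, map_sub, map_sign_smul, map_sum]
  refine congrArg₂ _ (Subtype.ext (pval_mval e x.dOp.1 f.2)) (congrArg _ ?_)
  rw [← Equiv.sum_comp e]
  refine Finset.sum_congr rfl fun i _ => Subtype.ext ?_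
  refine (qval_mval e (dfam_mem y (e i))).trans ?_
  have h1 : (fun j => indDeg (e i) (e j)) = indDeg i := by
    funext j
    simp [indDeg]
  have h2 : (fun j => dfam y (e i) (e j)) = dfam (fun i => y (e i)) i := by
    funext j
    by_cases hj : j = i
    · subst hj
      rw [dfam_self, dfam_self]
    · rw [dfam_ne _ hj, dfam_ne y fun h' => hj (e.injective h')]
  -- Only one of the unary operations has non-zero degree, so permuting them costs no sign.
  rw [h1, h2, permSign_of_mul_even, one_smul]
  · rfl
  · intro j j' hj
    simp only [indDeg, mul_ite, mul_one, mul_zero]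
    split_ifs with h3 h4
    · exact absurd (h4.trans h3.symm) hj
    · rfl
    · rfl

variable {J : I → Type} [∀ i, Fintype (J i)] [∀ i, Nonempty (J i)] [∀ i, LinearOrder (J i)]
  {z : ∀ i, J i → Cx C} {y : I → Cx C} {x : Cx C} {n N' : ℤ} {m : I → ℤ}

lemma coe_cast {y : I → Cx C} {x : Cx C} {n n' : ℤ} (h : n = n') (f : Op I y x n) :
    ((complexes C).cast (y := y) (x := x) h f : Op I y x n').1 = f.1 := by
  subst h
  rfl

lemma sum_update_add_one (m : I → ℤ) (i : I) :
    ∑ j, Function.update m i (m i + 1) j = ∑ j, m j + 1 := by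
  have : Function.update m i (m i + 1) = fun j => m j + indDeg i j := by
    funext j
    by_cases h : j = i
    · subst h; simp
    · simp [h]
  rw [this, Finset.sum_add_distrib, sum_indDeg]

/-- The composition `f ∘ (g₁, …, u, …, gₙ)` with `u` of degree `m i + 1` at the place `i`, as a
linear function of `u`. -/
def compAt (hN : n + (∑ i, m i) + 1 = N') (f : Op I y x n) (g : ∀ i, Op (J i) (z i) (y i) (m i))
    (i : I) : Op (J i) (z i) (y i) (m i + 1) →ₗ[k] Op (Σ i, J i) (fun p => z p.1 p.2) x N' :=
  ((comp n (Function.update m i (m i + 1)) N'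
    (by rw [sum_update_add_one, ← hN, add_assoc]) f).toLinearMap
      (fun j => if h : j = i then 0 else (complexes C).cast (by simp [h]) (g j)) i).comp
    ((complexes C).cast (by simp))

lemma coe_compAt (hN : n + (∑ i, m i) + 1 = N') (f : Op I y x n)
    (g : ∀ i, Op (J i) (z i) (y i) (m i)) (i : I) (t : Op (J i) (z i) (y i) (m i + 1)) :
    (compAt hN f g i t).1 = cval (fun j => m j + indDeg i j) f.1
      (Function.update (fun j => (g j).1) i t.1) := by
  have h1 : Function.update m i (m i + 1) = fun j => m j + indDeg i j := by
    funext j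
    by_cases h : j = i
    · subst h; simp
    · simp [h]
  have h2 : (fun j => (Function.update (fun j => if h : j = i then 0 else
      (complexes C).cast (y := z j) (x := y j) (by simp [h]) (g j)) i
      ((complexes C).cast (y := z i) (x := y i) (by simp) t) j :
        Op (J j) (z j) (y j) (Function.update m i (m i + 1) j)).1) =
      Function.update (fun j => (g j).1) i t.1 := by
    funext j
    by_cases h : j = i
    · subst h
      refine Eq.trans ?_ (Function.update_self j t.1 (fun j => (g j).1)).symm
      exact (congrArg (fun t : Op _ _ _ _ => t.1) (Function.update_self j _ _)).trans
        (coe_cast _ _)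
    · refine Eq.trans ?_ (Function.update_of_ne h t.1 (fun j => (g j).1)).symm
      exact (congrArg (fun t : Op _ _ _ _ => t.1) ((Function.update_of_ne h _ _).trans
        (dif_neg h))).trans (coe_cast _ _)
  exact congrArg₂ (fun m' G => cval m' f.1 G) h1 h2

lemma comp_dAt (hN : n + (∑ i, m i) + 1 = N') (f : Op I y x n)
    (g : ∀ i, Op (J i) (z i) (y i) (m i)) (i : I)
    (h : n + ∑ j, Function.update m i (m i + 1) j = N') :
    comp n (Function.update m i (m i + 1)) N' h f ((complexes C).dAt i g) =
      compAt hN f g i (dP (m i) (m i + 1) rfl (g i)) := by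
  apply Subtype.ext
  rw [coe_compAt]
  have h1 : Function.update m i (m i + 1) = fun j => m j + indDeg i j := by
    funext j
    by_cases h : j = i
    · subst h; simp
    · simp [h]
  have hd : ∀ (i : I) (n' : ℤ) (h : m i + 1 = n'),
      (dP (m i) n' h (g i)).1 = (dP (m i) (m i + 1) rfl (g i)).1 := by
    rintro i n' rfl
    rfl
  have h2 : (fun j => ((complexes C).dAt i g j : Op (J j) (z j) (y j) _).1) =
      Function.update (fun j => (g j).1) i (dP (m i) (m i + 1) rfl (g i)).1 := by
    funext j
    by_cases h : j = i
    · subst h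
      refine Eq.trans ?_ (Function.update_self j _ (fun j => (g j).1)).symm
      exact (congrArg (fun t : Op _ _ _ _ => t.1) (dif_pos rfl)).trans
        (hd _ _ (Function.update_self j _ m).symm)
    · refine Eq.trans ?_ (Function.update_of_ne h _ (fun j => (g j).1)).symm
      exact (congrArg (fun t : Op _ _ _ _ => t.1) (dif_neg h)).trans (coe_cast _ _)
  exact congrArg₂ (fun m' G => cval m' f.1 G) h1 h2

/-- The differential of `y i` passes the `g j` with `j < i` and then acts on the output of `g i`. -/
lemma comp_qOp (hN : n + (∑ i, m i) + 1 = N') (f : Op I y x n)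
    (g : ∀ i, Op (J i) (z i) (y i) (m i)) (i : I) (h : n + 1 + ∑ j, m j = N') :
    comp (n + 1) m N' h (qOp rfl i f) g =
      Int.negOnePow (∑ j with j < i, m j) • compAt hN f g i (pOp rfl (g i)) := by
  apply Subtype.ext
  refine (cval_qval (dfam_mem y i) (fun j => (g j).2)).trans ?_
  rw [shuffleSign_indDeg_left]
  refine congrArg (fun X => Int.negOnePow (∑ j with j < i, m j) • X)
    (Eq.trans ?_ (coe_compAt hN f g i _).symm)
  refine congrArg _ (funext fun j => ?_)
  by_cases hj : j = i
  · subst hj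
    rw [dfam_self, Function.update_self]
    rfl
  · rw [dfam_ne y hj, Function.update_of_ne hj, pval_one]

/-- The differential of an argument of `g i` passes the `g j` with `i < j` before it acts inside `g
i`. -/
lemma qOp_comp {N : ℤ} (hN : n + (∑ i, m i) + 1 = N') (h : n + ∑ i, m i = N) (hN' : N + 1 = N')
    (f : Op I y x n) (g : ∀ i, Op (J i) (z i) (y i) (m i)) (i : I) (j : J i) :
    qOp hN' ⟨i, j⟩ (comp n m N h f g) =
      Int.negOnePow (∑ j with i < j, m j) • compAt hN f g i (qOp rfl j (g i)) := by
  apply Subtype.ext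
  refine (qval_cval (r := fun i' j' => indDeg (⟨i, j⟩ : Σ i, J i) ⟨i', j'⟩)
    (v := fun i' j' => dfam (fun p : Σ i, J i => z p.1 p.2) ⟨i, j⟩ ⟨i', j'⟩)
    (fun j => (g j).2) (fun i' j' => dfam_mem (fun p : Σ i, J i => z p.1 p.2) _ _)).trans ?_
  have h1 : ∀ i', i' ≠ i → ∀ j', indDeg (⟨i, j⟩ : Σ i, J i) ⟨i', j'⟩ = 0 :=
    fun i' hi' j' => if_neg fun h' => hi' (congrArg Sigma.fst h')
  have h2 : ∀ j', indDeg (⟨i, j⟩ : Σ i, J i) ⟨i, j'⟩ = indDeg j j' := by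
    intro j'
    simp [indDeg]
  have h3 : (fun i' => ∑ j', indDeg (⟨i, j⟩ : Σ i, J i) ⟨i', j'⟩) = indDeg i := by
    funext i'
    by_cases hi' : i' = i
    · subst hi'
      simp only [h2, sum_indDeg]
      simp
    · simp only [h1 i' hi', Finset.sum_const_zero]
      simp [hi']
  have h4 : ∀ i', ∑ j', indDeg (⟨i, j⟩ : Σ i, J i) ⟨i', j'⟩ = indDeg i i' := congrFun h3
  simp only [h4]
  rw [shuffleSign_indDeg_right]
  refine congrArg (fun X => Int.negOnePow (∑ j with i < j, m j) • X)
    (Eq.trans ?_ (coe_compAt hN f g i _).symm)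
  refine congrArg _ (funext fun i' => ?_)
  by_cases hi' : i' = i
  · subst hi'
    rw [Function.update_self]
    refine congrArg₂ (fun s v => qval s (g i').1 v) (funext h2) (funext fun j' => ?_)
    by_cases hj : j' = j
    · subst hj
      rw [dfam_self, dfam_self]
    · rw [dfam_ne _ hj, dfam_ne (fun p : Σ i, J i => z p.1 p.2)]
      simpa using hj
  · rw [Function.update_of_ne hi']
    refine Eq.trans ?_ qval_one
    refine congrArg₂ (fun s v => qval s (g i').1 v) (funext (h1 i' hi')) (funext fun j' => ?_)
    exact dfam_ne (fun p : Σ i, J i => z p.1 p.2) fun h' => hi' (congrArg Sigma.fst h')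

/-- The differentials of the intermediate complexes occur in `d f` and in the `d (g i)` with
opposite signs; what survives are the differentials of the target and of the arguments. -/
lemma dP_comp {N : ℤ} (h : n + ∑ i, m i = N) (h' : N + 1 = N') (f : Op I y x n)
    (g : ∀ i, Op (J i) (z i) (y i) (m i)) (h1 : n + 1 + ∑ i, m i = N')
    (h2 : ∀ i, n + ∑ j, Function.update m i (m i + 1) j = N') :
    dP N N' h' (comp n m N h f g) = comp (n + 1) m N' h1 (dP n (n + 1) rfl f) g +
      ∑ i, Int.negOnePow (n + ∑ j with j < i, m j) •
        comp n (Function.update m i (m i + 1)) N' (h2 i) f ((complexes C).dAt i g) := by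
  have hN : n + (∑ i, m i) + 1 = N' := by rw [h, h']
  have hp : pOp h' (comp n m N h f g) = comp (n + 1) m N' h1 (pOp rfl f) g :=
    Subtype.ext (pval_cval x.dOp.1 f.2 fun i => (g i).2)
  have hq := fun i j => qOp_comp hN h h' f g i j
  have e1 : comp (n + 1) m N' h1 (dP n (n + 1) rfl f) g = comp (n + 1) m N' h1 (pOp rfl f) g -
      ∑ i, Int.negOnePow (n + ∑ j with j < i, m j) • compAt hN f g i (pOp rfl (g i)) := by
    rw [dP_eq, map_sub, sub_apply, sign_smul_eq k, map_smul, smul_apply, map_sum, sum_apply,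
      ← sign_smul_eq k, Finset.smul_sum]
    simp only [comp_qOp hN, smul_smul, ← Int.negOnePow_add]
  have e2 : ∀ i, Int.negOnePow (n + ∑ j with j < i, m j) •
      comp n (Function.update m i (m i + 1)) N' (h2 i) f ((complexes C).dAt i g) =
        Int.negOnePow (n + ∑ j with j < i, m j) • compAt hN f g i (pOp rfl (g i)) -
        Int.negOnePow (N + ∑ j with i < j, m j) • ∑ j, compAt hN f g i (qOp rfl j (g i)) := by
    intro i
    rw [comp_dAt hN, dP_eq, map_sub, map_sign_smul, map_sum, smul_sub, smul_smul,
      ← Int.negOnePow_add, ← h, sum_lt_add_sum_gt i m]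
    -- `N` already contains the degrees after `i`; adding them once more leaves `n + ∑_{j < i} m j +
    -- m i` modulo `2`.
    refine congrArg₂ _ rfl (congrArg (fun s : ℤˣ => s • _) (negOnePow_congr ?_))
    exact ⟨-∑ j with i < j, m j, by ring⟩
  rw [e1, Finset.sum_congr rfl fun i _ => e2 i, dP_eq, hp, Fintype.sum_sigma,
    Finset.sum_sub_distrib, sub_add_sub_cancel, Finset.smul_sum]
  refine congrArg₂ _ rfl (Finset.sum_congr rfl fun i _ => ?_)
  rw [Finset.sum_congr rfl fun j _ => hq i j, ← Finset.smul_sum, smul_smul, Int.negOnePow_add]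

end

variable (C) in
lemma lawful : (complexes C).Lawful where
  d_d n n' n'' h h' f := dP_dP h h' f
  map_refl n f := Subtype.ext (mval_refl f.1)
  map_trans e e' _ _ n f := Subtype.ext (mval_trans e e' f.1)
  d_map e _ _ n n' h f := dP_mapOp e h f
  d_id x := dP_one x
  d_comp n m N N' h h' f g := dP_comp h h' f g _ _
  comp_map_right e _ _ _ n m N h f g := Subtype.ext (cval_mval_right e fun i => (g i).2)
  comp_map_left e _ _ _ _ _ _ _ n m N h h' f g := Subtype.ext (cval_mval_left e fun i => (g i).2)
  assoc n m r N N' M hN hN' hM hMN f g h := by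
    obtain rfl : (fun i => m i + ∑ j, r i j) = M := funext hM
    exact Subtype.ext (cval_assoc (fun i => (g i).2) fun i j => (h i j).2)
  id_comp n f := Subtype.ext ((mval_unitSigma f.2).trans pval_one)
  comp_id n f := Subtype.ext ((mval_sigmaUnit fun i => (Cx.one _).2).trans qval_one)

end Cx

/-! ### Evaluation of operations at chains of simplices -/

section evaluation

variable {C : PTCat.{u, v, w} k} (B : CosimplicialLie C)

/-- The term `B^a` of a cosimplicial Lie algebra. -/
abbrev CosimplicialLie.term (a : ℕ) : C.Ob := (B.lie ⦋a⦌).carrier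

open Classical in
/-- The operation `B(σ)` defined by a simplex `σ`, as a family with a single non-zero member. -/
def simpOp {b : ℕ} (σ : Simp b) : ∀ a : ℕ, C.P Unit (fun _ => B.term a) (B.term b) :=
  Pi.single σ.1 (B.mor σ.2)

lemma simpOp_self {b l : ℕ} (p : ⦋l⦌ ⟶ ⦋b⦌) : simpOp B (⟨l, p⟩ : Simp b) l = B.mor p := by
  simp [simpOp]

lemma simpOp_ne {b : ℕ} (σ : Simp b) {a : ℕ} (h : σ.1 ≠ a) : simpOp B σ a = 0 := by
  simp [simpOp, h.symm]

lemma simpOp_push {b b' : ℕ} (θ : ⦋b⦌ ⟶ ⦋b'⦌) (σ : Simp b) (a : ℕ) :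
    simpOp B (Simp.push θ σ) a = C.post (B.mor θ) (simpOp B σ a) := by
  obtain ⟨l, p⟩ := σ
  by_cases h : l = a
  · subst h
    rw [simpOp_self, Simp.push, simpOp_self]
    exact B.mor_comp p θ
  · rw [simpOp_ne B _ h, simpOp_ne, C.post_zero]
    exact h

/-- The linear extension of `simpOp`. -/
def chainOp (b : ℕ) : ZChains k b →ₗ[k] ∀ a : ℕ, C.P Unit (fun _ => B.term a) (B.term b) :=
  Finsupp.linearCombination k (simpOp B)

lemma chainOp_single {b : ℕ} (σ : Simp b) : chainOp B b (Finsupp.single σ 1) = simpOp B σ := by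
  simp [chainOp]

lemma MB_d_succ (b : ℕ) :
    (MB B).d b (b + 1) = ∑ s : Fin (b + 2), (-1 : k) ^ (s : ℕ) • B.mor (SimplexCategory.δ s) := by
  have h1 : (MB B).d b (b + 1) =
      AlgebraicTopology.AlternatingCofaceMapComplex.objD B.toCosimplicial b :=
    CochainComplex.of_d (fun n => B.toCosimplicial.obj ⦋n⦌)
      (AlgebraicTopology.AlternatingCofaceMapComplex.objD B.toCosimplicial) b
  rw [h1]
  refine Finset.sum_congr rfl fun s _ => ?_
  refine Eq.trans ?_ (Int.cast_smul_eq_zsmul k ((-1) ^ (s : ℕ)) (B.mor (SimplexCategory.δ s))).symm |>.trans ?_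
  · rfl
  · simp

lemma MB_d_ne {a b : ℕ} (h : a + 1 ≠ b) : (MB B).d a b = 0 :=
  (MB B).d_eq_zero a b fun h' => h (by
    have h2 : (b : ℤ) = (a : ℤ) + 1 := h'
    exact_mod_cast h2.symm)

/-- The faces of `σ` are the cofaces followed by `σ`, and `MB` has the alternating sum of the
cofaces as differential, so this is functoriality of `B`. For a vertex, both sides vanish because
nothing maps to the term of degree `0`. -/
lemma chainOp_bdry {b : ℕ} (σ : Simp b) (a : ℕ) :
    chainOp B b (Simp.bdry σ) a = C.post (B.mor σ.2) ((MB B).d a σ.1) := by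
  obtain ⟨l, p⟩ := σ
  cases l with
  | zero =>
    rw [MB_d_ne B (Nat.succ_ne_zero a)]
    exact (C.post_zero _).symm
  | succ l =>
    have h1 : chainOp B b (Simp.bdry (⟨l + 1, p⟩ : Simp b)) =
        ∑ s : Fin (l + 2), (-1 : k) ^ (s : ℕ) • simpOp B (⟨l, SimplexCategory.δ s ≫ p⟩ : Simp b) := by
      simp [Simp.bdry, chainOp]
    rw [h1, Finset.sum_apply]
    simp only [Pi.smul_apply]
    by_cases h : a = l
    · subst h
      simp only [simpOp_self]
      have h2 : C.post (B.mor p) ((MB B).d a (a + 1)) =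
          C.postₗ (fun _ => B.term a) (B.term (a + 1)) (B.term b) (B.mor p)
            (∑ s : Fin (a + 2), (-1 : k) ^ (s : ℕ) • B.mor (SimplexCategory.δ s)) :=
        congrArg (C.post (B.mor p)) (MB_d_succ B a)
      refine Eq.trans ?_ h2.symm
      rw [map_sum]
      refine Finset.sum_congr rfl fun s _ => ?_
      rw [map_smul]
      exact congrArg _ (B.mor_comp _ _)
    · rw [MB_d_ne B (fun h' => h (by simpa using h'))]
      refine Eq.trans ?_ (C.post_zero _).symm
      refine Finset.sum_eq_zero fun s _ => ?_
      rw [simpOp_ne B _ (Ne.symm h), smul_zero]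

variable {I : Type} [Fintype I] [LinearOrder I] [Nonempty I] {b : ℕ}

/-- The evaluation of an operation at tensors of simplices. -/
def ev (θ : C.P I (fun _ => B.term b) (B.term b)) :
    ZTens k I b →ₗ[k] ∀ a : I → ℕ, C.P I (fun i => B.term (a i)) (B.term b) :=
  Finsupp.linearCombination k fun p a => C.pre θ (fun i => simpOp B (p i) (a i))

lemma ev_single (θ : C.P I (fun _ => B.term b) (B.term b)) (p : I → Simp b) (a : I → ℕ) :
    ev B θ (Finsupp.single p 1) a = C.pre θ (fun i => simpOp B (p i) (a i)) := by
  simp [ev]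

/-- To prove a linear statement for all tensors it suffices to prove it for tensors of simplices. -/
lemma ztens_induction {M : Type*} [AddCommGroup M] [Module k M] {J : Type}
    (L L' : ZTens k J b →ₗ[k] M) (h : ∀ p, L (Finsupp.single p 1) = L' (Finsupp.single p 1))
    (x : ZTens k J b) : L x = L' x := by
  congr 1
  exact Finsupp.lhom_ext' fun p => LinearMap.ext_ring (h p)

/-- Presents the sum defining `entry` as the value of a linear map at a chain, so that identities
can be tested on tensors of simplices. -/
lemma ev_apply (θ : C.P I (fun _ => B.term b) (B.term b)) (x : ZTens k I b) (a : I → ℕ) :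
    ev B θ x a = ∑ p : ∀ i, (⦋a i⦌ ⟶ ⦋b⦌), x (fun i => ⟨a i, p i⟩) •
      C.pre θ (fun i => B.mor (p i)) := by
  have h := ztens_induction ((LinearMap.proj a).comp (ev B θ))
    (∑ p : ∀ i, (⦋a i⦌ ⟶ ⦋b⦌), ((Finsupp.lapply (R := k) (fun i => (⟨a i, p i⟩ : Simp b))).smulRight
      (C.pre (z := fun i => B.term (a i)) θ (fun i => B.mor (p i))))) ?_ x
  · simpa using h
  intro q
  simp only [LinearMap.comp_apply, LinearMap.proj_apply, ev_single, LinearMap.sum_apply,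
    LinearMap.smulRight_apply, Finsupp.lapply_apply]
  by_cases hq : ∀ i, (q i).1 = a i
  · obtain rfl : (fun i => (q i).1) = a := funext hq
    rw [Finset.sum_eq_single (fun i => (q i).2)]
    · have : (fun i => (⟨(q i).1, (q i).2⟩ : Simp b)) = q := rfl
      rw [this, Finsupp.single_eq_same, one_smul]
      exact congrArg (C.pre θ) (funext fun i => simpOp_self B (q i).2)
    · intro p _ hp
      rw [Finsupp.single_eq_of_ne, zero_smul]
      intro h
      refine hp (funext fun i => ?_)
      have := congrFun h i
      exact eq_of_heq (Sigma.mk.inj_iff.1 this).2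
    · simp
  · push Not at hq
    obtain ⟨i, hi⟩ := hq
    rw [C.pre_zero _ _ i (simpOp_ne B _ hi)]
    refine (Finset.sum_eq_zero fun p _ => ?_).symm
    rw [Finsupp.single_eq_of_ne, zero_smul]
    rintro rfl
    exact hi rfl

/-- The generator `id_[b]` of `Z([b])`. -/
abbrev idChain (k : Type u) [Field k] (b : ℕ) : ZChains k b := Finsupp.single ⟨b, 𝟙 ⦋b⦌⟩ 1

/-- Yoneda: a simplex is the image of an identity under itself, so naturality determines `φ` by its
values at the identities. -/
lemma zhom_single {J : Type} [Fintype J] {n : ℤ} (φ : ZHom k J n) (σ : Simp b) :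
    φ.1 b (Finsupp.single σ 1) = zPushTens J σ.2 (φ.1 σ.1 (idChain k σ.1)) := by
  have h := LinearMap.congr_fun (φ.2.1 σ.1 b σ.2) (idChain k σ.1)
  rw [LinearMap.comp_apply, LinearMap.comp_apply, zPush_single] at h
  rw [← h]
  simp [Simp.push]

lemma opOf_apply (ψ : Lie k I) {n : ℤ} (φ : ZHom k I n) (a : I → ℕ) (b : ℕ) :
    (opOf B ψ φ).1 a b = ev B ((B.lie ⦋b⦌).act I ψ) (φ.1 b (idChain k b)) a :=
  (ev_apply B _ _ _).symm

/-- Here it enters that `B(θ)` is a morphism of Lie algebras: applied to every argument of `ψ`, it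
can be pulled out to the left. -/
lemma ev_push {b' : ℕ} (θ : ⦋b⦌ ⟶ ⦋b'⦌) (ψ : Lie k I) (x : ZTens k I b) (a : I → ℕ) :
    ev B ((B.lie ⦋b'⦌).act I ψ) (zPushTens I θ x) a =
      C.post (B.mor θ) (ev B ((B.lie ⦋b⦌).act I ψ) x a) := by
  refine ztens_induction (J := I) ((LinearMap.proj a).comp ((ev B ((B.lie ⦋b'⦌).act I ψ)).comp
    (zPushTens I θ))) ((C.postₗ (fun i => B.term (a i)) (B.term b) (B.term b') (B.mor θ)).comp
      ((LinearMap.proj a).comp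
      (ev B ((B.lie ⦋b⦌).act I ψ)))) (fun p => ?_) x
  simp only [LinearMap.comp_apply, LinearMap.proj_apply, zPushTens_single, ev_single,
    C.postₗ_apply, simpOp_push]
  rw [← C.pre_pre, ← B.mor_lie, C.post_pre]

lemma ev_zPerm {I' : Type} [Fintype I'] [Nonempty I'] [LinearOrder I'] (e : I ≃ I')
    (θ : C.P I (fun _ => B.term b) (B.term b)) (x : ZTens k I b) (a : I' → ℕ) :
    ev B (C.map (y := fun _ => B.term b) e θ) (zPerm e b x) a =
      permSign e (fun i => (a (e i) : ℤ)) • C.map (y := fun i => B.term (a i)) e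
        (ev B θ x (fun i => a (e i))) := by
  rw [sign_smul_eq k]
  refine ztens_induction ((LinearMap.proj a).comp ((ev B (C.map (y := fun _ => B.term b) e θ)).comp
    (zPerm e b))) (((permSign e (fun i => (a (e i) : ℤ)) : ℤ) : k) •
      (C.map (y := fun i => B.term (a i)) e).comp ((LinearMap.proj fun i => a (e i)).comp
      (ev B θ))) (fun p => ?_) x
  simp only [LinearMap.comp_apply, LinearMap.proj_apply, LinearMap.smul_apply, zPerm,
    Finsupp.linearCombination_single, one_smul, map_sign_smul, ev_single]
  rw [← sign_smul_eq k]
  by_cases hp : ∀ i, (p i).1 = a (e i)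
  · simp only [hp]
    refine congrArg _ ((C.pre_map (y := fun _ => B.term b) (y' := fun i => B.term (a i)) e θ
      (fun i => simpOp B (p (e.symm i)) (a i))).trans (congrArg (C.map (y := fun i => B.term (a i)) e)
      (congrArg (C.pre θ) (funext fun i => ?_))))
    rw [e.symm_apply_apply]
  · push Not at hp
    obtain ⟨i, hi⟩ := hp
    rw [C.pre_zero _ _ (e i), C.pre_zero _ _ i (simpOp_ne B _ hi), map_zero, smul_zero, smul_zero]
    rw [e.symm_apply_apply]
    exact simpOp_ne B _ hi

variable {J : I → Type} [∀ i, Fintype (J i)] [∀ i, LinearOrder (J i)] [∀ i, Nonempty (J i)]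

lemma zTensor_single (v : ∀ i, J i → Simp b) :
    zTensor k J b (fun i => Finsupp.single (v i) 1) =
      Finsupp.single (fun p => v p.1 p.2) 1 := by
  classical
  ext p
  rw [zTensor_apply, Finsupp.single_apply]
  simp only [Finsupp.single_apply]
  split_ifs with h
  · subst h
    simp
  · by_contra hne
    have h2 := fun i => Finset.prod_ne_zero_iff.1 hne i (Finset.mem_univ i)
    refine h (funext fun p => ?_)
    have := h2 p.1
    rw [ne_eq, ite_eq_right_iff, not_forall] at this
    exact congrFun this.1 p.2

/-- Both sides are polylinear in `x`, and on tensors of simplices the claim is `pre_comp`. -/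
lemma ev_zTensor (θ : C.P I (fun _ => B.term b) (B.term b))
    (θ' : ∀ i, C.P (J i) (fun _ => B.term b) (B.term b)) (x : ∀ i, ZTens k (J i) b)
    (a : (Σ i, J i) → ℕ) :
    ev B (C.comp (z := fun _ _ => B.term b) θ θ') (zTensor k J b x) a =
      C.comp (z := fun i j => B.term (a ⟨i, j⟩)) θ
        (fun i => ev B (θ' i) (x i) (fun j => a ⟨i, j⟩)) := by
  classical
  have key : ((LinearMap.proj a).comp (ev B (C.comp (z := fun _ _ => B.term b) θ θ'))
      ).compMultilinearMap (zTensor k J b) =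
      (C.comp (z := fun i j => B.term (a ⟨i, j⟩)) θ).compLinearMap
        (fun i => (LinearMap.proj fun j => a ⟨i, j⟩).comp (ev B (θ' i))) := by
    refine Module.Basis.ext_multilinear
      (fun i => Finsupp.basisSingleOne (R := k) (ι := J i → Simp b)) fun v => ?_
    simp only [LinearMap.compMultilinearMap_apply, Finsupp.coe_basisSingleOne, zTensor_single,
      MultilinearMap.compLinearMap_apply, LinearMap.comp_apply, LinearMap.proj_apply, ev_single]
    exact C.pre_comp (z' := fun i j => B.term (a ⟨i, j⟩)) θ θ'
      (fun i j => simpOp B (v i j) (a ⟨i, j⟩))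
  exact congrArg (fun L => L x) key

end evaluation

lemma shuffleSign_neg_right {I : Type} [Fintype I] [LinearOrder I] (r A : I → ℤ) :
    shuffleSign r (fun i => -A i) = shuffleSign r A := by
  simp only [shuffleSign_eq, neg_mul, Int.negOnePow_neg]

/-- The composition with fixed operations `g i`, as a linear map. -/
def PTCat.compWith (C : PTCat.{u, v, w} k) {I : Type} [Finite I] [Nonempty I] {J : I → Type}
    [∀ i, Finite (J i)] [∀ i, Nonempty (J i)] {z : ∀ i, J i → C.Ob} {y : I → C.Ob} (x : C.Ob)
    (g : ∀ i, C.P (J i) (z i) (y i)) :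
    C.P I y x →ₗ[k] C.P (Σ i, J i) (fun p => z p.1 p.2) x where
  toFun f := C.comp f g
  map_add' f f' := by rw [map_add, add_apply]
  map_smul' r f := by rw [map_smul, smul_apply, RingHom.id_apply]

lemma multilinear_tensor_ext {ι : Type*} [Finite ι] {A B : ι → Type*} [∀ i, AddCommGroup (A i)]
    [∀ i, Module k (A i)] [∀ i, AddCommGroup (B i)] [∀ i, Module k (B i)] {M : Type*}
    [AddCommGroup M] [Module k M] {T T' : MultilinearMap k (fun i => A i ⊗[k] B i) M}
    (h : ∀ (x : ∀ i, A i) (y : ∀ i, B i), T (fun i => x i ⊗ₜ y i) = T' (fun i => x i ⊗ₜ y i)) :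
    T = T' := by
  refine Module.Basis.ext_multilinear (fun i => (Module.Basis.ofVectorSpace k (A i)).tensorProduct
    (Module.Basis.ofVectorSpace k (B i))) fun v => ?_
  simp only [Module.Basis.tensorProduct_apply']
  exact h _ _

/-- The composition with fixed unary operations `h i`, as a linear map. -/
def PTCat.preWith (C : PTCat.{u, v, w} k) {I : Type} [Finite I] [Nonempty I] {z y : I → C.Ob}
    (x : C.Ob) (h : ∀ i, C.P Unit (fun _ => z i) (y i)) : C.P I y x →ₗ[k] C.P I z x :=
  (C.map (y := z) (sigmaUnit I)).comp (C.compWith (J := fun _ => Unit) (z := fun i _ => z i) x h)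

/-! ### The maps `F` form a pseudo-tensor functor -/

section actionFunctor

variable {C : PTCat.{u, v, w} k} (B : CosimplicialLie C)
  {I : Type} [Fintype I] [LinearOrder I] [Nonempty I]

lemma ev_zhom {n : ℤ} {b : ℕ} (ψ : Lie k I) (φ : ZHom k I n) (σ : Simp b) (a : I → ℕ) :
    ev B ((B.lie ⦋b⦌).act I ψ) (φ.1 b (Finsupp.single σ 1)) a =
      C.post (B.mor σ.2) ((opOf B ψ φ).1 a σ.1) := by
  rw [zhom_single, ev_push]
  exact congrArg _ (opOf_apply B ψ φ a σ.1).symm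

section comp

variable {J : I → Type} [∀ i, Fintype (J i)] [∀ i, LinearOrder (J i)] [∀ i, Nonempty (J i)]
  {r : I → ℤ}

lemma ev_zTensorMap_single {b : ℕ} (ψ : Lie k I) (ψ' : ∀ i, Lie k (J i))
    (φ' : ∀ i, ZHom k (J i) (r i)) (q : I → Simp b) (a : (Σ i, J i) → ℕ) :
    ev B (C.comp (z := fun _ _ => B.term b) ((B.lie ⦋b⦌).act I ψ)
        (fun i => (B.lie ⦋b⦌).act (J i) (ψ' i))) (zTensorMap r b φ' (Finsupp.single q 1)) a =
      shuffleSign r (fun i => r i - ((q i).1 : ℤ)) •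
        C.comp (z := fun i j => B.term (a ⟨i, j⟩)) ((B.lie ⦋b⦌).act I ψ)
          (fun i => C.post (B.mor (q i).2) ((opOf B (ψ' i) (φ' i)).1 (fun j => a ⟨i, j⟩) (q i).1)) := by
  rw [zTensorMap_single, map_sign_smul]
  refine (congrArg (fun f : C.P (Σ i, J i) (fun p => B.term (a p)) (B.term b) =>
    shuffleSign r (fun i => r i - ((q i).1 : ℤ)) • f) (ev_zTensor B _ _ _ a)).trans ?_
  simp only [ev_zhom]
  rfl

/-- A simplex `q i` in the value of `φ` acts as `B(q i)`, and by `ev_zhom` the value of `φ' i` at `q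
i` acts as the operation of `φ' i` followed by `B(q i)`. Both composites therefore pass through the
terms of degree `dim (q i)`. -/
lemma opOf_comp {n N : ℤ} (h : n + ∑ i, r i = N) (ψ : Lie k I) (ψ' : ∀ i, Lie k (J i))
    (φ : ZHom k I n) (φ' : ∀ i, ZHom k (J i) (r i)) :
    opOf B (lieComp ψ ψ') (zComp n r N h φ φ') =
      Cx.comp (z := fun _ _ => MB B) (y := fun _ => MB B) n r N h (opOf B ψ φ)
        (fun i => opOf B (ψ' i) (φ' i)) := by
  suffices key : ∀ (a : (Σ i, J i) → ℕ) (b : ℕ),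
      (opOf B (lieComp ψ ψ') (zComp n r N h φ φ')).1 a b =
        Cx.cval r (opOf B ψ φ).1 (fun i => (opOf B (ψ' i) (φ' i)).1) a b from
    Subtype.ext (funext fun a => funext fun b => key a b)
  intro a b
  refine (opOf_apply B _ _ a b).trans ?_
  have hact : (B.lie ⦋b⦌).act (Σ i, J i) (lieComp ψ ψ') =
      C.comp (z := fun _ _ => B.term b) ((B.lie ⦋b⦌).act I ψ)
        (fun i => (B.lie ⦋b⦌).act (J i) (ψ' i)) :=
    (B.lie ⦋b⦌).op_comp (J := J) (z := fun _ _ => ()) (y := fun _ => ()) (x := ()) ψ ψ'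
  rw [hact]
  change ev B (C.comp (z := fun _ _ => B.term b) ((B.lie ⦋b⦌).act I ψ)
      (fun i => (B.lie ⦋b⦌).act (J i) (ψ' i))) (zTensorMap r b φ' (φ.1 b (idChain k b))) a = _
  -- `c i` is the degree in which the operation of `φ' i` lands. It may be negative, where `MB` has
  -- no term; then both sides vanish.
  by_cases hc : ∀ i, ∃ c : ℕ, (c : ℤ) = ∑ j, (a ⟨i, j⟩ : ℤ) + r i
  · choose c hc using hc
    refine Eq.trans ?_ (Cx.cval_of (z := fun _ _ => MB B) (y := fun _ => MB B) (x := MB B)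
      (f := (opOf B ψ φ).1) (fun i => (opOf B (ψ' i) (φ' i)).2) b c hc).symm
    let G : C.P I (fun i => B.term (c i)) (B.term b) →ₗ[k]
        C.P (Σ i, J i) (fun p => B.term (a p)) (B.term b) :=
      C.compWith (z := fun i j => B.term (a ⟨i, j⟩)) (B.term b)
        (fun i => (opOf B (ψ' i) (φ' i)).1 (fun j => a ⟨i, j⟩) (c i))
    -- The value of `φ` at the identity is replaced by an arbitrary chain, in which both sides are
    -- linear.
    suffices key : ∀ x : ZTens k I b, ev B (C.comp (z := fun _ _ => B.term b)
        ((B.lie ⦋b⦌).act I ψ) (fun i => (B.lie ⦋b⦌).act (J i) (ψ' i))) (zTensorMap r b φ' x) a =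
        shuffleSign r (fun i => ∑ j, (a ⟨i, j⟩ : ℤ)) • G (ev B ((B.lie ⦋b⦌).act I ψ) x c) from
      (key _).trans (congrArg (fun f => shuffleSign r (fun i => ∑ j, (a ⟨i, j⟩ : ℤ)) • G f)
        (opOf_apply B ψ φ c b).symm)
    intro x
    rw [sign_smul_eq k]
    refine ztens_induction (J := I) ((LinearMap.proj a).comp ((ev B _).comp (zTensorMap r b φ')))
      (((shuffleSign r (fun i => ∑ j, (a ⟨i, j⟩ : ℤ)) : ℤ) : k) • G.comp
        ((LinearMap.proj c).comp (ev B ((B.lie ⦋b⦌).act I ψ)))) (fun q => ?_) x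
    refine (ev_zTensorMap_single B ψ ψ' φ' q a).trans ?_
    simp only [LinearMap.smul_apply, LinearMap.comp_apply, LinearMap.proj_apply, ev_single]
    rw [← sign_smul_eq k]
    by_cases hq : ∀ i, (q i).1 = c i
    · obtain rfl : (fun i => (q i).1) = c := funext hq
      -- The degree of `φ' i (q i)` is minus the sum of the degrees of the arguments, so the sign
      -- rules of the two sides agree, only parities being relevant.
      have h1 : (fun i => r i - ((q i).1 : ℤ)) = fun i => -∑ j, (a ⟨i, j⟩ : ℤ) := by
        funext i
        have : ((q i).1 : ℤ) = ∑ j, (a ⟨i, j⟩ : ℤ) + r i := hc i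
        omega
      rw [h1, shuffleSign_neg_right]
      refine congrArg _ ((C.comp_pre (z := fun i j => B.term (a ⟨i, j⟩)) _ _ _).symm.trans ?_)
      refine congrArg G (congrArg _ (funext fun i => ?_))
      exact (simpOp_self B (q i).2).symm
    · push Not at hq
      obtain ⟨i, hi⟩ := hq
      rw [MultilinearMap.map_coord_zero _ i, C.pre_zero _ _ i (simpOp_ne B _ hi), map_zero,
        smul_zero, smul_zero]
      refine (congrArg (C.post _) ((opOf B (ψ' i) (φ' i)).2 _ _ fun h' => hi ?_)).trans
        (C.post_zero _)
      have h2 : ((q i).1 : ℤ) = ∑ j, (a ⟨i, j⟩ : ℤ) + r i := h'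
      have := hc i
      omega
  · push Not at hc
    obtain ⟨i, hi⟩ := hc
    refine Eq.trans ?_ (Cx.cval_zero (z := fun _ _ => MB B) (y := fun _ => MB B) (x := MB B)
      (f := (opOf B ψ φ).1) (fun i => (opOf B (ψ' i) (φ' i)).2) b i hi).symm
    refine (ztens_induction (J := I) ((LinearMap.proj a).comp ((ev B _).comp (zTensorMap r b φ')))
      0 (fun q => ?_) _)
    refine (ev_zTensorMap_single B ψ ψ' φ' q a).trans ?_
    rw [MultilinearMap.map_coord_zero _ i, smul_zero]
    · rfl
    · exact (congrArg (C.post _) ((opOf B (ψ' i) (φ' i)).2 _ _ (hi _))).trans (C.post_zero _)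

end comp

lemma opOf_zMap {I' : Type} [Fintype I'] [LinearOrder I'] [Nonempty I'] (e : I ≃ I') {n : ℤ}
    (ψ : Lie k I) (φ : ZHom k I n) :
    opOf B (lieMap e ψ) (zMap e n φ) = Cx.mapOp (y := fun _ => MB B) e n (opOf B ψ φ) := by
  suffices key : ∀ (a : I' → ℕ) (b : ℕ), (opOf B (lieMap e ψ) (zMap e n φ)).1 a b =
      permSign e (fun i => (a (e i) : ℤ)) •
        C.map (y := fun i => B.term (a i)) e ((opOf B ψ φ).1 (fun i => a (e i)) b) from
    Subtype.ext (funext fun a => funext fun b => key a b)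
  intro a b
  refine (opOf_apply B _ _ a b).trans ?_
  have hact : (B.lie ⦋b⦌).act I' (lieMap e ψ) =
      C.map (y := fun _ => B.term b) e ((B.lie ⦋b⦌).act I ψ) :=
    (B.lie ⦋b⦌).op_map e (y := fun _ => ()) (x := ()) ψ
  rw [hact]
  refine (ev_zPerm B e _ (φ.1 b (idChain k b)) a).trans ?_
  exact congrArg (fun f => permSign e (fun i => (a (e i) : ℤ)) •
    C.map (y := fun i => B.term (a i)) e f) (opOf_apply B ψ φ _ b).symm

lemma opOf_one : opOf B lieOne zOne = (MB B).one := by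
  suffices key : ∀ (a : Unit → ℕ) (b : ℕ), (opOf B lieOne zOne).1 a b = (MB B).one.1 a b from
    Subtype.ext (funext fun a => funext fun b => key a b)
  intro a b
  refine (opOf_apply B _ _ a b).trans ?_
  have hact : (B.lie ⦋b⦌).act Unit lieOne = C.id (B.term b) := (B.lie ⦋b⦌).op_id ()
  rw [hact]
  have h1 : (zOne : ZHom k Unit 0).1 b (idChain k b) =
      Finsupp.single (fun _ : Unit => (⟨b, 𝟙 ⦋b⦌⟩ : Simp b)) 1 := by
    simp [zOne]
  rw [h1, ev_single]
  refine (C.pre_unit (C.id (B.term b)) (simpOp B ⟨b, 𝟙 ⦋b⦌⟩ (a ()))).trans ?_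
  refine (C.post_id _).trans ?_
  by_cases h : a () = b
  · obtain rfl : a = fun _ => b := funext fun _ => h
    rw [simpOp_self, B.mor_id]
    exact (Cx.one_apply_self (MB B) (fun _ => b)).symm
  · rw [simpOp_ne B _ (fun h' => h h'.symm)]
    exact (Cx.one_apply_ne (MB B) a b h).symm

section differential

/-- The faces of `id_[b]` are the cofaces, so the term `φ ∘ d` of `D φ` becomes composition with the
differential of the target. -/
lemma ev_bdry {b : ℕ} {n : ℤ} (ψ : Lie k I) (φ : ZHom k I n) (a : I → ℕ) :
    ev B ((B.lie ⦋b⦌).act I ψ) (φ.1 b (Simp.bdry (⟨b, 𝟙 ⦋b⦌⟩ : Simp b))) a =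
      Cx.pval (MB B).dOp.1 (opOf B ψ φ).1 a b := by
  have h0 : ∀ c : ℕ, c + 1 ≠ b → C.post ((MB B).dOp.1 (fun _ => c) b) ((opOf B ψ φ).1 a c) = 0 :=
    fun c hc => (congrArg (fun h => C.post h ((opOf B ψ φ).1 a c)) (MB_d_ne B hc)).trans
      (C.zero_post _)
  cases b with
  | zero =>
    refine Eq.trans ?_ (finsum_eq_zero_of_forall_eq_zero fun c => h0 c (Nat.succ_ne_zero c)).symm
    simp [Simp.bdry]
    rfl
  | succ l =>
    refine Eq.trans ?_ (finsum_eq_single _ l fun c hc => h0 c (by omega)).symm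
    have h2 : C.post ((MB B).dOp.1 (fun _ => l) (l + 1)) ((opOf B ψ φ).1 a l) =
        (C.postₗ (fun i => B.term (a i)) (B.term l) (B.term (l + 1))).flip ((opOf B ψ φ).1 a l)
          (∑ s : Fin (l + 2), (-1 : k) ^ (s : ℕ) • B.mor (SimplexCategory.δ s)) :=
      congrArg (fun h => C.post h ((opOf B ψ φ).1 a l)) (MB_d_succ B l)
    refine Eq.trans ?_ h2.symm
    rw [map_sum]
    simp only [Simp.bdry, Category.comp_id, map_sum, Finset.sum_apply]
    refine Finset.sum_congr rfl fun s _ => ?_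
    rw [map_smul, ← mul_one ((-1 : k) ^ (s : ℕ)), ← smul_eq_mul, ← Finsupp.smul_single, map_smul,
      map_smul, smul_eq_mul, mul_one]
    exact congrArg (fun f => (-1 : k) ^ (s : ℕ) • f)
      (ev_zhom B ψ φ (⟨l, SimplexCategory.δ s⟩ : Simp (l + 1)) a)

lemma ev_update {b : ℕ} (θ : C.P I (fun _ => B.term b) (B.term b)) (p : I → Simp b) (j : I)
    (z : ZChains k b) (a : I → ℕ) :
    ev B θ (Finsupp.lmapDomain k k (fun σ => Function.update p j σ) z) a =
      C.pre θ (Function.update (fun i => simpOp B (p i) (a i)) j (chainOp B b z (a j))) := by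
  have key : ((LinearMap.proj a).comp (ev B θ)).comp
      (Finsupp.lmapDomain k k (fun σ => Function.update p j σ)) =
      ((C.preₗ (fun _ => B.term b) (fun i => B.term (a i)) (B.term b) θ).toLinearMap
        (fun i => simpOp B (p i) (a i)) j).comp ((LinearMap.proj (a j)).comp (chainOp B b)) := by
    refine Finsupp.lhom_ext' fun σ => LinearMap.ext_ring ?_
    simp only [LinearMap.comp_apply, LinearMap.proj_apply, Finsupp.lsingle_apply,
      Finsupp.lmapDomain_apply, Finsupp.mapDomain_single, ev_single, chainOp_single]
    refine congrArg (C.pre θ) (funext fun i => ?_)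
    by_cases h : i = j
    · subst h
      simp
    · simp [h]
  exact LinearMap.congr_fun key z

lemma qval_dfam (f : Cx.Fam I (fun _ => MB B) (MB B)) (i : I) (a : I → ℕ) (b : ℕ) :
    Cx.qval (indDeg i) f (Cx.dfam (fun _ => MB B) i) a b =
      Int.negOnePow (∑ j with j < i, (a j : ℤ)) •
        C.pre (z := fun j => B.term (a j)) (f (fun j => a j + if j = i then 1 else 0) b)
          (fun j => Cx.dfam (fun _ => MB B) i j (fun _ => a j) (a j + if j = i then 1 else 0)) := by
  refine (Cx.qval_of (y := fun _ => MB B) (x := MB B) (f := f) (Cx.dfam_mem (fun _ => MB B) i) (a := a) b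
    (fun j => a j + if j = i then 1 else 0) (fun j => ?_)).trans ?_
  · change ((a j + if j = i then 1 else 0 : ℕ) : ℤ) = (a j : ℤ) + if j = i then 1 else 0
    push_cast
    rfl
  · rw [shuffleSign_indDeg_left]
    rfl

lemma post_simpOp_dfam {b : ℕ} (σ : Simp b) (i j : I) (a c : ℕ)
    (hc : c = a + if j = i then 1 else 0) :
    C.post (simpOp B σ c) (Cx.dfam (fun _ => MB B) i j (fun _ => a) c) =
      if j = i then chainOp B b (Simp.bdry σ) a else simpOp B σ a := by
  by_cases hj : j = i
  · subst hj
    rw [if_pos rfl] at hc ⊢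
    subst hc
    rw [Cx.dfam_self, chainOp_bdry]
    by_cases h : σ.1 = a + 1
    · obtain ⟨l, p⟩ := σ
      obtain rfl : l = a + 1 := h
      exact congrArg (fun f => C.post f ((MB B).d a (a + 1))) (simpOp_self B p)
    · rw [MB_d_ne B (Ne.symm h)]
      exact ((congrArg (fun f => C.post f ((MB B).d a (a + 1))) (simpOp_ne B σ h)).trans
        (C.zero_post _)).trans (C.post_zero _).symm
  · rw [if_neg hj] at hc ⊢
    obtain rfl : c = a := hc
    rw [Cx.dfam_ne _ hj]
    exact (congrArg (C.post (simpOp B σ c)) (Cx.one_apply_self (MB B) (fun _ => c))).trans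
      (C.id_post _)

/-- The counterpart of `ev_bdry`: the term `d ∘ φ` of `D φ` becomes composition with the
differentials of the arguments, since at each place a boundary acts as the differential of `MB`
(`post_simpOp_dfam`). -/
lemma ev_zDTens {b : ℕ} (θ : C.P I (fun _ => B.term b) (B.term b)) (x : ZTens k I b)
    (a : I → ℕ) :
    ev B θ (zDTens I b x) a = ∑ i, Int.negOnePow (∑ j with j < i, (a j : ℤ)) •
        C.pre (z := fun j => B.term (a j)) (ev B θ x (fun j => a j + if j = i then 1 else 0))
          (fun j => Cx.dfam (fun _ => MB B) i j (fun _ => a j) (a j + if j = i then 1 else 0)) := by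
  let G (i : I) : C.P I (fun j => B.term (a j + if j = i then 1 else 0)) (B.term b) →ₗ[k]
      C.P I (fun j => B.term (a j)) (B.term b) :=
    C.preWith (z := fun j => B.term (a j)) (B.term b)
      (fun j => Cx.dfam (fun _ => MB B) i j (fun _ => a j) (a j + if j = i then 1 else 0))
  suffices key : ev B θ (zDTens I b x) a = ∑ i, Int.negOnePow (∑ j with j < i, (a j : ℤ)) •
      G i (ev B θ x (fun j => a j + if j = i then 1 else 0)) from key
  simp only [sign_smul_eq k]
  refine (ztens_induction (J := I) ((LinearMap.proj a).comp ((ev B θ).comp (zDTens I b)))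
    (∑ i, ((Int.negOnePow (∑ j with j < i, (a j : ℤ)) : ℤ) : k) • (G i).comp
      ((LinearMap.proj (fun j => a j + if j = i then 1 else 0)).comp (ev B θ))) (fun p => ?_)
    x).trans ?_
  · simp only [LinearMap.comp_apply, LinearMap.proj_apply, LinearMap.sum_apply,
      LinearMap.smul_apply, zDTens, Finsupp.linearCombination_single, one_smul, map_sum,
      map_sign_smul, ev_single]
    refine Finset.sum_congr rfl fun i _ => ?_
    rw [← sign_smul_eq k]
    have h1 : G i (C.pre θ (fun j => simpOp B (p j) (a j + if j = i then 1 else 0))) =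
        C.pre θ (Function.update (fun j => simpOp B (p j) (a j)) i
          (chainOp B b (Simp.bdry (p i)) (a i))) := by
      refine (C.pre_pre _ _ _).trans (congrArg (C.pre θ) (funext fun j => ?_))
      refine (post_simpOp_dfam B (p j) i j (a j) _ rfl).trans ?_
      by_cases h : j = i
      · subst h
        simp
        rfl
      · simp [h]
        rfl
    rw [h1]
    change _ • ev B θ _ a = _
    rw [ev_update]
    -- The left sign counts dimensions of simplices, the right one degrees of arguments. They agree
    -- unless a place other than `i` fails to match, and then both terms are zero.
    by_cases hp : ∀ j, j ≠ i → (p j).1 = a j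
    · rw [Finset.sum_congr rfl fun j hj => by rw [hp j (Finset.mem_filter.1 hj).2.ne]]
    · push Not at hp
      obtain ⟨j, hj, hpj⟩ := hp
      rw [C.pre_zero _ _ j, smul_zero, smul_zero]
      rw [Function.update_of_ne hj, simpOp_ne B _ hpj]
  · simp only [LinearMap.comp_apply, LinearMap.proj_apply, LinearMap.sum_apply,
      LinearMap.smul_apply]

lemma opOf_zDiff {n n' : ℤ} (h : n + 1 = n') (ψ : Lie k I) (φ : ZHom k I n) :
    opOf B ψ (zDiff n n' h φ) = Cx.dP (y := fun _ => MB B) n n' h (opOf B ψ φ) := by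
  rw [Cx.dP_eq]
  suffices key : ∀ (a : I → ℕ) (b : ℕ), (opOf B ψ (zDiff n n' h φ)).1 a b =
      Cx.pval (MB B).dOp.1 (opOf B ψ φ).1 a b - Int.negOnePow n •
        ∑ i, Cx.qval (indDeg i) (opOf B ψ φ).1 (Cx.dfam (fun _ => MB B) i) a b by
    apply Subtype.ext
    funext a b
    refine (key a b).trans ?_
    have h2 : ((∑ i, Cx.qOp h i (opOf B ψ φ) : Cx.Op I (fun _ => MB B) (MB B) n').1 a b) =
        ∑ i, Cx.qval (indDeg i) (opOf B ψ φ).1 (Cx.dfam (fun _ => MB B) i) a b :=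
      (map_sum ((Cx.evalAt a b).comp (Cx.Op I (fun _ => MB B) (MB B) n').subtype) _ _)
    exact congrArg (fun f => Cx.pval (MB B).dOp.1 (opOf B ψ φ).1 a b - Int.negOnePow n • f) h2.symm
  intro a b
  refine (opOf_apply B _ _ a b).trans ?_
  have h1 : (zDiff n n' h φ).1 b (idChain k b) = φ.1 b (Simp.bdry (⟨b, 𝟙 ⦋b⦌⟩ : Simp b)) -
      Int.negOnePow n • zDTens I b (φ.1 b (idChain k b)) := by
    simp [zDiff, zD]
  rw [h1, map_sub, map_sign_smul]
  change ev B _ _ a - Int.negOnePow n • ev B _ _ a = _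
  rw [ev_bdry, ev_zDTens]
  refine congrArg₂ (fun f g : C.P I (fun i => B.term (a i)) (B.term b) => f - Int.negOnePow n • g)
    rfl (Finset.sum_congr rfl fun i _ => ?_)
  refine Eq.trans ?_ (qval_dfam B _ i a b).symm
  exact congrArg (fun f => Int.negOnePow (∑ j with j < i, (a j : ℤ)) •
    C.pre (z := fun j => B.term (a j)) f _) (opOf_apply B ψ φ _ b).symm

end differential

theorem isFunctor_F : DGPTData.IsFunctor (LieEZ k) (complexes C) (fun _ => MB B) (F B) where
  d {I _ _ _ y x} n n' h f := by
    induction f using TensorProduct.induction_on with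
    | zero => simp only [map_zero]
    | add f f' hf hf' => simp only [map_add, hf, hf']
    | tmul ψ φ => exact opOf_zDiff B h ψ φ
  map {I I' _ _ _ _ _ _} e {y x} n f := by
    induction f using TensorProduct.induction_on with
    | zero => simp only [map_zero]
    | add f f' hf hf' => simp only [map_add, hf, hf']
    | tmul ψ φ => exact opOf_zMap B e ψ φ
  id x := opOf_one B
  comp {I _ _ _ J _ _ _ z y x} n m N h f g := by
    induction f using TensorProduct.induction_on with
    | zero => simp only [map_zero, zero_apply]
    | add f f' hf hf' => simp only [map_add, add_apply, hf, hf']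
    | tmul ψ φ =>
      -- Both sides are polylinear in `g`, so each `g i` may be taken to be a pure tensor as well.
      have key : (F B (Σ i, J i) (fun p => z p.1 p.2) x N).compMultilinearMap
          ((LieEZ k).comp (z := z) (y := y) (x := x) n m N h (ψ ⊗ₜ φ)) =
          ((complexes C).comp (z := fun _ _ => MB B) (y := fun _ => MB B) (x := MB B) n m N h
            (F B I y x n (ψ ⊗ₜ φ))).compLinearMap (fun i => F B (J i) (z i) (y i) (m i)) := by
        refine multilinear_tensor_ext fun ψ' φ' => ?_
        refine (congrArg (F B (Σ i, J i) (fun p => z p.1 p.2) x N)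
          (tensorComp_tmul _ _ ψ φ ψ' φ')).trans ?_
        exact opOf_comp B h ψ ψ' φ φ'
      exact congrArg (fun L => L g) key

end actionFunctor

/-! ### Pulling the axioms back along an injective functor -/

section transport

variable {A : DGPTData.{u, v, w} k} {B : DGPTData.{u, v', w'} k} {obj : A.Ob → B.Ob}
  {F : ∀ (I : Type) [Fintype I] [LinearOrder I] [Nonempty I] (y : I → A.Ob) (x : A.Ob) (n : ℤ),
      A.P I y x n →ₗ[k] B.P I (fun i => obj (y i)) (obj x) n}

lemma apply_cast {I : Type} [Fintype I] [LinearOrder I] [Nonempty I] {y : I → A.Ob} {x : A.Ob}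
    {n n' : ℤ} (h : n = n') (f : A.P I y x n) :
    F I y x n' (A.cast h f) = B.cast h (F I y x n f) := by
  subst h
  rfl

lemma apply_dAt (hF : DGPTData.IsFunctor A B obj F) {I : Type} [LinearOrder I] {J : I → Type}
    [∀ i, Fintype (J i)] [∀ i, LinearOrder (J i)] [∀ i, Nonempty (J i)] {z : ∀ i, J i → A.Ob}
    {y : I → A.Ob} {m : I → ℤ} (i : I) (g : ∀ j, A.P (J j) (z j) (y j) (m j)) (j : I) :
    F (J j) (z j) (y j) _ (A.dAt i g j) =
      B.dAt (z := fun i j => obj (z i j)) (y := fun i => obj (y i)) i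
        (fun j => F (J j) (z j) (y j) (m j) (g j)) j := by
  unfold DGPTData.dAt
  by_cases h : j = i
  · rw [dif_pos h, dif_pos h, hF.d]
  · rw [dif_neg h, dif_neg h, apply_cast]

/-- The axioms can be checked after an injective functor. -/
theorem DGPTData.IsFunctor.lawful (hF : DGPTData.IsFunctor A B obj F) (hB : B.Lawful)
    (hinj : ∀ (I : Type) [Fintype I] [LinearOrder I] [Nonempty I] (y : I → A.Ob) (x : A.Ob)
      (n : ℤ), Function.Injective (F I y x n)) : A.Lawful where
  d_d n n' n'' h h' f := hinj _ _ _ _ (by rw [hF.d, hF.d, hB.d_d, map_zero])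
  map_refl {I _ _ _ y x} n f := hinj _ _ _ _ ((hF.map (y := y) (Equiv.refl I) n f).trans (hB.map_refl n _))
  map_trans {I I' I'' _ _ _ _ _ _ _ _ _} e e' {y x} n f := hinj _ _ _ _ (by
    refine (hF.map (y := y) (e.trans e') n f).trans ?_
    refine (hB.map_trans (y := fun i => obj (y i)) e e' n _).trans ?_
    refine (congrArg (B.map (y := fun i => obj (y i)) e' n) ?_).trans (hF.map (y := y) e' n _).symm
    exact (hF.map (y := fun i => y (e' i)) e n f).symm)
  d_map {I I' _ _ _ _ _ _} e {y x} n n' h f := hinj _ _ _ _ (by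
    rw [hF.d, hF.map, hF.map, hF.d]
    exact hB.d_map (y := fun i => obj (y i)) e n n' h _)
  d_id x := hinj _ _ _ _ (by rw [hF.d, hF.id, hB.d_id, map_zero])
  d_comp {I _ _ _ J _ _ _ z y x} n m N N' h h' f g := hinj _ _ _ _ (by
    rw [hF.d, hF.comp, map_add, hF.comp, map_sum]
    refine (hB.d_comp (z := fun i j => obj (z i j)) (y := fun i => obj (y i)) n m N N' h h' _ _).trans
      (congrArg₂ _ (by rw [hF.d]) (Finset.sum_congr rfl fun i _ => ?_))
    rw [map_sign_smul, hF.comp]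
    simp only [apply_dAt hF])
  comp_map_right {I _ _ _ J J' _ _ _ _ _ _} e {z y x} n m N h f g := hinj _ _ _ _ (by
    refine (hF.comp n m N h f _).trans ?_
    refine Eq.trans ?_ (hF.map (y := fun p : Σ i, J' i => z p.1 p.2) (Equiv.sigmaCongrRight e) N
      (A.comp n m N h f g)).symm
    refine Eq.trans ?_ ((hB.comp_map_right e (z := fun i j => obj (z i j))
      (y := fun i => obj (y i)) n m N h _ _).trans (congrArg (B.map
        (y := fun p : Σ i, J' i => obj (z p.1 p.2)) (Equiv.sigmaCongrRight e) N)
        (hF.comp n m N h f g).symm))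
    exact congrArg _ (funext fun i => hF.map (y := z i) (e i) (m i) (g i)))
  comp_map_left {I I' _ _ _ _ _ _} e {J _ _ _ z y x} n m N h h' f g := hinj _ _ _ _ (by
    rw [hF.comp, map_sign_smul, hF.map]
    refine Eq.trans ?_ (congrArg (permSign e (fun i => m (e i)) • ·) (hF.map
      (y := fun p : Σ i, J i => z p.1 p.2) (Equiv.sigmaCongrLeft e) N (A.comp (z := fun i => z (e i))
        (y := fun i => y (e i)) n (fun i => m (e i)) N h' f (fun i => g (e i)))).symm)
    refine (hB.comp_map_left e (z := fun i j => obj (z i j)) (y := fun i => obj (y i)) n m N h h'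
      _ _).trans ?_
    exact congrArg (fun f => permSign e (fun i => m (e i)) • B.map
      (y := fun p : Σ i, J i => obj (z p.1 p.2)) (Equiv.sigmaCongrLeft e) N f)
      (hF.comp (z := fun i => z (e i)) (y := fun i => y (e i)) n (fun i => m (e i)) N h' f
        (fun i => g (e i))).symm)
  assoc {I _ _ _ J _ _ _ H _ _ _ t z y x} n m r N N' M hN hN' hM hMN f g h := hinj _ _ _ _ (by
    refine (hF.map (y := fun p : Σ i, Σ j, H i j => t p.1 p.2.1 p.2.2) (Equiv.sigmaAssoc H) N'
      _).trans ?_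
    refine Eq.trans ?_ ((hB.assoc (t := fun i j l => obj (t i j l)) (z := fun i j => obj (z i j))
      (y := fun i => obj (y i)) n m r N N' M hN hN' hM hMN (F I y x n f)
      (fun i => F (J i) (z i) (y i) (m i) (g i))
      (fun i j => F (H i j) (t i j) (z i j) (r i j) (h i j))).trans ?_)
    · refine congrArg (B.map (y := fun p : Σ i, Σ j, H i j => obj (t p.1 p.2.1 p.2.2))
        (Equiv.sigmaAssoc H) N') ((hF.comp (J := fun p : Σ i, J i => H p.1 p.2)
        (z := fun p => t p.1 p.2) (y := fun p => z p.1 p.2) N (fun p => r p.1 p.2) N' hN'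
        (A.comp n m N hN f g) (fun p => h p.1 p.2)).trans ?_)
      rw [hF.comp]
    · rw [map_sign_smul]
      refine congrArg (fun f => shuffleSign m (fun i => ∑ j, r i j) • f) (Eq.trans ?_
        (hF.comp (J := fun i => Σ j, H i j) (z := fun i p => t i p.1 p.2) (y := y) n M N' hMN f
        (fun i => A.comp (J := H i) (z := t i) (y := z i) (m i) (r i) (M i) (hM i) (g i)
          (h i))).symm)
      exact congrArg _ (funext fun i => (hF.comp (J := H i) (z := t i) (y := z i) (m i) (r i) (M i)
        (hM i) (g i) (h i)).symm))
  id_comp {I _ _ _ y x} n f := hinj _ _ _ _ (by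
    refine (hF.map (y := y) (unitSigma I) n _).trans ?_
    refine (congrArg (B.map (y := fun i => obj (y i)) (unitSigma I) n)
      (hF.comp (J := fun _ => I) (z := fun _ => y) (y := fun _ => x) 0 (fun _ => n) n (by simp)
        (A.id x) (fun _ => f))).trans ?_
    rw [hF.id]
    exact hB.id_comp (y := fun i => obj (y i)) n _)
  comp_id {I _ _ _ y x} n f := hinj _ _ _ _ (by
    refine (hF.map (y := y) (sigmaUnit I) n _).trans ?_
    refine (congrArg (B.map (y := fun i => obj (y i)) (sigmaUnit I) n)
      (hF.comp (J := fun _ => Unit) (z := fun i _ => y i) (y := y) n (fun _ => 0) n (by simp)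
        f (fun i => A.id (y i)))).trans ?_
    simp only [hF.id]
    exact hB.comp_id (y := fun i => obj (y i)) n _)

end transport

/-! ### The universal cosimplicial Lie algebra and the axioms of `Lie ⊗ Z` -/

/-- The pseudo-tensor category of polylinear maps between the members of a family of vector
spaces. -/
def multilinearPT {O : Type} (X : O → Type u) [∀ o, AddCommGroup (X o)] [∀ o, Module k (X o)] :
    PTCat.{u, 0, u} k where
  Ob := O
  P I _ _ y x := MultilinearMap k (fun i => X (y i)) (X x)
  map e y x := (MultilinearMap.domDomCongrLinearEquiv' k k (fun i => X (y i)) (X x)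
    e.symm).symm.toLinearMap
  id x := MultilinearMap.ofSubsingleton k (X x) (X x) () LinearMap.id
  comp {I _ _ J _ _ z y x} :=
    { toFun f :=
        { toFun g := f.compMultilinearMap g
          map_update_add' := by
            intro _ g i a b
            ext v
            have h (c : MultilinearMap k (fun j => X (z i j)) (X (y i))) :
                (fun i' => Function.update g i c i' (Sigma.curry (γ := fun i j => X (z i j)) v i')) =
                  Function.update (fun i' => g i'
                    (Sigma.curry (γ := fun i j => X (z i j)) v i')) i (c (Sigma.curry (γ := fun i j => X (z i j)) v i)) := by
              funext i'
              by_cases hi : i' = i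
              · subst hi; simp
              · simp [hi]
            simp [h]
          map_update_smul' := by
            intro _ g i r a
            ext v
            have h (c : MultilinearMap k (fun j => X (z i j)) (X (y i))) :
                (fun i' => Function.update g i c i' (Sigma.curry (γ := fun i j => X (z i j)) v i')) =
                  Function.update (fun i' => g i'
                    (Sigma.curry (γ := fun i j => X (z i j)) v i')) i (c (Sigma.curry (γ := fun i j => X (z i j)) v i)) := by
              funext i'
              by_cases hi : i' = i
              · subst hi; simp
              · simp [hi]
            simp [h] }
      map_add' f f' := by ext; rfl
      map_smul' r f := by ext; rfl }
  map_refl f := by ext; rfl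
  map_trans e e' _ _ f := by ext; rfl
  comp_map_right _ _ _ _ _ _ := by ext; rfl
  comp_map_left _ _ _ _ _ _ _ _ _ := by ext; rfl
  assoc _ _ _ := by ext; rfl
  id_comp _ := by ext; rfl
  comp_id _ := by ext; rfl

section universalLie

/-- The value of a Lie operation at elements of a Lie algebra, as a polylinear map. -/
def lieEval {I : Type} (L : Type u) [LieRing L] [LieAlgebra k L] :
    Lie k I →ₗ[k] MultilinearMap k (fun _ : I => L) L where
  toFun ψ :=
    { toFun := fun x => FreeLieAlgebra.lift k x ψ.1
      map_update_add' := by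
        intro _ x i a b
        obtain ⟨ψ, hψ⟩ := ψ
        induction hψ using Submodule.span_induction with
        | mem ψ h =>
          obtain ⟨w, hw, rfl⟩ := h
          simp only [lift_evalWord]
          exact ((evalWord_update (k := k) x i w).2 (by rw [hw])).1 a b
        | zero => simp
        | add ψ ψ' _ _ h h' => simp only [map_add, h, h']; abel
        | smul r ψ _ h => simp only [map_smul, h, smul_add]
      map_update_smul' := by
        intro _ x i r a
        obtain ⟨ψ, hψ⟩ := ψ
        induction hψ using Submodule.span_induction with
        | mem ψ h =>
          obtain ⟨w, hw, rfl⟩ := h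
          simp only [lift_evalWord]
          exact ((evalWord_update (k := k) x i w).2 (by rw [hw])).2 r a
        | zero => simp
        | add ψ ψ' _ _ h h' => simp only [map_add, h, h', smul_add]
        | smul s ψ _ h => simp only [map_smul, h]; rw [smul_comm] }
  map_add' ψ ψ' := by ext x; exact map_add (FreeLieAlgebra.lift k x) ψ.1 ψ'.1
  map_smul' r ψ := by ext x; exact map_smul (FreeLieAlgebra.lift k x) r ψ.1

lemma lieHom_lift {I : Type} {L L' : Type*} [LieRing L] [LieAlgebra k L] [LieRing L']
    [LieAlgebra k L'] (f : L →ₗ⁅k⁆ L') (v : I → L) (x : FreeLieAlgebra k I) :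
    f (FreeLieAlgebra.lift k v x) = FreeLieAlgebra.lift k (fun i => f (v i)) x :=
  lieHom_ext (F := f.comp (FreeLieAlgebra.lift k v))
    (G := FreeLieAlgebra.lift k (fun i => f (v i))) (fun i => by simp) x

variable (k) in
/-- The free Lie algebra on countably many copies of each simplex of the standard simplex. -/
abbrev SimpLie (m : SimplexCategory) : Type u :=
  FreeLieAlgebra k (ℕ × Σ l : ℕ, (⦋l⦌ ⟶ m))

variable (k) in
/-- The Lie algebra `SimpLie k m` as a Lie algebra in a pseudo-tensor category. -/
def simpLieAlg (m : SimplexCategory) : LieAlg (multilinearPT (k := k) (SimpLie k)) where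
  obj _ := m
  op {I _ _ _ _} := lieEval (SimpLie k m)
  op_map e y x f := by
    refine MultilinearMap.ext fun v => ?_
    exact lieHom_ext (F := (FreeLieAlgebra.lift k v).comp (lieRename e))
      (G := FreeLieAlgebra.lift k (fun i => v (e i))) (fun i => by simp [lieRename]) f.1
  op_id x := by
    refine MultilinearMap.ext fun v => ?_
    exact FreeLieAlgebra.lift_of_apply _ _
  op_comp {I _ _ J _ _ z y x} f g := by
    refine MultilinearMap.ext fun v => ?_
    refine lieHom_ext (F := (FreeLieAlgebra.lift k v).comp (lieSubst (fun i => (g i).1)))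
      (G := FreeLieAlgebra.lift k (fun i => FreeLieAlgebra.lift k (fun j => v ⟨i, j⟩) (g i).1))
      (fun i => ?_) f.1
    simp only [LieHom.comp_apply, lieSubst, FreeLieAlgebra.lift_of_apply]
    exact lieHom_ext (F := (FreeLieAlgebra.lift k v).comp (lieRename (fun j => ⟨i, j⟩)))
      (G := FreeLieAlgebra.lift k (fun j => v ⟨i, j⟩)) (fun j => by simp [lieRename]) (g i).1

/-- The functoriality of `SimpLie k m` in `m`. -/
def simpLieMap {m n : SimplexCategory} (θ : m ⟶ n) : SimpLie k m →ₗ⁅k⁆ SimpLie k n :=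
  lieRename (fun p => (p.1, ⟨p.2.1, p.2.2 ≫ θ⟩))

lemma simpLieMap_of {m n : SimplexCategory} (θ : m ⟶ n) (s l : ℕ) (p : ⦋l⦌ ⟶ m) :
    simpLieMap θ (FreeLieAlgebra.of k (s, ⟨l, p⟩)) =
      FreeLieAlgebra.of k ((s, ⟨l, p ≫ θ⟩) : ℕ × Σ l : ℕ, (⦋l⦌ ⟶ n)) := by
  simp [simpLieMap, lieRename]

variable (k) in
/-- The cosimplicial Lie algebra `m ↦ SimpLie k m`. -/
def simpCosimplicialLie : CosimplicialLie (multilinearPT (k := k) (SimpLie k)) where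
  lie := simpLieAlg k
  mor {m n} θ := MultilinearMap.ofSubsingleton k (SimpLie k m) (SimpLie k n) () (simpLieMap θ).toLinearMap
  mor_id n := by
    refine MultilinearMap.ext fun v => ?_
    refine lieHom_ext (F := simpLieMap (𝟙 n)) (G := LieHom.id) (fun i => ?_) (v ())
    obtain ⟨s, l, p⟩ := i
    rw [simpLieMap_of, Category.comp_id]
    rfl
  mor_comp {l m n} θ θ' := by
    refine MultilinearMap.ext fun v => ?_
    refine lieHom_ext (F := simpLieMap (θ ≫ θ')) (G := (simpLieMap θ').comp (simpLieMap θ))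
      (fun i => ?_) (v ())
    obtain ⟨s, l, p⟩ := i
    rw [simpLieMap_of, LieHom.comp_apply, simpLieMap_of, simpLieMap_of, Category.assoc]
  mor_lie {m n} θ I _ _ ψ := by
    refine MultilinearMap.ext fun v => ?_
    exact lieHom_lift (simpLieMap θ) v ψ.1

end universalLie

section injectivity

variable {I : Type} [Fintype I]

/-- Each letter occurs in every monomial of a multilinear element. -/
lemma lift_eq_zero_of_letter {L : Type u} [LieRing L] [LieAlgebra k L] (ψ : Lie k I) (x : I → L)
    (i : I) (h : x i = 0) : FreeLieAlgebra.lift k x ψ.1 = 0 :=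
  (lieEval L ψ).map_coord_zero i h

/-- A homomorphism which recovers a Lie operation from its value at the simplices `p i`. -/
lemma exists_lieHom_single (a : I → ℕ) {b : ℕ} (p : ∀ i, (⦋a i⦌ ⟶ ⦋b⦌)) (ν : I → ℕ)
    (hν : Function.Injective ν) : ∃ f : SimpLie k ⦋b⦌ →ₗ⁅k⁆ FreeLieAlgebra k I,
      ∀ (ψ : Lie k I) (q : ∀ i, (⦋a i⦌ ⟶ ⦋b⦌)),
        f (FreeLieAlgebra.lift k (fun i => FreeLieAlgebra.of k (ν i, (⟨a i, q i⟩ : Simp b))) ψ.1) =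
          if q = p then ψ.1 else 0 := by
  classical
  -- The letter `(ν i, p i)` goes to the letter `i`, the chosen index being unambiguous as `ν` is
  -- injective, and all other letters go to `0`. If `q ≠ p`, some letter of the value is killed, and
  -- with it the whole multilinear element.
  refine ⟨FreeLieAlgebra.lift k fun s => if h : ∃ i, ν i = s.1 ∧ (⟨a i, p i⟩ : Simp b) = s.2 then
    FreeLieAlgebra.of k h.choose else 0, fun ψ q => ?_⟩
  have h1 : ∀ i, (if h : ∃ i', ν i' = ν i ∧ (⟨a i', p i'⟩ : Simp b) = ⟨a i, q i⟩ then
      FreeLieAlgebra.of k h.choose else 0) = if q i = p i then FreeLieAlgebra.of k i else 0 := by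
    intro i
    split_ifs with h h' h'
    · rw [hν h.choose_spec.1]
    · have h2 := h.choose_spec.2
      rw [hν h.choose_spec.1] at h2
      exact absurd (eq_of_heq (Sigma.mk.inj_iff.1 h2).2).symm h'
    · exact absurd ⟨i, rfl, by rw [h']⟩ h
    · rfl
  refine (lieHom_ext (F := (FreeLieAlgebra.lift k _).comp (FreeLieAlgebra.lift k fun i =>
      FreeLieAlgebra.of k (ν i, (⟨a i, q i⟩ : Simp b))))
    (G := FreeLieAlgebra.lift k (fun i => if q i = p i then FreeLieAlgebra.of k i else 0))
    (fun i => ?_) ψ.1).trans ?_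
  · simp only [LieHom.comp_apply, FreeLieAlgebra.lift_of_apply]
    exact h1 i
  · split_ifs with hq
    · subst hq
      simp only [if_true]
      exact lieHom_ext (F := FreeLieAlgebra.lift k (fun i => FreeLieAlgebra.of k i))
        (G := LieHom.id) (fun i => by simp) ψ.1
    · obtain ⟨i, hi⟩ := Function.ne_iff.1 hq
      exact lift_eq_zero_of_letter ψ _ i (if_neg hi)

lemma zhom_ext_coef {n : ℤ} {φ φ' : ZHom k I n}
    (h : ∀ (a : I → ℕ) (b : ℕ) (p : ∀ i, (⦋a i⦌ ⟶ ⦋b⦌)), coef φ a b p = coef φ' a b p) :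
    φ = φ' := by
  have h1 : ∀ b, φ.1 b (idChain k b) = φ'.1 b (idChain k b) := fun b =>
    Finsupp.ext fun q => h (fun i => (q i).1) b (fun i => (q i).2)
  apply Subtype.ext
  funext b
  refine Finsupp.lhom_ext' fun σ => LinearMap.ext_ring ?_
  simp only [LinearMap.comp_apply, Finsupp.lsingle_apply]
  rw [zhom_single φ, zhom_single φ', h1]

/-- The coefficients of an element of `Lie(I) ⊗ Z(I)`. -/
def tensorCoef {n : ℤ} (a : I → ℕ) (b : ℕ) (p : ∀ i, (⦋a i⦌ ⟶ ⦋b⦌)) :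
    Lie k I ⊗[k] ZHom k I n →ₗ[k] Lie k I :=
  (TensorProduct.rid k (Lie k I)).toLinearMap.comp (LinearMap.lTensor (Lie k I)
    { toFun := fun φ : ZHom k I n => coef φ a b p
      map_add' := fun _ _ => rfl
      map_smul' := fun _ _ => rfl })

lemma tensorCoef_tmul {n : ℤ} (a : I → ℕ) (b : ℕ) (p : ∀ i, (⦋a i⦌ ⟶ ⦋b⦌)) (ψ : Lie k I)
    (φ : ZHom k I n) : tensorCoef a b p (ψ ⊗ₜ φ) = coef φ a b p • ψ := by
  simp [tensorCoef]
  rfl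

/-- Expanded along a basis of `Lie k I`, the tensor has coordinates in `ZHom k I n`, and these are
determined by their coefficients. -/
lemma tensorCoef_injective {n : ℤ} {x : Lie k I ⊗[k] ZHom k I n}
    (h : ∀ (a : I → ℕ) (b : ℕ) (p : ∀ i, (⦋a i⦌ ⟶ ⦋b⦌)), tensorCoef a b p x = 0) : x = 0 := by
  classical
  let e := TensorProduct.equivFinsuppOfBasisLeft (R := k) (N := ZHom k I n)
    (Module.Basis.ofVectorSpace k (Lie k I))
  refine (LinearEquiv.map_eq_zero_iff e).1 (Finsupp.ext fun t => zhom_ext_coef fun a b p => ?_)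
  have key : ∀ y : Lie k I ⊗[k] ZHom k I n, coef (e y t) a b p =
      (Module.Basis.ofVectorSpace k (Lie k I)).repr (tensorCoef a b p y) t := by
    intro y
    induction y using TensorProduct.induction_on with
    | zero => simp; rfl
    | add y y' hy hy' =>
      simp only [map_add, Finsupp.add_apply, ← hy, ← hy']
      rfl
    | tmul ψ φ =>
      rw [tensorCoef_tmul]
      simp only [e, TensorProduct.equivFinsuppOfBasisLeft_apply_tmul_apply, map_smul,
        Finsupp.smul_apply, smul_eq_mul]
      exact mul_comm _ _
  rw [key, h]
  simp
  rfl

variable [LinearOrder I] [Nonempty I]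

lemma simpCosimplicialLie_pre (a : I → ℕ) {b : ℕ} (ψ : Lie k I) (q : ∀ i, (⦋a i⦌ ⟶ ⦋b⦌))
    (v : ∀ i, SimpLie k ⦋a i⦌) :
    (show MultilinearMap k (fun i => SimpLie k ⦋a i⦌) (SimpLie k ⦋b⦌) from
      (multilinearPT (k := k) (SimpLie k)).pre (((simpCosimplicialLie k).lie ⦋b⦌).act I ψ)
        (fun i => (simpCosimplicialLie k).mor (q i))) v =
      FreeLieAlgebra.lift k (fun i => simpLieMap (q i) (v i)) ψ.1 := rfl

/-- The tautological argument `(ν i, id_[a i])` is taken by `B(q i)` to the letter `(ν i, q i)`. The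
operation thus becomes a sum over `q` of Lie polynomials in different letters, from which
`exists_lieHom_single` extracts the coefficient at `p`. -/
lemma F_injective (y : I → (LieEZ k).Ob) (x : (LieEZ k).Ob) (n : ℤ) :
    Function.Injective (F (simpCosimplicialLie k) I y x n) := by
  rw [injective_iff_map_eq_zero]
  intro f hf
  refine tensorCoef_injective fun a b p => ?_
  -- Distinct arguments take their letters from distinct copies of the simplices, so they stay
  -- distinguishable when the simplices coincide.
  obtain ⟨ν, hν⟩ := Countable.exists_injective_nat I
  obtain ⟨g, hg⟩ := exists_lieHom_single (k := k) a p ν hν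
  let v (i : I) : SimpLie k ⦋a i⦌ := FreeLieAlgebra.of k (ν i, (⟨a i, 𝟙 ⦋a i⦌⟩ : Simp (a i)))
  let G : MultilinearMap k (fun i => SimpLie k ⦋a i⦌) (SimpLie k ⦋b⦌) →ₗ[k] FreeLieAlgebra k I :=
    { toFun := fun T => g (T v)
      map_add' := fun T T' => map_add g _ _
      map_smul' := fun r T => map_smul g _ _ }
  let E : Cx.Op I (fun _ => MB (simpCosimplicialLie k)) (MB (simpCosimplicialLie k)) n →ₗ[k]
      MultilinearMap k (fun i => SimpLie k ⦋a i⦌) (SimpLie k ⦋b⦌) :=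
    { toFun := fun T => T.1 a b
      map_add' := fun _ _ => rfl
      map_smul' := fun _ _ => rfl }
  have key : G.comp (E.comp (F (simpCosimplicialLie k) I y x n)) =
      (Submodule.subtype _).comp (tensorCoef a b p) := by
    refine TensorProduct.ext' fun ψ φ => ?_
    have h1 : E (F (simpCosimplicialLie k) I y x n (ψ ⊗ₜ φ)) =
        ∑ q : ∀ i, (⦋a i⦌ ⟶ ⦋b⦌), coef φ a b q •
          (show MultilinearMap k (fun i => SimpLie k ⦋a i⦌) (SimpLie k ⦋b⦌) from
            (multilinearPT (k := k) (SimpLie k)).pre (((simpCosimplicialLie k).lie ⦋b⦌).act I ψ)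
            (fun i => (simpCosimplicialLie k).mor (q i))) := rfl
    simp only [LinearMap.comp_apply]
    rw [h1, map_sum, tensorCoef_tmul]
    rw [Finset.sum_eq_single p]
    · rw [map_smul]
      change coef φ a b p • g _ = coef φ a b p • ψ.1
      rw [simpCosimplicialLie_pre]
      simp only [v, simpLieMap_of, Category.id_comp]
      rw [hg, if_pos rfl]
    · intro q _ hq
      rw [map_smul]
      change coef φ a b q • g _ = 0
      rw [simpCosimplicialLie_pre]
      simp only [v, simpLieMap_of, Category.id_comp]
      rw [hg, if_neg hq, smul_zero]
    · exact fun h => absurd (Finset.mem_univ _) h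
  have h1 := LinearMap.congr_fun key f
  simp only [LinearMap.comp_apply] at h1
  rw [hf, map_zero, map_zero] at h1
  exact Subtype.ext h1.symm

end injectivity

/-- There is no circularity: `isFunctor_F` refers to the structure maps of `LieEZ` only, not to its
axioms. -/
theorem lawful_LieEZ : (LieEZ k).Lawful :=
  (isFunctor_F (simpCosimplicialLie k)).lawful (Cx.lawful _) fun _ => F_injective

/-! ### The canonical truncation is a suboperad -/

section truncation

namespace DGPTData

variable {A : DGPTData.{u, v, w} k}

lemma d_congr {I : Type} [Fintype I] [LinearOrder I] [Nonempty I] {y : I → A.Ob} {x : A.Ob}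
    {n n' n'' : ℤ} (h : n + 1 = n') (h' : n + 1 = n'') (f : A.P I y x n) (hf : A.d n n' h f = 0) :
    A.d n n'' h' f = 0 := by
  subst h
  subst h'
  exact hf

/-- In a composition a factor of positive degree is zero. If there is none, total degree `0` forces
every factor into degree `0`, and by the Leibniz rule a composite of cocycles is a cocycle. -/
lemma isSub_tau (hA : A.Lawful) : A.IsSub A.tau where
  d {I _ _ _ y x} n n' h f hf := by
    refine ⟨fun hn => ?_, fun _ => hA.d_d _ _ _ _ _ _⟩
    rcases lt_or_eq_of_le (by omega : 0 ≤ n) with h0 | h0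
    · rw [hf.1 h0, map_zero]
    · exact d_congr rfl h f (hf.2 h0.symm)
  map {I I' _ _ _ _ _ _} e {y x} n f hf := by
    refine ⟨fun hn => ?_, fun hn => ?_⟩
    · rw [hf.1 hn, map_zero]
    · rw [hA.d_map (y := y) e n (n + 1) rfl f, hf.2 hn, map_zero]
  id x := ⟨fun h => absurd h (lt_irrefl 0), fun _ => d_congr _ _ _ (hA.d_id x)⟩
  comp {I _ _ _ J _ _ _ z y x} n m N h f g hf hg := by
    by_cases hpos : 0 < n ∨ ∃ i, 0 < m i
    · have h0 : A.comp (z := z) (y := y) (x := x) n m N h f g = 0 := by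
        rcases hpos with hn | ⟨i, hi⟩
        · rw [hf.1 hn, map_zero, zero_apply]
        · exact (A.comp n m N h f).map_coord_zero i ((hg i).1 hi)
      rw [h0]
      exact zero_mem _
    · push Not at hpos
      have hm : ∑ i, m i ≤ 0 := Finset.sum_nonpos fun i _ => hpos.2 i
      refine ⟨fun hN => by omega, fun hN => ?_⟩
      have hn0 : n = 0 := by omega
      have hm0 : ∀ i, m i = 0 := fun i => (Finset.sum_eq_zero_iff_of_nonpos
        (fun i _ => hpos.2 i)).1 (by omega) i (Finset.mem_univ i)
      rw [hA.d_comp n m N (N + 1) h rfl f g, hf.2 hn0, map_zero, zero_apply, zero_add]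
      refine Finset.sum_eq_zero fun i _ => ?_
      rw [MultilinearMap.map_coord_zero _ i, smul_zero]
      rw [dAt, dif_pos rfl]
      exact d_congr rfl _ _ ((hg i).2 (hm0 i))

variable {S : ∀ (I : Type) [Fintype I] [LinearOrder I] [Nonempty I] (y : I → A.Ob) (x : A.Ob)
  (n : ℤ), Submodule k (A.P I y x n)} (hS : A.IsSub S)

lemma isFunctor_subtype :
    IsFunctor (A.sub S hS) A (fun x => x) (fun I _ _ _ y x n => (S I y x n).subtype) where
  d _ _ _ _ := rfl
  map _ _ _ _ _ := rfl
  id _ := rfl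
  comp _ _ _ _ _ _ := rfl

lemma sub_lawful (hA : A.Lawful) : (A.sub S hS).Lawful :=
  (isFunctor_subtype hS).lawful hA fun _ => fun _ _ _ => Subtype.val_injective

lemma IsFunctor.comp_subtype {B : DGPTData.{u, v', w'} k} {obj : A.Ob → B.Ob}
    {F : ∀ (I : Type) [Fintype I] [LinearOrder I] [Nonempty I] (y : I → A.Ob) (x : A.Ob) (n : ℤ),
      A.P I y x n →ₗ[k] B.P I (fun i => obj (y i)) (obj x) n} (hF : IsFunctor A B obj F) :
    IsFunctor (A.sub S hS) B obj (fun I _ _ _ y x n => (F I y x n).comp (S I y x n).subtype) where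
  d n n' h f := hF.d n n' h f.1
  map e _ _ n f := hF.map e n f.1
  id x := hF.id x
  comp n m N h f g := hF.comp n m N h f.1 (fun i => (g i).1)

end DGPTData

end truncation

/-! ### The augmentation is a morphism of operads -/

section augmentation

variable {I : Type} [Fintype I]

/-- The tensor of copies of the vertex of `Δ^0`. -/
abbrev vertexTensor (I : Type) : I → Simp 0 := fun _ => ⟨0, 𝟙 ⦋0⦌⟩

lemma augZ_eq {n : ℤ} (φ : ZHom k I n) : augZ I n φ = φ.1 0 (idChain k 0) (vertexTensor I) := rfl

lemma augZ_eq_zero {n : ℤ} (hn : n ≠ 0) (φ : ZHom k I n) : augZ I n φ = 0 :=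
  φ.2.2 0 ⟨0, 𝟙 _⟩ _ (by simpa using hn.symm)

lemma simp_zero_ext (σ : Simp 0) (h : σ.1 = 0) : σ = ⟨0, 𝟙 ⦋0⦌⟩ := by
  obtain ⟨l, p⟩ := σ
  obtain rfl : l = 0 := h
  have : p = 𝟙 ⦋0⦌ := by
    ext i
    exact congrArg Fin.val (Subsingleton.elim (α := Fin 1) _ _)
  rw [this]

lemma bdry_edge_zero (p : ⦋1⦌ ⟶ ⦋0⦌) : (Simp.bdry (⟨1, p⟩ : Simp 0) : ZChains k 0) = 0 := by
  have h : ∀ s, (⟨0, SimplexCategory.δ s ≫ p⟩ : Simp 0) = ⟨0, 𝟙 ⦋0⦌⟩ := fun s =>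
    simp_zero_ext _ rfl
  simp [Simp.bdry, h, Fin.sum_univ_two]

/-- Only tensors of total dimension `1` could contribute, and in `Δ^0` the two faces of an edge
coincide and cancel. -/
lemma zDTens_vertexTensor [LinearOrder I] (x : ZTens k I 0) :
    zDTens I 0 x (vertexTensor I) = 0 := by
  refine apply_eq_zero_of_support _ _ _ fun p _ => ?_
  by_cases h : ∑ i, ((p i).1 : ℤ) = 1
  · have h1 : ∀ j, (Simp.bdry (p j) : ZChains k 0) = 0 := by
      intro j
      have h2 : ((p j).1 : ℤ) ≤ 1 := by
        rw [← h]
        exact Finset.single_le_sum (f := fun i => ((p i).1 : ℤ)) (fun i _ => Int.natCast_nonneg _)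
          (Finset.mem_univ j)
      generalize p j = σ at h2
      obtain ⟨l, q⟩ := σ
      match l, q, h2 with
      | 0, q, _ => rfl
      | 1, q, _ => exact bdry_edge_zero q
      | l + 2, q, h2 => simp at h2; omega
    simp [zDTens, h1]
  · exact zDTens_apply_eq_zero I p _ (by simpa using fun h' => h h'.symm)

/-- The vertex `id_[0]` has no boundary, so only the term `d ∘ φ` is left, and it has no component
at the tensor of vertices. -/
lemma augZ_zDiff [LinearOrder I] {n n' : ℤ} (h : n + 1 = n') (φ : ZHom k I n) :
    augZ I n' (zDiff n n' h φ) = 0 := by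
  have h1 : (zDiff n n' h φ).1 0 (idChain k 0) =
      -(Int.negOnePow n • zDTens I 0 (φ.1 0 (idChain k 0))) := by
    simp [zDiff, zD, Simp.bdry]
  rw [augZ_eq, h1, Finsupp.neg_apply, Units.smul_def, Finsupp.smul_apply, zDTens_vertexTensor]
  simp

lemma augZ_zMap {I' : Type} [LinearOrder I] [Fintype I'] [LinearOrder I'] (e : I ≃ I') {n : ℤ}
    (φ : ZHom k I n) : augZ I' n (zMap e n φ) = augZ I n φ := by
  rw [augZ_eq, augZ_eq]
  refine ztens_induction (J := I) ((Finsupp.lapply (vertexTensor I')).comp (zPerm e 0))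
    (Finsupp.lapply (vertexTensor I)) (fun p => ?_) (φ.1 0 (idChain k 0))
  simp only [LinearMap.comp_apply, zPerm, Finsupp.linearCombination_single, one_smul,
    Finsupp.lapply_apply, Units.smul_def, Finsupp.smul_apply]
  by_cases h : p = vertexTensor I
  · subst h
    have h1 : permSign e (fun _ : I => ((0 : ℕ) : ℤ)) = 1 :=
      permSign_of_mul_even _ _ fun _ _ _ => by simp
    rw [h1, Finsupp.single_eq_same, Finsupp.single_eq_same]
    simp
  · rw [Finsupp.single_eq_of_ne, Finsupp.single_eq_of_ne (Ne.symm h), smul_zero]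
    intro h'
    refine h (funext fun i => ?_)
    have := congrFun h' (e i)
    simpa using this.symm

lemma augZ_zOne : augZ Unit 0 (zOne : ZHom k Unit 0) = 1 := by
  rw [augZ_eq]
  simp [zOne]

/-- A map of degree `≤ 0` does not lower the dimension, so only the tensor of vertices contributes
to the coefficient at vertices. A map of positive degree could send simplices of positive dimension
to vertices. -/
lemma augZ_zComp [LinearOrder I] {J : I → Type} [∀ i, Fintype (J i)] [∀ i, LinearOrder (J i)]
    {n N : ℤ} {r : I → ℤ} (hr : ∀ i, r i ≤ 0) (h : n + ∑ i, r i = N) (φ : ZHom k I n)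
    (φ' : ∀ i, ZHom k (J i) (r i)) :
    augZ (Σ i, J i) N (zComp n r N h φ φ') = augZ I n φ * ∏ i, augZ (J i) (r i) (φ' i) := by
  rw [augZ_eq, augZ_eq]
  change zTensorMap r 0 φ' (φ.1 0 (idChain k 0)) _ = _
  generalize φ.1 0 (idChain k 0) = x
  rw [mul_comm]
  refine ztens_induction (J := I) ((Finsupp.lapply (vertexTensor (Σ i, J i))).comp
    (zTensorMap r 0 φ')) ((∏ i, augZ (J i) (r i) (φ' i)) • Finsupp.lapply (vertexTensor I))
    (fun p => ?_) x
  simp only [LinearMap.comp_apply, LinearMap.smul_apply, Finsupp.lapply_apply, zTensorMap_single,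
    Units.smul_def, Finsupp.smul_apply, zTensor_apply, smul_eq_mul]
  by_cases hp : p = vertexTensor I
  · subst hp
    rw [Finsupp.single_eq_same, mul_one]
    change _ • ∏ i, augZ (J i) (r i) (φ' i) = _
    -- If all degrees are `0` the sign is trivial; otherwise a factor of the product vanishes for
    -- degree reasons.
    by_cases hr0 : ∀ i, r i = 0
    · obtain rfl : r = fun _ => 0 := funext hr0
      rw [shuffleSign_zero_left]
      simp
    · push Not at hr0
      obtain ⟨i, hi⟩ := hr0
      rw [Finset.prod_eq_zero (Finset.mem_univ i) (augZ_eq_zero hi _), smul_zero]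
  · rw [Finsupp.single_eq_of_ne (Ne.symm hp), mul_zero]
    obtain ⟨i, hi⟩ := Function.ne_iff.1 hp
    rw [Finset.prod_eq_zero (Finset.mem_univ i), smul_zero]
    refine (φ' i).2.2 0 (p i) _ ?_
    have h1 : (p i).1 ≠ 0 := fun h' => hi (simp_zero_ext _ h')
    have := hr i
    simp
    omega

/-- The linear map `ψ ⊗ φ ↦ augZ φ • ψ`. -/
abbrev augT (I : Type) [Fintype I] (n : ℤ) : Lie k I ⊗[k] ZHom k I n →ₗ[k] Lie k I :=
  tensorCoef (fun _ => 0) 0 (fun _ => 𝟙 _)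

lemma augT_tmul {n : ℤ} (ψ : Lie k I) (φ : ZHom k I n) : augT I n (ψ ⊗ₜ φ) = augZ I n φ • ψ :=
  tensorCoef_tmul _ _ _ _ _

lemma augT_eq_zero {n : ℤ} (hn : n ≠ 0) (f : Lie k I ⊗[k] ZHom k I n) : augT I n f = 0 := by
  induction f using TensorProduct.induction_on with
  | zero => exact map_zero _
  | add f f' hf hf' => rw [map_add, hf, hf', add_zero]
  | tmul ψ φ => rw [augT_tmul, augZ_eq_zero hn, zero_smul]

lemma augT_comp [LinearOrder I] [Nonempty I] {J : I → Type} [∀ i, Fintype (J i)]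
    [∀ i, LinearOrder (J i)] [∀ i, Nonempty (J i)] {n N : ℤ} {r : I → ℤ} (hr : ∀ i, r i ≤ 0)
    (h : n + ∑ i, r i = N) (f : Lie k I ⊗[k] ZHom k I n)
    (g : ∀ i, Lie k (J i) ⊗[k] ZHom k (J i) (r i)) :
    augT (Σ i, J i) N (tensorComp lieComp (zComp n r N h) f g) =
      lieComp (augT I n f) (fun i => augT (J i) (r i) (g i)) := by
  induction f using TensorProduct.induction_on with
  | zero => simp only [map_zero, zero_apply]
  | add f f' hf hf' => simp only [map_add, add_apply, hf, hf']
  | tmul ψ φ =>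
    have key : (augT (Σ i, J i) N).compMultilinearMap
        (tensorComp lieComp (zComp n r N h) (ψ ⊗ₜ φ)) =
        (lieComp (augT I n (ψ ⊗ₜ φ))).compLinearMap (fun i => augT (J i) (r i)) := by
      refine multilinear_tensor_ext fun ψ' φ' => ?_
      rw [LinearMap.compMultilinearMap_apply, tensorComp_tmul, MultilinearMap.compLinearMap_apply]
      simp only [augT_tmul]
      rw [augZ_zComp hr, MultilinearMap.map_smul_univ, map_smul, smul_apply, smul_smul, mul_comm]
    exact congrArg (fun L => L g) key

variable [LinearOrder I] [Nonempty I] (h : (LieEZ k).IsSub (LieEZ k).tau)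

/-- Outside degree `0` both sides vanish, which removes the case distinction made in `augmentation`.
-/
lemma augmentation_val (y : I → (LieEZTrunc k h).Ob) (x : (LieEZTrunc k h).Ob) (n : ℤ)
    (f : (LieEZTrunc k h).P I y x n) : (augmentation h I y x n f).1 = augT I n f.1 := by
  by_cases hn : n = 0
  · have h1 : (augmentation h I y x n f).1 = TensorProduct.lift (LinearMap.mk₂ k
        (fun (ψ : Lie k I) (φ : ZHom k I n) => augZ I n φ • ψ)
        (by intros; simp only [smul_add]) (by intros; rw [smul_comm])
        (by intros; rw [map_add, add_smul]) (by intros; rw [map_smul, smul_assoc])) f.1 := by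
      simp only [augmentation, LinearMap.codRestrict_apply]
      rw [if_pos hn]
      rfl
    rw [h1]
    congr 1
    refine TensorProduct.ext' fun ψ φ => ?_
    rw [augT_tmul]
    rfl
  · rw [augT_eq_zero hn]
    exact (augmentation h I y x n f).2 hn

theorem isFunctor_augmentation : DGPTData.IsFunctor (LieEZTrunc k h) (LieOp k).toDG (fun _ => ())
    (augmentation h) where
  d {I _ _ _ y x} n n' hn f := by
    apply Subtype.ext
    rw [augmentation_val]
    change augT I n' ((zDiff n n' hn).lTensor _ f.1) = 0
    induction f.1 using TensorProduct.induction_on with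
    | zero => simp only [map_zero]
    | add f f' hf hf' => rw [map_add, map_add, hf, hf', add_zero]
    | tmul ψ φ => rw [LinearMap.lTensor_tmul, augT_tmul, augZ_zDiff, zero_smul]
  map {I I' _ _ _ _ _ _} e {y x} n f := by
    apply Subtype.ext
    rw [augmentation_val]
    refine Eq.trans ?_ (congrArg (lieMap e) (augmentation_val h (fun i => y (e i)) x n f).symm)
    change augT I' n (TensorProduct.map (lieMap e) (zMap e n) f.1) = lieMap e (augT I n f.1)
    induction f.1 using TensorProduct.induction_on with
    | zero => simp only [map_zero]
    | add f f' hf hf' => simp only [map_add, hf, hf']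
    | tmul ψ φ => rw [TensorProduct.map_tmul, augT_tmul, augT_tmul, augZ_zMap, map_smul]
  id x := by
    apply Subtype.ext
    rw [augmentation_val]
    refine (augT_tmul _ _).trans ?_
    rw [augZ_zOne, one_smul]
  comp {I _ _ _ J _ _ _ z y x} n m N hN f g := by
    apply Subtype.ext
    rw [augmentation_val]
    have h1 : (((LieOp k).toDG.comp (z := fun _ _ => ()) (y := fun _ => ()) (x := ()) n m N hN
        (augmentation h I y x n f) (fun i => augmentation h (J i) (z i) (y i) (m i) (g i))).1 :
        Lie k (Σ i, J i)) = lieComp (augT I n f.1) (fun i => augT (J i) (m i) (g i).1) := by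
      exact congrArg₂ (fun a b => lieComp a b) (augmentation_val h y x n f)
        (funext fun i => augmentation_val h (z i) (y i) (m i) (g i))
    refine Eq.trans ?_ h1.symm
    change augT (Σ i, J i) N (tensorComp (LieOp k).comp (zComp n m N hN) f.1 (fun i => (g i).1)) = _
    -- `augT_comp` is available for degrees `≤ 0`; in positive degrees the truncation is zero.
    by_cases hm : ∀ i, m i ≤ 0
    · exact augT_comp hm hN f.1 (fun i => (g i).1)
    · push Not at hm
      obtain ⟨i, hi⟩ := hm
      have h0 : (g i).1 = 0 := (g i).2.1 hi
      rw [MultilinearMap.map_coord_zero _ i h0, map_zero, MultilinearMap.map_coord_zero _ i]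
      rw [h0, map_zero]

end augmentation

/-! ### Tensor products of endomorphisms of the chains -/

section tensorEnd

variable {I : Type} [Fintype I] {m : ℕ}

open Classical in
variable (k I m) in
/-- The tensors of chains as a tensor product. -/
def tensEquiv : (⨂[k] _ : I, ZChains k m) ≃ₗ[k] ZTens k I m :=
  PiTensorProduct.ofFinsuppEquiv' (R := k) (κ := fun _ : I => Simp m)

lemma tensEquiv_tprod (x : I → ZChains k m) (q : I → Simp m) :
    tensEquiv k I m (PiTensorProduct.tprod k x) q = ∏ i, x i (q i) := by
  simp [tensEquiv]

lemma tensEquiv_single (p : I → Simp m) :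
    tensEquiv k I m (PiTensorProduct.tprod k fun i => Finsupp.single (p i) 1) =
      Finsupp.single p 1 := by
  simp [tensEquiv]

/-- The tensor product of endomorphisms of the space of chains. -/
def tensEnd (f : I → Module.End k (ZChains k m)) : Module.End k (ZTens k I m) :=
  (tensEquiv k I m).toLinearMap ∘ₗ PiTensorProduct.map f ∘ₗ (tensEquiv k I m).symm.toLinearMap

lemma tensEnd_single (f : I → Module.End k (ZChains k m)) (p : I → Simp m) :
    tensEnd f (Finsupp.single p 1) =
      tensEquiv k I m (PiTensorProduct.tprod k fun i => f i (Finsupp.single (p i) 1)) := by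
  rw [← tensEquiv_single]
  simp [tensEnd]

lemma tensEnd_single_apply (f : I → Module.End k (ZChains k m)) (p q : I → Simp m) :
    tensEnd f (Finsupp.single p 1) q = ∏ i, f i (Finsupp.single (p i) 1) (q i) := by
  rw [tensEnd_single, tensEquiv_tprod]

lemma tensEnd_mul (f f' : I → Module.End k (ZChains k m)) :
    tensEnd f * tensEnd f' = tensEnd (f * f') := by
  refine LinearMap.ext fun x => ?_
  have := PiTensorProduct.map_mul (R := k) f f'
  simp only [tensEnd, Module.End.mul_apply, LinearMap.comp_apply, LinearEquiv.coe_coe,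
    LinearEquiv.symm_apply_apply]
  exact congrArg _ (LinearMap.congr_fun this ((tensEquiv k I m).symm x)).symm

lemma tensEnd_one : tensEnd (1 : I → Module.End k (ZChains k m)) = 1 := by
  refine LinearMap.ext fun x => ?_
  have := PiTensorProduct.map_one (R := k) (s := fun _ : I => ZChains k m)
  simp only [tensEnd, LinearMap.comp_apply, LinearEquiv.coe_coe, Module.End.one_apply]
  refine (congrArg _ (LinearMap.congr_fun this ((tensEquiv k I m).symm x))).trans ?_
  simp

lemma tensEnd_update_add [DecidableEq I] (f : I → Module.End k (ZChains k m)) (i : I)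
    (a b : Module.End k (ZChains k m)) : tensEnd (Function.update f i (a + b)) =
      tensEnd (Function.update f i a) + tensEnd (Function.update f i b) := by
  simp only [tensEnd, PiTensorProduct.map_update_add, LinearMap.add_comp, LinearMap.comp_add]

lemma tensEnd_update_smul [DecidableEq I] (f : I → Module.End k (ZChains k m)) (i : I) (r : k)
    (a : Module.End k (ZChains k m)) : tensEnd (Function.update f i (r • a)) =
      r • tensEnd (Function.update f i a) := by
  simp only [tensEnd, PiTensorProduct.map_update_smul, LinearMap.smul_comp, LinearMap.comp_smul]

end tensorEnd

/-! ### The cone contraction of the chains of a simplex -/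

section chains

variable {m : ℕ}

variable (k m) in
/-- The parity operator on chains. -/
def parity : Module.End k (ZChains k m) :=
  Finsupp.linearCombination k fun σ => Finsupp.single σ ((-1 : k) ^ σ.1)

lemma parity_single (σ : Simp m) (r : k) :
    parity k m (Finsupp.single σ r) = (-1 : k) ^ σ.1 • Finsupp.single σ r := by
  simp [parity, mul_comm]

lemma parity_mul_parity : parity k m * parity k m = 1 := by
  refine Finsupp.lhom_ext' fun σ => LinearMap.ext_ring ?_
  simp only [LinearMap.comp_apply, Finsupp.lsingle_apply, Module.End.mul_apply, parity_single,
    map_smul, smul_smul, ← mul_pow, Module.End.one_apply]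
  simp

lemma zD_single (σ : Simp m) : zD (k := k) m (Finsupp.single σ 1) = Simp.bdry σ := by
  simp [zD]

/-- The boundary changes the dimension by one, and so does the cone operator in
`parity_mul_coneMap`. -/
lemma parity_mul_zD : parity k m * zD m = -(zD m * parity k m) := by
  refine Finsupp.lhom_ext' fun σ => LinearMap.ext_ring ?_
  simp only [LinearMap.comp_apply, Finsupp.lsingle_apply, Module.End.mul_apply, parity_single,
    map_smul, LinearMap.neg_apply, zD_single]
  obtain ⟨l, p⟩ := σ
  cases l with
  | zero => simp [Simp.bdry]
  | succ l =>
    simp only [Simp.bdry, map_sum, parity_single, Finset.smul_sum, ← Finset.sum_neg_distrib]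
    refine Finset.sum_congr rfl fun s _ => ?_
    rw [pow_succ]
    simp

/-- The cone with vertex `0` over a simplex. -/
def coneHom {l : ℕ} (p : ⦋l⦌ ⟶ ⦋m⦌) : ⦋l + 1⦌ ⟶ ⦋m⦌ :=
  SimplexCategory.Hom.mk ⟨Fin.cons 0 (fun i => p.toOrderHom i), by
    intro i j
    refine Fin.cases ?_ (fun i => ?_) i
    · intro _
      simp
    · refine Fin.cases ?_ (fun j => ?_) j
      · intro h
        simp at h
      · intro h
        simpa using p.toOrderHom.monotone (Fin.succ_le_succ_iff.1 h)⟩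

lemma coneHom_zero {l : ℕ} (p : ⦋l⦌ ⟶ ⦋m⦌) : (coneHom p).toOrderHom 0 = 0 := rfl

lemma coneHom_succ {l : ℕ} (p : ⦋l⦌ ⟶ ⦋m⦌) (i : Fin (l + 1)) :
    (coneHom p).toOrderHom i.succ = p.toOrderHom i := rfl

lemma δ_zero_coneHom {l : ℕ} (p : ⦋l⦌ ⟶ ⦋m⦌) : SimplexCategory.δ 0 ≫ coneHom p = p := by
  ext i
  rfl

lemma δ_succ_coneHom {l : ℕ} (p : ⦋l + 1⦌ ⟶ ⦋m⦌) (s : Fin (l + 2)) :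
    SimplexCategory.δ s.succ ≫ coneHom p = coneHom (SimplexCategory.δ s ≫ p) := by
  refine SimplexCategory.Hom.ext _ _ (OrderHom.ext _ _ (funext fun i => ?_))
  change (coneHom p).toOrderHom (s.succ.succAbove i) =
    (coneHom (SimplexCategory.δ s ≫ p)).toOrderHom i
  refine Fin.cases ?_ (fun i => ?_) i
  · rw [Fin.succ_succAbove_zero, coneHom_zero, coneHom_zero]
  · rw [Fin.succ_succAbove_succ, coneHom_succ, coneHom_succ]
    rfl

variable (m) in
/-- The vertex `0` of `Δ^m`. -/
def vertexHom : ⦋0⦌ ⟶ ⦋m⦌ := SimplexCategory.Hom.mk ⟨fun _ => 0, fun _ _ _ => le_rfl⟩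

lemma δ_one_coneHom (p : ⦋0⦌ ⟶ ⦋m⦌) :
    SimplexCategory.δ 1 ≫ coneHom p = vertexHom m := by
  refine SimplexCategory.Hom.ext _ _ (OrderHom.ext _ _ (funext fun i => ?_))
  change (coneHom p).toOrderHom (Fin.succAbove 1 i) = 0
  obtain rfl : i = 0 := Subsingleton.elim (α := Fin 1) _ _
  exact coneHom_zero p

/-- The cone operator on chains. -/
def coneMap : Module.End k (ZChains k m) :=
  Finsupp.lmapDomain k k fun σ : Simp m => (⟨σ.1 + 1, coneHom σ.2⟩ : Simp m)

lemma coneMap_single (σ : Simp m) (r : k) : coneMap (Finsupp.single σ r) =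
    Finsupp.single (⟨σ.1 + 1, coneHom σ.2⟩ : Simp m) r := by
  simp [coneMap]

lemma parity_mul_coneMap : parity k m * coneMap = -(coneMap * parity k m) := by
  refine Finsupp.lhom_ext' fun σ => LinearMap.ext_ring ?_
  simp only [LinearMap.comp_apply, Finsupp.lsingle_apply, Module.End.mul_apply, parity_single,
    map_smul, LinearMap.neg_apply, coneMap_single, pow_succ]
  simp

/-- The projection of chains onto the multiples of the vertex `0`. -/
def vertexProj : Module.End k (ZChains k m) :=
  Finsupp.linearCombination k fun σ =>
    if σ.1 = 0 then Finsupp.single (⟨0, vertexHom m⟩ : Simp m) 1 else 0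

lemma vertexProj_single (σ : Simp m) (r : k) : vertexProj (Finsupp.single σ r) =
    if σ.1 = 0 then Finsupp.single (⟨0, vertexHom m⟩ : Simp m) r else 0 := by
  simp [vertexProj]

lemma parity_mul_vertexProj : parity k m * vertexProj = vertexProj * parity k m := by
  refine Finsupp.lhom_ext' fun σ => LinearMap.ext_ring ?_
  simp only [LinearMap.comp_apply, Finsupp.lsingle_apply, Module.End.mul_apply, parity_single,
    map_smul, vertexProj_single]
  by_cases h : σ.1 = 0 <;> simp [h, parity_single]

lemma zD_mul_vertexProj : zD m * vertexProj (k := k) = 0 := by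
  refine Finsupp.lhom_ext' fun σ => LinearMap.ext_ring ?_
  simp only [LinearMap.comp_apply, Finsupp.lsingle_apply, Module.End.mul_apply, vertexProj_single]
  by_cases h : σ.1 = 0 <;> simp [h, zD_single, Simp.bdry]

/-- Only edges have faces of dimension `0`, and the two faces of an edge go to the same vertex with
opposite signs. -/
lemma vertexProj_mul_zD : vertexProj * zD m = (0 : Module.End k (ZChains k m)) := by
  refine Finsupp.lhom_ext' fun σ => LinearMap.ext_ring ?_
  simp only [LinearMap.comp_apply, Finsupp.lsingle_apply, Module.End.mul_apply, zD_single]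
  obtain ⟨l, p⟩ := σ
  match l, p with
  | 0, p => simp [Simp.bdry]
  | 1, p => simp [Simp.bdry, vertexProj_single, Fin.sum_univ_two]
  | l + 2, p => simp [Simp.bdry, vertexProj_single]

/-- The face of a cone opposite its apex is the simplex itself, and the other faces are the cones
over its faces. Over a vertex the other face is the vertex `0`, for which `vertexProj` accounts. -/
lemma zD_coneMap : zD m * coneMap + coneMap * zD m + vertexProj (k := k) = 1 := by
  refine Finsupp.lhom_ext' fun σ => LinearMap.ext_ring ?_
  simp only [LinearMap.comp_apply, Finsupp.lsingle_apply, LinearMap.add_apply,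
    Module.End.mul_apply, Module.End.one_apply, zD_single, coneMap_single,
    vertexProj_single]
  obtain ⟨l, p⟩ := σ
  cases l with
  | zero =>
    simp [Simp.bdry, Fin.sum_univ_two, δ_zero_coneHom, δ_one_coneHom]
  | succ l =>
    simp only [Simp.bdry, map_sum, coneMap_single]
    rw [Fin.sum_univ_succ]
    simp [δ_zero_coneHom, δ_succ_coneHom, pow_succ]

end chains

/-! ### Contraction of the tensor powers -/

section homotopy

variable {m : ℕ}

/-- `f` raises the dimension of the simplices by `d`. -/
def RaisesDim (d : ℕ) (f : Module.End k (ZChains k m)) : Prop :=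
  ∀ σ τ : Simp m, τ.1 ≠ σ.1 + d → f (Finsupp.single σ 1) τ = 0

lemma RaisesDim.mul {d d' : ℕ} {f f' : Module.End k (ZChains k m)} (hf : RaisesDim d f)
    (hf' : RaisesDim d' f') : RaisesDim (d + d') (f * f') := by
  intro σ τ h
  refine apply_eq_zero_of_support f _ _ fun ρ hρ => hf _ _ fun h1 => ?_
  by_cases h2 : ρ.1 = σ.1 + d'
  · omega
  · exact hρ (hf' σ ρ h2)

lemma raisesDim_one : RaisesDim 0 (1 : Module.End k (ZChains k m)) := by
  intro σ τ h
  exact Finsupp.single_eq_of_ne (by rintro rfl; exact h rfl)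

lemma raisesDim_parity : RaisesDim 0 (parity k m) := by
  intro σ τ h
  rw [parity_single, Finsupp.smul_apply, Finsupp.single_eq_of_ne, smul_zero]
  rintro rfl
  exact h rfl

lemma raisesDim_coneMap : RaisesDim 1 (coneMap : Module.End k (ZChains k m)) := by
  intro σ τ h
  rw [coneMap_single, Finsupp.single_eq_of_ne]
  rintro rfl
  exact h rfl

lemma raisesDim_vertexProj : RaisesDim 0 (vertexProj : Module.End k (ZChains k m)) := by
  intro σ τ h
  rw [vertexProj_single]
  split_ifs with h0
  · refine Finsupp.single_eq_of_ne ?_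
    rintro rfl
    exact h (by simp [h0])
  · rfl

variable {I : Type} [Fintype I]

lemma tensEnd_apply_eq_zero {f : I → Module.End k (ZChains k m)} {d : I → ℕ}
    (hf : ∀ i, RaisesDim (d i) (f i)) (p q : I → Simp m)
    (h : ∑ i, (q i).1 ≠ ∑ i, (p i).1 + ∑ i, d i) : tensEnd f (Finsupp.single p 1) q = 0 := by
  rw [tensEnd_single_apply]
  by_contra hne
  have h2 := fun i => Finset.prod_ne_zero_iff.1 hne i (Finset.mem_univ i)
  apply h
  rw [← Finset.sum_add_distrib]
  refine Finset.sum_congr rfl fun i _ => ?_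
  by_contra h3
  exact h2 i (hf i _ _ h3)

variable (k I m) in
/-- The augmentation of the tensors of chains. -/
def zAug : ZTens k I m →ₗ[k] k :=
  Finsupp.linearCombination k fun p => if ∀ i, (p i).1 = 0 then 1 else 0

variable (k I m) in
/-- The tensor of copies of the vertex `0` of `Δ^m`. -/
abbrev vertexChain : ZTens k I m := Finsupp.single (fun _ => ⟨0, vertexHom m⟩) 1

lemma zAug_single (p : I → Simp m) :
    zAug k m I (Finsupp.single p 1) = if ∀ i, (p i).1 = 0 then 1 else 0 := by
  simp [zAug]

lemma tensEnd_vertexProj (x : ZTens k I m) :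
    tensEnd (fun _ => vertexProj) x = zAug k m I x • vertexChain k m I := by
  refine ztens_induction (tensEnd _) ((zAug k m I).smulRight (vertexChain k m I)) (fun p => ?_) x
  rw [tensEnd_single, LinearMap.smulRight_apply, zAug_single]
  simp only [vertexProj_single]
  split_ifs with h
  · simp only [h, if_true, one_smul]
    exact tensEquiv_single _
  · push Not at h
    obtain ⟨i, hi⟩ := h
    rw [MultilinearMap.map_coord_zero _ i (if_neg hi), map_zero, zero_smul]

lemma zAug_zPushTens {m' : ℕ} (θ : ⦋m⦌ ⟶ ⦋m'⦌) (x : ZTens k I m) :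
    zAug k m' I (zPushTens I θ x) = zAug k m I x := by
  refine ztens_induction (zAug k m' I ∘ₗ zPushTens I θ) (zAug k m I) (fun p => ?_) x
  rw [LinearMap.comp_apply, zPushTens_single, zAug_single, zAug_single]
  rfl

variable [LinearOrder I]

/-- The endomorphism `f` at the place `j`, with the Koszul signs of an operator of odd degree. -/
def place (j : I) (f : Module.End k (ZChains k m)) (i : I) : Module.End k (ZChains k m) :=
  if i < j then parity k m else if i = j then f else 1

/-- The Koszul signs of the differential are carried by `parity` at the earlier places, so that
identities between operators on the tensor power can be checked place by place. -/
lemma zDTens_eq : zDTens I m = ∑ j, tensEnd (place j (zD (k := k) m)) := by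
  refine Finsupp.lhom_ext' fun p => LinearMap.ext_ring ?_
  simp only [LinearMap.comp_apply, Finsupp.lsingle_apply, LinearMap.sum_apply, zDTens,
    Finsupp.linearCombination_single, one_smul]
  refine Finset.sum_congr rfl fun j _ => ?_
  have h1 : (fun i => place j (zD (k := k) m) i (Finsupp.single (p i) 1)) =
      fun i => (if i < j then (-1 : k) ^ (p i).1 else 1) •
        Function.update (fun i => Finsupp.single (p i) (1 : k)) j (Simp.bdry (p j)) i := by
    funext i
    rcases lt_trichotomy i j with h | h | h
    · simp [place, h, h.ne, parity_single]
    · subst h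
      simp [place, zD_single]
    · simp [place, h.not_gt, h.ne']
  have h2 : ∏ i, (if i < j then (-1 : k) ^ (p i).1 else 1) =
      ((Int.negOnePow (∑ i with i < j, ((p i).1 : ℤ)) : ℤ) : k) := by
    rw [← Finset.prod_filter, Finset.prod_pow_eq_pow_sum, ← Nat.cast_sum, Int.negOnePow_def,
      zpow_natCast]
    push_cast
    rfl
  have h3 : Finsupp.lmapDomain k k (fun σ => Function.update p j σ) =
      (tensEquiv k I m).toLinearMap ∘ₗ (PiTensorProduct.tprod k).toLinearMap
        (fun i => Finsupp.single (p i) (1 : k)) j := by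
    refine Finsupp.lhom_ext' fun σ => LinearMap.ext_ring ?_
    simp only [LinearMap.comp_apply, Finsupp.lsingle_apply, Finsupp.lmapDomain_apply,
      Finsupp.mapDomain_single, MultilinearMap.toLinearMap_apply, LinearEquiv.coe_coe]
    rw [← tensEquiv_single]
    congr 2
    funext i
    by_cases h : i = j
    · subst h
      simp
    · simp [h]
  rw [tensEnd_single, h1, MultilinearMap.map_smul_univ, map_smul, h2, ← sign_smul_eq k, h3]
  rfl

/-- The two products differ only at the place `i`, where they have the factors `parity * f` and `f *
parity`. -/
lemma tensEnd_place_mul_of_lt {f f' : Module.End k (ZChains k m)}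
    (hf : parity k m * f = -(f * parity k m)) {i j : I} (h : i < j) :
    tensEnd (place j f') * tensEnd (place i f) + tensEnd (place i f) * tensEnd (place j f') = 0 := by
  have h1 : place j f' * place i f =
      Function.update (place i f * place j f') i (parity k m * f) := by
    funext l
    by_cases hl : l = i
    · subst hl
      simp [place, h]
    · rw [Function.update_of_ne hl]
      rcases lt_or_gt_of_ne hl with h1 | h1
      · simp [place, h1, h1.trans h]
      · by_cases h2 : l = j
        · subst h2
          simp [place, hl, h1.not_gt]
        · by_cases h3 : l < j <;> simp [place, hl, h1.not_gt, h2, h3]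
  have h2 : place i f * place j f' =
      Function.update (place i f * place j f') i (f * parity k m) := by
    refine (Function.eq_update_iff).2 ⟨?_, fun _ _ => rfl⟩
    simp [place, h]
  have h3 : parity k m * f + f * parity k m = 0 := by
    rw [hf]
    exact neg_add_cancel (f * parity k m)
  -- The factor at `i` is now `0`; it is written as `0 • 0` and the scalar is pulled out.
  rw [tensEnd_mul, tensEnd_mul, h1, h2, Function.update_idem, ← tensEnd_update_add, h3,
    ← zero_smul k (0 : Module.End k (ZChains k m)), tensEnd_update_smul]
  exact zero_smul _ _

lemma tensEnd_place_mul_of_ne {f f' : Module.End k (ZChains k m)}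
    (hf : parity k m * f = -(f * parity k m)) (hf' : parity k m * f' = -(f' * parity k m))
    {i j : I} (h : i ≠ j) :
    tensEnd (place j f') * tensEnd (place i f) + tensEnd (place i f) * tensEnd (place j f') = 0 := by
  rcases lt_or_gt_of_ne h with h | h
  · exact tensEnd_place_mul_of_lt hf h
  · rw [add_comm]
    exact tensEnd_place_mul_of_lt hf' h

lemma tensEnd_place_mul_self (f f' : Module.End k (ZChains k m)) (j : I) :
    tensEnd (place j f) * tensEnd (place j f') = tensEnd (Function.update 1 j (f * f')) := by
  rw [tensEnd_mul]
  congr 1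
  funext l
  by_cases hl : l = j
  · subst hl
    simp [place]
  · by_cases h : l < j <;> simp [place, hl, h, parity_mul_parity]

/-- The summands of the differential at the other places anticommute with the cone operator at `j`;
at `j` itself the identity is `zD_coneMap`. -/
lemma zDTens_homotopy_place (j : I) :
    zDTens I m * tensEnd (place j coneMap) + tensEnd (place j coneMap) * zDTens I m +
      tensEnd (Function.update 1 j (vertexProj (k := k))) = 1 := by
  rw [zDTens_eq, Finset.sum_mul, Finset.mul_sum, ← Finset.sum_add_distrib,
    Finset.sum_eq_single j]
  · rw [tensEnd_place_mul_self, tensEnd_place_mul_self, ← tensEnd_update_add,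
      ← tensEnd_update_add, zD_coneMap]
    exact (congrArg tensEnd (Function.update_eq_self j 1)).trans tensEnd_one
  · intro i _ hi
    exact tensEnd_place_mul_of_ne parity_mul_coneMap parity_mul_zD hi.symm
  · exact fun h => absurd (Finset.mem_univ _) h

/-- `vertexProj` at the places in `S`. -/
def vertexProjOn (S : Finset I) (i : I) : Module.End k (ZChains k m) :=
  if i ∈ S then vertexProj else 1

/-- `parity` commutes with the projection, and where the boundary meets the projection both products
are zero. -/
lemma vertexProjOn_mul_zDTens (S : Finset I) :
    tensEnd (vertexProjOn S) * zDTens I m = zDTens (k := k) I m * tensEnd (vertexProjOn S) := by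
  rw [zDTens_eq, Finset.sum_mul, Finset.mul_sum]
  refine Finset.sum_congr rfl fun j _ => ?_
  rw [tensEnd_mul, tensEnd_mul]
  congr 1
  funext i
  simp only [Pi.mul_apply, vertexProjOn, place]
  split_ifs <;> simp [parity_mul_vertexProj, zD_mul_vertexProj, vertexProj_mul_zD]

/-- Homotopies are concatenated. With `P` the projection on `S`, which commutes with the
differential, and `h`, `Q` the cone operator and the projection at a new place, adding `P h` to `H`
turns `1 - P` into `(1 - P) + P (1 - Q) = 1 - P Q`. -/
lemma exists_homotopy_vertexProjOn (S : Finset I) : ∃ H : Module.End k (ZTens k I m),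
    (∀ p q : I → Simp m, ∑ i, (q i).1 ≠ ∑ i, (p i).1 + 1 → H (Finsupp.single p 1) q = 0) ∧
      zDTens I m * H + H * zDTens I m + tensEnd (vertexProjOn S) = 1 := by
  induction S using Finset.induction_on with
  | empty =>
    refine ⟨0, fun _ _ _ => rfl, ?_⟩
    have h : (vertexProjOn ∅ : I → Module.End k (ZChains k m)) = 1 := funext fun i => by
      simp [vertexProjOn]
    rw [h, tensEnd_one]
    simp
  | insert j S hj ih =>
    obtain ⟨H, hH, hH'⟩ := ih
    refine ⟨H + tensEnd (vertexProjOn S) * tensEnd (place j coneMap), fun p q h => ?_, ?_⟩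
    · rw [LinearMap.add_apply, Finsupp.add_apply, hH p q h, zero_add, tensEnd_mul]
      refine tensEnd_apply_eq_zero (d := fun i => 0 + if i = j then 1 else 0) (fun i => ?_) p q
        (by simpa using h)
      refine RaisesDim.mul ?_ ?_
      · rw [vertexProjOn]
        split_ifs
        · exact raisesDim_vertexProj
        · exact raisesDim_one
      · by_cases h : i = j
        · subst h
          simpa [place] using raisesDim_coneMap
        · by_cases h' : i < j
          · simpa [place, h, h'] using raisesDim_parity
          · simpa [place, h, h'] using raisesDim_one
    · have h1 : tensEnd (vertexProjOn S) * tensEnd (Function.update 1 j (vertexProj (k := k))) =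
          tensEnd (m := m) (vertexProjOn (insert j S)) := by
        rw [tensEnd_mul]
        congr 1
        funext i
        by_cases h : i = j
        · subst h
          simp [vertexProjOn, hj]
        · simp [vertexProjOn, h]
      rw [mul_add, add_mul, ← mul_assoc, ← vertexProjOn_mul_zDTens, mul_assoc, mul_assoc,
        add_add_add_comm, add_assoc, ← h1, ← mul_add, ← mul_add, zDTens_homotopy_place, mul_one, hH']

variable (k I m) in
-- Projecting at all places leaves the augmentation times the tensor of vertices `0`. The operator
-- `H` is not natural in `[m]`, since a morphism need not fix the vertex `0`.
theorem exists_homotopy : ∃ H : Module.End k (ZTens k I m),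
    (∀ p q : I → Simp m, ∑ i, (q i).1 ≠ ∑ i, (p i).1 + 1 → H (Finsupp.single p 1) q = 0) ∧
      ∀ x, zDTens I m (H x) + H (zDTens I m x) = x - zAug k m I x • vertexChain k m I := by
  obtain ⟨H, hH, hH'⟩ := exists_homotopy_vertexProjOn (k := k) (I := I) (m := m) Finset.univ
  refine ⟨H, hH, fun x => ?_⟩
  have h1 : (vertexProjOn Finset.univ : I → Module.End k (ZChains k m)) = fun _ => vertexProj :=
    funext fun i => by simp [vertexProjOn]
  rw [← tensEnd_vertexProj, ← h1]
  exact eq_sub_of_add_eq (LinearMap.congr_fun hH' x)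

end homotopy

/-! ### Solving `D φ = χ` value by value -/

section cochains

variable {I : Type}

lemma zPushTens_comp {m m' m'' : ℕ} (θ : ⦋m⦌ ⟶ ⦋m'⦌) (θ' : ⦋m'⦌ ⟶ ⦋m''⦌) (x : ZTens k I m) :
    zPushTens I θ' (zPushTens I θ x) = zPushTens I (θ ≫ θ') x := by
  refine ztens_induction (zPushTens I θ' ∘ₗ zPushTens I θ) (zPushTens I (θ ≫ θ')) (fun p => ?_) x
  simp only [LinearMap.comp_apply, zPushTens_single, Simp.push, Category.assoc]

lemma zPushTens_id {m : ℕ} (x : ZTens k I m) : zPushTens I (𝟙 ⦋m⦌) x = x := by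
  refine ztens_induction (zPushTens I (𝟙 ⦋m⦌)) LinearMap.id (fun p => ?_) x
  simp only [LinearMap.id_apply, zPushTens_single, Simp.push, Category.comp_id]

variable (k I) in
/-- The cosimplicial vector space `[m] ↦ Z([m])^{⊗ I}`. -/
def zTensCosimplicial : CosimplicialObject (ModuleCat.{u} k) where
  obj m := ModuleCat.of k (ZTens k I m.len)
  map θ := ModuleCat.ofHom (zPushTens I θ)
  map_id m := by
    exact ModuleCat.hom_ext (LinearMap.ext fun x => zPushTens_id x)
  map_comp θ θ' := by
    exact ModuleCat.hom_ext (LinearMap.ext fun x => (zPushTens_comp θ θ' x).symm)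

/-- The alternating sum of the cofaces of `Z([m])^{⊗ I}`. -/
def coboundary (l : ℕ) : ZTens k I l →ₗ[k] ZTens k I (l + 1) :=
  ∑ s : Fin (l + 2), (-1 : k) ^ (s : ℕ) • zPushTens I (SimplexCategory.δ s)

lemma coboundary_apply (l : ℕ) (x : ZTens k I l) : coboundary l x =
    ∑ s : Fin (l + 2), (-1 : k) ^ (s : ℕ) • zPushTens I (SimplexCategory.δ s) x := by
  simp [coboundary]

/-- Identifies the map with the differential of a cosimplicial vector space, whose square is zero by
`d_squared`. -/
lemma coboundary_eq (l : ℕ) : coboundary (k := k) (I := I) l =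
    (AlgebraicTopology.AlternatingCofaceMapComplex.objD (zTensCosimplicial k I) l).hom := by
  rw [AlgebraicTopology.AlternatingCofaceMapComplex.objD, ModuleCat.hom_sum, coboundary]
  refine Finset.sum_congr rfl fun s _ => LinearMap.ext fun x => ?_
  change (-1 : k) ^ (s : ℕ) • zPushTens I (SimplexCategory.δ s) x =
    (-1 : ℤ) ^ (s : ℕ) • zPushTens I (SimplexCategory.δ s) x
  rw [← Int.cast_smul_eq_zsmul k]
  push_cast
  rfl

lemma coboundary_coboundary (l : ℕ) (x : ZTens k I l) :
    coboundary (l + 1) (coboundary l x) = 0 := by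
  rw [coboundary_eq, coboundary_eq]
  exact LinearMap.congr_fun (congrArg ModuleCat.Hom.hom
    (AlgebraicTopology.AlternatingCofaceMapComplex.d_squared (zTensCosimplicial k I) l)) x

variable [Fintype I]

/-- The two cofaces preserve the augmentation and have opposite signs, so nothing is required of
`x`. -/
lemma zAug_coboundary_zero (x : ZTens k I 0) : zAug k 1 I (coboundary 0 x) = 0 := by
  rw [coboundary_apply, map_sum]
  simp [Fin.sum_univ_two, zAug_zPushTens]

lemma zAug_coboundary {l : ℕ} {x : ZTens k I l} (h : zAug k l I x = 0) :
    zAug k (l + 1) I (coboundary l x) = 0 := by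
  rw [coboundary_apply, map_sum]
  simp [zAug_zPushTens, h]

lemma zAug_eq_zero {l : ℕ} {x : ZTens k I l}
    (h : ∀ q : I → Simp l, (∀ i, (q i).1 = 0) → x q = 0) : zAug k l I x = 0 := by
  rw [zAug, Finsupp.linearCombination_apply]
  refine Finset.sum_eq_zero fun q _ => ?_
  change x q • (if ∀ i, (q i).1 = 0 then (1 : k) else 0) = 0
  by_cases hq : ∀ i, (q i).1 = 0
  · rw [h q hq, zero_smul]
  · rw [if_neg hq, smul_zero]

lemma zAug_zero (x : ZTens k I 0) : zAug k 0 I x = x (vertexTensor I) := by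
  refine ztens_induction (zAug k 0 I) (Finsupp.lapply (vertexTensor I)) (fun p => ?_) x
  rw [zAug_single, Finsupp.lapply_apply]
  split_ifs with h
  · have : p = vertexTensor I := funext fun i => simp_zero_ext _ (h i)
    rw [this, Finsupp.single_eq_same]
  · rw [Finsupp.single_eq_of_ne]
    rintro rfl
    exact h fun _ => rfl

/-- The elements of degree `n` with respect to the dimension shifted by `l`. -/
def IsHomog (n : ℤ) {l : ℕ} (x : ZTens k I l) : Prop :=
  ∀ q : I → Simp l, -(∑ i, ((q i).1 : ℤ)) ≠ -(l : ℤ) + n → x q = 0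

lemma isHomog_value {n : ℤ} (φ : ZHom k I n) (l : ℕ) : IsHomog n (φ.1 l (idChain k l)) :=
  fun q h => φ.2.2 l ⟨l, 𝟙 _⟩ q h

lemma zPushTens_apply_eq_zero {m m' : ℕ} (θ : ⦋m⦌ ⟶ ⦋m'⦌) (d : ℤ) (x : ZTens k I m)
    (hx : ∀ q : I → Simp m, ∑ i, ((q i).1 : ℤ) ≠ d → x q = 0) (q : I → Simp m')
    (hq : ∑ i, ((q i).1 : ℤ) ≠ d) : zPushTens I θ x q = 0 := by
  refine apply_eq_zero_of_support _ _ _ fun p hp => ?_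
  rw [zPushTens_single]
  refine Finsupp.single_eq_of_ne ?_
  rintro rfl
  exact hp (hx p hq)

lemma IsHomog.coboundary {n n' : ℤ} (h : n + 1 = n') {l : ℕ} {x : ZTens k I l}
    (hx : IsHomog n x) : IsHomog n' (coboundary l x) := by
  intro q hq
  rw [coboundary_apply, Finsupp.coe_finsetSum, Finset.sum_apply]
  refine Finset.sum_eq_zero fun s _ => ?_
  rw [Finsupp.smul_apply, zPushTens_apply_eq_zero _ ((l : ℤ) - n) x
    (fun p hp => hx p (by omega)) q (by push_cast at hq; omega), smul_zero]

/-- The element of `Z(I)` with given values at the identities. -/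
def zhomOf (n : ℤ) (v : ∀ l, ZTens k I l) (hv : ∀ l, IsHomog n (v l)) : ZHom k I n :=
  ⟨fun m => Finsupp.linearCombination k fun σ : Simp m => zPushTens I σ.2 (v σ.1), by
    refine ⟨fun m m' θ => ?_, fun m σ p hp => ?_⟩
    · refine Finsupp.lhom_ext' fun σ => LinearMap.ext_ring ?_
      simp only [LinearMap.comp_apply, Finsupp.lsingle_apply, zPush_single,
        Finsupp.linearCombination_single, one_smul, zPushTens_comp]
      rfl
    · rw [Finsupp.linearCombination_single, one_smul]
      exact zPushTens_apply_eq_zero _ ((σ.1 : ℤ) - n) _ (fun q hq => hv _ q (by omega)) p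
        (by omega)⟩

lemma zhomOf_value (n : ℤ) (v : ∀ l, ZTens k I l) (hv : ∀ l, IsHomog n (v l)) (l : ℕ) :
    (zhomOf n v hv).1 l (idChain k l) = v l := by
  refine (Finsupp.linearCombination_single _ _ _).trans ?_
  rw [one_smul]
  exact zPushTens_id _

lemma zhom_ext_value {n : ℤ} {φ φ' : ZHom k I n}
    (h : ∀ l, φ.1 l (idChain k l) = φ'.1 l (idChain k l)) : φ = φ' :=
  zhom_ext_coef fun a b p => congrArg (fun x : ZTens k I b => x fun i => ⟨a i, p i⟩) (h b)

lemma homotopy_isHomog {n n' : ℤ} (h : n + 1 = n') {l : ℕ} {H : Module.End k (ZTens k I l)}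
    (hH : ∀ p q : I → Simp l, ∑ i, (q i).1 ≠ ∑ i, (p i).1 + 1 → H (Finsupp.single p 1) q = 0)
    {x : ZTens k I l} (hx : IsHomog n' x) : IsHomog n (H x) := by
  intro q hq
  refine apply_eq_zero_of_support H x q fun p hp => hH p q fun h1 => ?_
  have h2 : -(∑ i, ((p i).1 : ℤ)) = -(l : ℤ) + n' := by
    by_contra h3
    exact hp (hx p h3)
  apply hq
  have h4 : ∑ i, ((q i).1 : ℤ) = ∑ i, ((p i).1 : ℤ) + 1 := by exact_mod_cast h1
  omega

/-- `H` raises the total dimension, so its values contain no tensor of vertices. -/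
lemma zAug_homotopy {l : ℕ} {H : Module.End k (ZTens k I l)}
    (hH : ∀ p q : I → Simp l, ∑ i, (q i).1 ≠ ∑ i, (p i).1 + 1 → H (Finsupp.single p 1) q = 0)
    (x : ZTens k I l) : zAug k l I (H x) = 0 := by
  refine zAug_eq_zero fun q hq => apply_eq_zero_of_support H x q fun p _ => hH p q ?_
  simp [hq]

variable [LinearOrder I]

lemma zDTens_coboundary (l : ℕ) (x : ZTens k I l) :
    zDTens I (l + 1) (coboundary l x) = coboundary l (zDTens I l x) := by
  simp only [coboundary_apply, map_sum, map_smul]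
  refine Finset.sum_congr rfl fun s _ => ?_
  exact congrArg _ (LinearMap.congr_fun (zDTens_comp_zPushTens (k := k) I (SimplexCategory.δ s)) x)

lemma zDiff_value_zero {n n' : ℤ} (h : n + 1 = n') (φ : ZHom k I n) :
    (zDiff n n' h φ).1 0 (idChain k 0) =
      -(((Int.negOnePow n : ℤ) : k) • zDTens I 0 (φ.1 0 (idChain k 0))) := by
  rw [← sign_smul_eq k]
  simp [zDiff, zD, Simp.bdry]

/-- On values at identities `D` is the differential of a total complex: the faces of `id_[l+1]` give
the coboundary of the preceding value, and the tensor power gives its chain differential. -/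
lemma zDiff_value_succ {n n' : ℤ} (h : n + 1 = n') (φ : ZHom k I n) (l : ℕ) :
    (zDiff n n' h φ).1 (l + 1) (idChain k (l + 1)) = coboundary l (φ.1 l (idChain k l)) -
      ((Int.negOnePow n : ℤ) : k) • zDTens I (l + 1) (φ.1 (l + 1) (idChain k (l + 1))) := by
  rw [← sign_smul_eq k]
  change φ.1 (l + 1) (zD (l + 1) (idChain k (l + 1))) - _ = _
  congr 1
  rw [zD_single, Simp.bdry, map_sum, coboundary_apply]
  refine Finset.sum_congr rfl fun s _ => ?_
  rw [← mul_one ((-1 : k) ^ (s : ℕ)), ← smul_eq_mul, ← Finsupp.smul_single, map_smul,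
    smul_eq_mul, mul_one, Category.comp_id, zhom_single]

lemma sign_mul_self (n : ℤ) : ((Int.negOnePow n : ℤ) : k) * ((Int.negOnePow n : ℤ) : k) = 1 := by
  rw [← Int.cast_mul, ← Units.val_mul, Int.units_mul_self]
  simp

lemma sign_succ {n n' : ℤ} (h : n + 1 = n') :
    ((Int.negOnePow n' : ℤ) : k) = -((Int.negOnePow n : ℤ) : k) := by
  rw [← h, Int.negOnePow_succ]
  simp

/-- Given the value `v` at `id_[l]`, the next one has to satisfy `c • d v' = w` with `w = coboundary
v - χ(id_[l+1])`. The equation for `v` together with `D χ = 0` makes `w` a cycle, and its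
augmentation is zero, so the contraction gives `d (H w) = w`. Since any homogeneous sequence of
values defines a natural family (`zhomOf`), the choices need not be compatible. -/
lemma exists_zDiff_eq_of_value_zero {n n' : ℤ} (h : n + 1 = n') (χ : ZHom k I n')
    (hχ : ∀ n'' (h' : n' + 1 = n''), zDiff n' n'' h' χ = 0)
    (hχ' : ∀ l, zAug k (l + 1) I (χ.1 (l + 1) (idChain k (l + 1))) = 0) (v₀ : ZTens k I 0)
    (hv₀ : IsHomog n v₀)
    (hv₀' : -(((Int.negOnePow n : ℤ) : k) • zDTens I 0 v₀) = χ.1 0 (idChain k 0)) :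
    ∃ φ : ZHom k I n, zDiff n n' h φ = χ ∧ φ.1 0 (idChain k 0) = v₀ := by
  set c : k := ((Int.negOnePow n : ℤ) : k) with hc
  have hcc : c * c = 1 := sign_mul_self n
  have hdχ : ∀ l, zDTens I (l + 1) (χ.1 (l + 1) (idChain k (l + 1))) =
      -(c • coboundary l (χ.1 l (idChain k l))) := by
    intro l
    have h1 := zDiff_value_succ (n' := n' + 1) rfl χ l
    rw [hχ, sign_succ h] at h1
    have h2 : 0 = coboundary l (χ.1 l (idChain k l)) +
        c • zDTens I (l + 1) (χ.1 (l + 1) (idChain k (l + 1))) := by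
      rw [← sub_neg_eq_add, ← neg_smul]
      exact h1
    have h3 := eq_neg_of_add_eq_zero_right h2.symm
    rw [← one_smul k (zDTens I (l + 1) _), ← hcc, mul_smul, h3, smul_neg]
  -- Besides homogeneity, this records what makes the next obstruction a cycle and of augmentation
  -- zero. At `l = 0` the last clause is automatic.
  let Good (l : ℕ) (v : ZTens k I l) : Prop :=
    IsHomog n v ∧ coboundary l (zDTens I l v) = -(c • coboundary l (χ.1 l (idChain k l))) ∧
      zAug k (l + 1) I (coboundary l v) = 0
  have good0 : Good 0 v₀ := by
    refine ⟨hv₀, ?_, zAug_coboundary_zero _⟩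
    rw [← hv₀', map_neg, map_smul, smul_neg, smul_smul, hcc, one_smul, neg_neg]
  have step : ∀ l v, Good l v → ∃ v' : ZTens k I (l + 1), Good (l + 1) v' ∧
      coboundary l v - c • zDTens I (l + 1) v' = χ.1 (l + 1) (idChain k (l + 1)) := by
    rintro l v ⟨h1, h2, h3⟩
    obtain ⟨H, hH, hH'⟩ := exists_homotopy k (l + 1) I
    set w := coboundary l v - χ.1 (l + 1) (idChain k (l + 1)) with hw
    have hw1 : zDTens I (l + 1) w = 0 := by
      rw [hw, map_sub, zDTens_coboundary, h2, hdχ, sub_self]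
    have hw2 : zDTens I (l + 1) (H w) = w := by
      have := hH' w
      have hw0 : zAug k (l + 1) I w = 0 := by
        rw [hw, map_sub, h3, hχ' l, sub_zero]
      rwa [hw1, map_zero, add_zero, hw0, zero_smul, sub_zero] at this
    have hw3 : c • zDTens I (l + 1) (c • H w) = w := by
      rw [map_smul, smul_smul, hcc, one_smul, hw2]
    have hw4 : IsHomog n' w := fun q hq => by
      rw [hw, Finsupp.sub_apply, h1.coboundary h q hq, isHomog_value χ (l + 1) q hq, sub_zero]
    -- The factor `c` is right because `c * c = 1`; values of `H` have augmentation zero, which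
    -- preserves the last clause of `Good`.
    refine ⟨c • H w, ⟨fun q hq => ?_, ?_, ?_⟩, ?_⟩
    · rw [Finsupp.smul_apply, homotopy_isHomog h hH hw4 q hq, smul_zero]
    · rw [map_smul, hw2, map_smul, hw, map_sub, coboundary_coboundary, zero_sub, smul_neg]
    · refine zAug_coboundary ?_
      rw [map_smul, zAug_homotopy hH, smul_zero]
    · rw [hw3, hw, sub_sub_cancel]
  choose next hnext hnext' using step
  let v (l : ℕ) : {v : ZTens k I l // Good l v} :=
    Nat.rec ⟨v₀, good0⟩ (fun l v => ⟨next l v.1 v.2, hnext l v.1 v.2⟩) l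
  refine ⟨zhomOf n (fun l => (v l).1) (fun l => (v l).2.1), zhom_ext_value fun l => ?_,
    zhomOf_value _ _ _ 0⟩
  cases l with
  | zero =>
    rw [zDiff_value_zero, zhomOf_value]
    exact hv₀'
  | succ l =>
    rw [zDiff_value_succ, zhomOf_value, zhomOf_value]
    exact hnext' l (v l).1 (v l).2

/-- As `n' ≤ 0`, the value of `χ` at `id_[l+1]` has total dimension `l + 1 - n' > 0`, hence
augmentation zero. At `id_[0]` this is the hypothesis on `augZ`, and the contraction for `Δ^0`
provides the initial value. -/
theorem exists_zDiff_eq {n n' n'' : ℤ} (h : n + 1 = n') (h' : n' + 1 = n'') (hn' : n' ≤ 0)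
    (χ : ZHom k I n') (hχ : zDiff n' n'' h' χ = 0) (hε : augZ I n' χ = 0) :
    ∃ φ : ZHom k I n, zDiff n n' h φ = χ := by
  obtain ⟨H, hH, hH'⟩ := exists_homotopy k 0 I
  have h0 : zDTens I 0 (χ.1 0 (idChain k 0)) = 0 := by
    have h1 := zDiff_value_zero h' χ
    rw [hχ] at h1
    have h2 : ((Int.negOnePow n' : ℤ) : k) • zDTens I 0 (χ.1 0 (idChain k 0)) = 0 :=
      neg_eq_zero.1 h1.symm
    rw [← one_smul k (zDTens I 0 _), ← sign_mul_self n', mul_smul, h2, smul_zero]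
  have h1 := hH' (χ.1 0 (idChain k 0))
  rw [h0, map_zero, add_zero, zAug_zero, ← augZ_eq, hε, zero_smul, sub_zero] at h1
  obtain ⟨φ, hφ, -⟩ := exists_zDiff_eq_of_value_zero h χ (fun _ h'' => by subst h''; subst h'; exact hχ)
    (fun l => zAug_eq_zero fun q hq => isHomog_value χ (l + 1) q (by simp [hq]; omega))
    (-(((Int.negOnePow n : ℤ) : k) • H (χ.1 0 (idChain k 0)))) (fun q hq => by
      rw [Finsupp.neg_apply, Finsupp.smul_apply,
        homotopy_isHomog h hH (isHomog_value χ 0) q hq, smul_zero, neg_zero])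
    (by rw [map_neg, map_smul, smul_neg, neg_neg, smul_smul, sign_mul_self, one_smul, h1])
  exact ⟨φ, hφ⟩

variable (k I) in
-- The case `χ = 0`, started from the tensor of vertices: a natural chain map of Alexander–Whitney
-- type, obtained by acyclicity.
theorem exists_cocycle_augZ_eq_one :
    ∃ φ : ZHom k I 0, (∀ n (h : 0 + 1 = n), zDiff 0 n h φ = 0) ∧ augZ I 0 φ = 1 := by
  obtain ⟨φ, hφ, hφ'⟩ := exists_zDiff_eq_of_value_zero (n := 0) (n' := 1) (zero_add 1)
    (0 : ZHom k I 1) (fun _ _ => map_zero _) (fun l => map_zero _)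
    (Finsupp.single (vertexTensor I) 1) (fun q hq => by
      refine Finsupp.single_eq_of_ne ?_
      rintro rfl
      exact hq (by simp))
    (by simp [zDTens, Simp.bdry])
  refine ⟨φ, fun n h => ?_, ?_⟩
  · obtain rfl : n = 1 := by omega
    exact hφ
  · rw [augZ_eq, hφ', Finsupp.single_eq_same]

end cochains

/-! ### The augmentation is a quasi-isomorphism -/

section quasiIso

lemma lTensor_prod_eq_zero {M N P Q : Type*} [AddCommGroup M] [Module k M] [AddCommGroup N]
    [Module k N] [AddCommGroup P] [Module k P] [AddCommGroup Q] [Module k Q] (f : N →ₗ[k] P)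
    (g : N →ₗ[k] Q) (x : M ⊗[k] N) (hf : f.lTensor M x = 0) (hg : g.lTensor M x = 0) :
    (f.prod g).lTensor M x = 0 := by
  have h : (TensorProduct.prodRight k k M P Q).toLinearMap ∘ₗ (f.prod g).lTensor M =
      (f.lTensor M).prod (g.lTensor M) := TensorProduct.ext' fun m n => by simp
  refine (TensorProduct.prodRight k k M P Q).injective ?_
  refine (LinearMap.congr_fun h x).trans ?_
  rw [map_zero]
  exact Prod.ext hf hg

variable {I : Type} [Fintype I] [LinearOrder I]

/-- By flatness of `Lie k I` a tensor killed by `D` and by the augmentation comes from `Lie k I ⊗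
ker (D, augZ)`, and pure tensors there are treated by `exists_zDiff_eq`. -/
theorem exists_lTensor_zDiff_eq {n n' n'' : ℤ} (h : n + 1 = n') (h' : n' + 1 = n'') (hn' : n' ≤ 0)
    (x : Lie k I ⊗[k] ZHom k I n') (hx : (zDiff n' n'' h').lTensor (Lie k I) x = 0)
    (hε : augT I n' x = 0) : ∃ y, (zDiff n n' h).lTensor (Lie k I) y = x := by
  let g := (zDiff (k := k) n' n'' h').prod (augZ I n')
  suffices hg : g.lTensor (Lie k I) x = 0 by
    obtain ⟨z, rfl⟩ := (Module.Flat.lTensor_exact (Lie k I) (LinearMap.exact_subtype_ker_map g) x).1 hg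
    clear hx hε hg
    induction z using TensorProduct.induction_on with
    | zero => exact ⟨0, by simp only [map_zero]⟩
    | add z z' hz hz' =>
      obtain ⟨y, hy⟩ := hz
      obtain ⟨y', hy'⟩ := hz'
      exact ⟨y + y', by rw [map_add, map_add, hy, hy']⟩
    | tmul ψ χ =>
      obtain ⟨h2, h3⟩ := Prod.mk.inj (LinearMap.mem_ker.1 χ.2)
      obtain ⟨φ, hφ⟩ := exists_zDiff_eq h h' hn' χ.1 h2 h3
      exact ⟨ψ ⊗ₜ φ, by rw [LinearMap.lTensor_tmul, hφ]; rfl⟩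
  refine lTensor_prod_eq_zero _ _ x hx ?_
  exact (LinearEquiv.map_eq_zero_iff (TensorProduct.rid k (Lie k I))).1 hε

variable (h : (LieEZ k).IsSub (LieEZ k).tau)

theorem isQuasiIso_augmentation : DGPTData.IsQuasiIso (LieEZTrunc k h) (LieOp k).toDG (fun _ => ())
    (augmentation h) where
  injective {I _ _ _ y x} n n' n'' hn hn' a ha hb := by
    obtain ⟨b, hb⟩ := hb
    have h1 : augT I n' a.1 = 0 := by
      rw [← augmentation_val h y x n' a, ← hb]
      rfl
    by_cases h0 : 0 < n'
    · exact ⟨0, Subtype.ext ((map_zero _).trans (a.2.1 h0).symm)⟩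
    · obtain ⟨z, hz⟩ := exists_lTensor_zDiff_eq hn hn' (not_lt.1 h0) a.1 (congrArg Subtype.val ha) h1
      -- `z` has degree `n = n' - 1 < 0`, where the truncation imposes no condition.
      exact ⟨⟨z, fun _ => by omega, fun _ => by omega⟩, Subtype.ext hz⟩
  surjective {I _ _ _ y x} n n' n'' hn hn' b hb := by
    by_cases h0 : n' = 0
    · subst h0
      obtain ⟨φ, hφ, hφ'⟩ := exists_cocycle_augZ_eq_one k I
      have h1 : ∀ n (hn : 0 + 1 = n), (zDiff 0 n hn).lTensor (Lie k I) (b.1 ⊗ₜ φ) = 0 := by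
        intro n hn
        rw [LinearMap.lTensor_tmul, hφ, TensorProduct.tmul_zero]
      refine ⟨⟨b.1 ⊗ₜ φ, fun h0 => absurd h0 (lt_irrefl 0),
        fun _ => h1 _ rfl⟩, Subtype.ext (h1 _ hn'), 0, ?_⟩
      rw [map_zero, add_zero]
      apply Subtype.ext
      rw [augmentation_val]
      refine (augT_tmul b.1 φ).trans ?_
      rw [hφ', one_smul]
    · refine ⟨0, map_zero _, 0, ?_⟩
      rw [map_zero, map_zero, add_zero]
      exact Subtype.ext (b.2 h0).symm

end quasiIso

end HomotopyLie

end

/-! ### The theorem -/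

open HomotopyLie
theorem theorem3p1p3 {k : Type u} [Field k] [CharZero k] (C : PTCat.{u, v, w} k)
    (B : CosimplicialLie C) :
    (complexes C).Lawful ∧ (LieEZ k).Lawful ∧
    DGPTData.IsFunctor (LieEZ k) (complexes C) (fun _ => MB B) (F B) ∧
    ∃ h : (LieEZ k).IsSub (LieEZ k).tau,
      IsHomotopyLieOperad (LieEZTrunc k h) (augmentation h) ∧
      DGPTData.IsFunctor (LieEZTrunc k h) (complexes C) (fun _ => MB B) (FTrunc B h) := by
  refine ⟨Cx.lawful C, lawful_LieEZ, isFunctor_F B, DGPTData.isSub_tau lawful_LieEZ, ?_,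
    DGPTData.IsFunctor.comp_subtype _ (isFunctor_F B)⟩
  exact {
    unique := ⟨{ default := ((), ()), uniq := fun _ => rfl }⟩
    lawful := DGPTData.sub_lawful _ lawful_LieEZ
    isFunctor := isFunctor_augmentation _
    isQuasiIso := isQuasiIso_augmentation _ }
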